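/- **Setting.** Let $n\ge 1$, let $X_1,\dots,X_n$ be exchangeable real random variables, $S_0=0$, $S_j=X_1+\dots+X_j$, and $S^{[0,n]}=\{(j,S_j):0\le j\le n\}$. Let $\bar C^{[0,n]}$ be the concave majorant of $S^{[0,n]}$, i.e. the least concave function on $[0,n]$ with $\bar C^{[0,n]}(j)\ge S_j$ for $0\le j\le n$; functions on $[0,n]$ carry the $\sigma$-algebra generated by the evaluations. A composition $\nu=(n_1,\dots,n_k)$ of $n$ has block end points $e_i=n_1+\dots+n_i$ ($e_0=0$) and blocks $\{e_{i-1}+1,\dots,e_i\}$. *The rearranged walk and its segment composition.* Independently of $X$, let $L=(L_1,\dots,L_K)$ be the cycle lengths, in non-increasing order, of a uniform random permutation of $[n]$, and cut $[n]$ into consecutive blocks of lengths $L_1,\dots,L_K$. Given $X$ and $L$, let $\rho$ be uniform among the permutations $\sigma$ of $[n]$ that put these blocks in some order $\tau$ and cyclically shift each of them, such that, in the new order, (i) the arithmetic means of the $X_{\sigma(\ell)}$ over the successive blocks are non-increasing, and (ii) within each block the walk with increments $X_{\sigma(\ell)}$ does not exceed the chord joining its values at the two ends of the block. Let $\Xi^K=(L_{\tau(1)},\dots,L_{\tau(K)})$,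 where $\tau$ is the block order of $\rho$, and let $\bar C_\rho$ be the concave majorant of the walk with increments $X_{\rho(1)},\dots,X_{\rho(n)}$. For a concave function $c$ that is affine between consecutive integers, a face is a maximal interval on which $c$ is affine; let $f(c)$ be the number of faces, let $\mathcal N(c)$ be the set of compositions of $n$ such that every end point of a face of $c$ is $0$ or a block end point, and for $\nu\in\mathcal N(c)$ let $k_j(\nu)$ be the number of blocks of $\nu$ lying in the $j$-th face of $c$. **Theorem.** Let $q_c(\cdot)$ be any version of the regular conditional law of $\Xi^K$ given $\bar C_\rho=c$, and, for each composition $\nu=(n_1,\dots,n_k)$ of $n$, let $\kappa_\nu$ be any version of the regular conditional law of $(X_1,\dots,X_n)$ given $(S_{e_1},\dots,S_{e_k})$. 1. For every composition $\nu=(n_1,\dots,n_k)$ of $n$, $$\mathbb P(\bar C^{[0,n]}\in dc)\,q_c(\nu)=\mathbf 1\{\nu\in\mathcal N(c)\}\,\frac{1}{\prod_{i=1}^k n_i\ \prod_{j=1}^{f(c)}k_j(\nu)!}\ \mathbb P\big(S_{e_i}\in dc(e_i),\ 1\le i\le k\big),$$ that is, for every measurable set $A$ of functions on $[0,n]$,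 $$\int_A q_c(\nu)\,\mathbb P(\bar C^{[0,n]}\in dc)=\mathbb E\Big[\mathbf 1\{I_\nu\in A,\ I_\nu\text{ concave},\ \nu\in\mathcal N(I_\nu)\}\prod_{i=1}^k\frac1{n_i}\prod_{j=1}^{f(I_\nu)}\frac1{k_j(\nu)!}\Big],$$ where $k_j(\nu)$ refers to the faces of $I_\nu$, and $I_\nu$ is the function on $[0,n]$ that is affine on each $[e_{i-1},e_i]$ and equals $S_{e_i}$ at $e_i$, $0\le i\le k$. 2. For almost every $\bar c$ with respect to the law of $\bar C^{[0,n]}$, the regular conditional law of $S^{[0,n]}$ given $\bar C^{[0,n]}=\bar c$ is the law of the walk obtained as follows. Choose a composition $\nu=(n_1,\dots,n_k)$ with law $q_{\bar c}$. Given $\nu$, sample $(Y_1,\dots,Y_n)$ from $\kappa_\nu$ at the values $(\bar c(e_1),\dots,\bar c(e_k))$, i.e. from the conditional law of $(X_1,\dots,X_n)$ given $S_{e_i}=\bar c(e_i)$, $1\le i\le k$. Let $B$ be the set of all permutations $\sigma$ of $[n]$ that cyclically permute each block of $\nu$ and satisfy $\sum_{\ell=1}^jY_{\sigma(\ell)}\le\bar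 c(j)$ for $1\le j\le n$; given $\nu$ and $Y$, choose $\hat\rho$ uniformly from $B$, and take the walk with positions $S^{\hat\rho}_j=\sum_{\ell=1}^jY_{\hat\rho(\ell)}$, $0\le j\le n$. -/

import Mathlib

open MeasureTheory ProbabilityTheory
open scoped ENNReal Nat

namespace ConcaveMajorantWalk

noncomputable section

/-! ### Walks and concave majorants -/

/-- `X_1, …, X_n` are exchangeable: permuting them does not change their joint law. -/
def Exchangeable {Ω : Type*} [MeasurableSpace Ω] {n : ℕ} (P : Measure Ω)
    (X : Fin n → Ω → ℝ) : Prop :=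
  ∀ σ : Equiv.Perm (Fin n), P.map (fun ω i => X (σ i) ω) = P.map (fun ω i => X i ω)

/-- `walk x j = x_1 + ⋯ + x_j`, the position at time `j` of the walk with increments `x`. -/
def walk {n : ℕ} (x : Fin n → ℝ) (j : ℕ) : ℝ :=
  ∑ i ∈ Finset.univ.filter (fun i : Fin n => (i : ℕ) < j), x i

/-- The walk on `[0, n]` as a whole: the list of its positions at the times `0, …, n`. -/
def path {n : ℕ} (x : Fin n → ℝ) : Fin (n + 1) → ℝ := fun j => walk x j

/-- Real functions on the interval `[0, n]`, with the σ-algebra generated by the evaluations. -/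
abbrev Profile (n : ℕ) : Type := Set.Icc (0 : ℝ) n → ℝ

/-- The value of a function on `[0, n]` at the point `t` of `[0, n]` (outside of `[0, n]` the
function is continued by its boundary values). -/
def Profile.val {n : ℕ} (c : Profile n) (t : ℝ) : ℝ :=
  Set.IccExtend (Nat.cast_nonneg n : (0 : ℝ) ≤ n) c t

/-- The concave majorant of the points `(j, s j)`, `0 ≤ j ≤ n`: the pointwise smallest concave
function on `[0, n]` that lies above all of them. -/
def concaveMajorant {n : ℕ} (s : Fin (n + 1) → ℝ) : Profile n := fun t =>
  sInf {y : ℝ | ∃ g : ℝ → ℝ, ConcaveOn ℝ (Set.Icc (0 : ℝ) n) g ∧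
    (∀ j : Fin (n + 1), s j ≤ g (j : ℕ)) ∧ g t = y}

/-! ### Uniform choices -/

instance instMeasurableSpaceComposition (n : ℕ) : MeasurableSpace (Composition n) := ⊤

/-- The law of the outcome of the following experiment: choose `a` uniformly from the finite set
`s`, then sample from `m a`. -/
def uniformMix {α β : Type*} [MeasurableSpace β] (s : Finset α) (m : α → Measure β) :
    Measure β :=
  (s.card : ℝ≥0∞)⁻¹ • ∑ a ∈ s, m a

/-! ### The rearranged walk and its segment composition -/

/-- The cycle lengths (fixed points included) of a permutation of `[n]`, in non-increasing
order. -/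
def cycleLengths {n : ℕ} (π : Equiv.Perm (Fin n)) : Composition n where
  blocks := π.partition.parts.sort (fun a b => b ≤ a)
  blocks_pos := by
    intro i hi
    rw [Multiset.mem_sort] at hi
    exact π.partition.parts_pos hi
  blocks_sum := by
    rw [← Multiset.sum_coe, Multiset.sort_eq, π.partition.parts_sum, Fintype.card_fin]

/-- The composition `(n_{τ(1)}, …, n_{τ(k)})` obtained from `L = (n_1, …, n_k)`. -/
def arrange {n : ℕ} (L : Composition n) (τ : Equiv.Perm (Fin L.length)) : Composition n where
  blocks := List.ofFn fun i => L.blocksFun (τ i)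
  blocks_pos := by
    intro i hi
    rw [List.mem_ofFn] at hi
    obtain ⟨j, rfl⟩ := hi
    exact L.one_le_blocksFun (τ j)
  blocks_sum := by
    rw [List.sum_ofFn, Equiv.sum_comp τ L.blocksFun, L.sum_blocksFun]

/-- `σ` puts the blocks of `L` in the order `τ` and cyclically shifts each block: for some shifts
`r`, the `j`-th place of the `i`-th new block holds the place `j + r i` (modulo the length) of the
old block `τ i` (everything counted from `0`). -/
def IsBlockArrangement {n : ℕ} (L : Composition n) (τ : Equiv.Perm (Fin L.length))
    (σ : Equiv.Perm (Fin n)) : Prop :=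
  ∃ r : Fin L.length → ℕ, ∀ (i : Fin L.length) (j : ℕ), j < L.blocksFun (τ i) →
    ∀ a : Fin n, (a : ℕ) = (arrange L τ).sizeUpTo i + j →
      (σ a : ℕ) = L.sizeUpTo (τ i) + (j + r i) % L.blocksFun (τ i)

/-- The arithmetic mean of the `m` increments that follow time `a`. -/
def meanAfter {n : ℕ} (x : Fin n → ℝ) (a m : ℕ) : ℝ := (walk x (a + m) - walk x a) / m

/-- With the blocks arranged in the order `τ` and the increments `z`, the block means are
non-increasing and within every block the walk stays below the chord of the block. -/
def IsMajorizing {n : ℕ} (L : Composition n) (τ : Equiv.Perm (Fin L.length))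
    (z : Fin n → ℝ) : Prop :=
  (∀ i j : Fin L.length, i ≤ j →
    meanAfter z ((arrange L τ).sizeUpTo j) (L.blocksFun (τ j)) ≤
      meanAfter z ((arrange L τ).sizeUpTo i) (L.blocksFun (τ i))) ∧
  ∀ (i : Fin L.length) (m : ℕ), 1 ≤ m → m ≤ L.blocksFun (τ i) →
    meanAfter z ((arrange L τ).sizeUpTo i) m ≤
      meanAfter z ((arrange L τ).sizeUpTo i) (L.blocksFun (τ i))

open Classical in
/-- The admissible rearrangements `σ` of the increments `x`, each listed together with its block
order `τ`. As `σ` determines `τ`, a uniform choice of a pair is a uniform choice of `σ`. -/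
def goodArrangements {n : ℕ} (L : Composition n) (x : Fin n → ℝ) :
    Finset (Equiv.Perm (Fin L.length) × Equiv.Perm (Fin n)) :=
  Finset.univ.filter fun p =>
    IsBlockArrangement L p.1 p.2 ∧ IsMajorizing L p.1 (fun i => x (p.2 i))

/-- The joint law of the segment composition and of the rearranged walk, for increments with joint
law `μ`: take the cycle lengths `L` of a uniform random permutation that is independent of the
increments, and choose uniformly an admissible rearrangement `(τ, ρ)`; the segment composition
lists the lengths of the blocks in their new order, and the rearranged walk has the increments
`X_{ρ(1)}, …, X_{ρ(n)}`. -/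
def rearrangementLaw {n : ℕ} (μ : Measure (Fin n → ℝ)) :
    Measure (Composition n × (Fin (n + 1) → ℝ)) :=
  μ.bind fun x =>
    uniformMix (Finset.univ : Finset (Equiv.Perm (Fin n))) fun π =>
      uniformMix (goodArrangements (cycleLengths π) x) fun p =>
        Measure.dirac (arrange (cycleLengths π) p.1, path fun i => x (p.2 i))

/-! ### Faces, and the explicit weights of the segment compositions -/

/-- The end points of the faces of a concave majorant `c` of a walk: `0`, `n`, and the integers in
between at which the slope of `c` changes (`c` is affine between consecutive integers). -/
def faceEnds {n : ℕ} (c : Profile n) : CompositionAsSet n where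
  boundaries := Finset.univ.filter fun j : Fin (n + 1) =>
    j = 0 ∨ j = Fin.last n ∨
      c.val ((j : ℕ) + 1) - c.val (j : ℕ) ≠ c.val (j : ℕ) - c.val ((j : ℕ) - 1)
  zero_mem := by simp
  getLast_mem := by simp

/-- The composition of `n` given by the lengths of the faces of `c` in their order. -/
def faces {n : ℕ} (c : Profile n) : Composition n := (faceEnds c).toComposition

/-- `ν` is obtained by splitting every face length of `c` into one or more blocks, that is, every
end point of a face of `c` is an end point of a block of `ν`. -/
def RefinesFaces {n : ℕ} (ν : Composition n) (c : Profile n) : Prop :=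
  (faceEnds c).boundaries ⊆ ν.boundaries

/-- The number of blocks of `ν` that lie in the `j`-th face of `c`. -/
def blocksInFace {n : ℕ} (ν : Composition n) (c : Profile n) (j : Fin (faces c).length) : ℕ :=
  (Finset.univ.filter fun i : Fin ν.length =>
    (faces c).sizeUpTo j ≤ ν.sizeUpTo i ∧
      ν.sizeUpTo (i + 1) ≤ (faces c).sizeUpTo (j + 1)).card

open Classical in
/-- `1 / (n_1 ⋯ n_k · k_1! ⋯ k_f!)` if `c` is concave and `ν = (n_1, …, n_k)` refines the face
composition of `c`, with `k_j` the number of blocks in the `j`-th face; otherwise `0`. -/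
def segmentWeight {n : ℕ} (ν : Composition n) (c : Profile n) : ℝ≥0∞ :=
  if ConcaveOn ℝ (Set.Icc (0 : ℝ) n) c.val ∧ RefinesFaces ν c then
    (((∏ i : Fin ν.length, ν.blocksFun i) *
      ∏ j : Fin (faces c).length, (blocksInFace ν c j)! : ℕ) : ℝ≥0∞)⁻¹
  else 0

/-- The positions of the walk at the right end points of the blocks of `ν`. -/
def blockEndValues {n : ℕ} (ν : Composition n) (x : Fin n → ℝ) : Fin ν.length → ℝ :=
  fun i => walk x (ν.sizeUpTo (i + 1))

/-- The values of a function on `[0, n]` at the right end points of the blocks of `ν`. -/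
def blockEndValuesOf {n : ℕ} (ν : Composition n) (c : Profile n) : Fin ν.length → ℝ :=
  fun i => c.val (ν.sizeUpTo (i + 1))

/-- The function on `[0, n]` that is affine on every block of `ν` and agrees with the walk at the
block end points. The `i`-th summand vanishes before the block, has the mean of the increments in
the block as its slope on the block, and is constant after it. -/
def blockChords {n : ℕ} (ν : Composition n) (x : Fin n → ℝ) : Profile n := fun t =>
  ∑ i : Fin ν.length, meanAfter x (ν.sizeUpTo i) (ν.blocksFun i) *
    max 0 (min ((t : ℝ) - ν.sizeUpTo i) (ν.blocksFun i))

/-! ### The walk built from a given concave majorant -/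

/-- `σ` cyclically permutes each block of `ν`: it maps the `j`-th place of the `i`-th block to the
place `j + r i` (modulo the length) of that block (places counted from `0`). -/
def IsBlockCyclic {n : ℕ} (ν : Composition n) (σ : Equiv.Perm (Fin n)) : Prop :=
  ∃ r : Fin ν.length → ℕ, ∀ (i : Fin ν.length) (j : ℕ), j < ν.blocksFun i →
    ∀ a : Fin n, (a : ℕ) = ν.sizeUpTo i + j →
      (σ a : ℕ) = ν.sizeUpTo i + (j + r i) % ν.blocksFun i

open Classical in
/-- The blockwise cyclic permutations `σ` for which the walk with increments
`y_{σ(1)}, …, y_{σ(n)}` stays below `c`. -/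
def goodShifts {n : ℕ} (ν : Composition n) (c : Profile n) (y : Fin n → ℝ) :
    Finset (Equiv.Perm (Fin n)) :=
  Finset.univ.filter fun σ =>
    IsBlockCyclic ν σ ∧ ∀ j : ℕ, 1 ≤ j → j ≤ n → walk (fun i => y (σ i)) j ≤ c.val j

/-- The law of the walk obtained from `c` in three steps: choose a composition `ν` with law `q c`;
sample `Y` from `κ ν`, evaluated at the values of `c` at the block end points of `ν`; and apply a
uniformly chosen element of `goodShifts ν c Y` to the increments `Y`. -/
def threeStepLaw {n : ℕ} (q : Kernel (Profile n) (Composition n))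
    (κ : (ν : Composition n) → Kernel (Fin ν.length → ℝ) (Fin n → ℝ)) (c : Profile n) :
    Measure (Fin (n + 1) → ℝ) :=
  ∑ ν : Composition n, q c {ν} •
    (κ ν (blockEndValuesOf ν c)).bind fun y =>
      uniformMix (goodShifts ν c y) fun σ => Measure.dirac (path fun i => y (σ i))

end

end ConcaveMajorantWalk

namespace ConcaveMajorantWalk

/-! Let `μ` be the exchangeable law of the increments. For fixed block lengths, the number of
admissible rearrangements of `x` is a product of two counts: the ways to shift each block cyclically
so that it stays below its chord, and the orders of blocks with equal slopes
(`card_goodArrangements`). Both counts can be read off from the rearranged walk and its segment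
composition, so the reciprocal of the number is a function `segmentProb` of these two alone.
Exchangeability then replaces `x ∘ σ` by `x` for every fixed block arrangement `σ`, and only
counting remains. The pairs of a permutation and an order of its cycle lengths that produce `ν =
(n_1, …, n_k)` number `n! / ∏ n_i` (`sum_arrange_cycleLengths`), each pair comes with `∏ n_i` block
arrangements, and everything cancels: the joint law of segment composition and rearranged walk has
the density `segmentProb ν s` with respect to counting measure times the law of the original walk
(`lintegral_rearrangementLaw`).

For each fixed path these densities add up to `1` (`sum_segmentProb`). If the path touches a face of
its majorant at `r` times after the start of the face, the blocks in this face split these touching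
times into runs `c_1, …, c_k` with weight `1 / (c_1 ⋯ c_k k!)`, and the sum of these weights is the
total mass of the law of the number of cycles of a uniform permutation of `r` objects. Hence the
rearranged walk has the law of the original one, and `segmentProb` is the conditional law of the
segment composition given the walk.

Finally, average over the `∏ n_i` cyclic permutations of the blocks of `ν`
(`lintegral_segmentProb_mul`). The chords, and the orders of blocks with equal slopes, do not
change. The averaging contributes `1 / ∏ n_i`, the equal slopes contribute `1 / ∏ k_j!`, and the
rest is the mean over the good shifts. With the test function `1` this is the formula for `q`. With
the indicator of a path event, the formula for `q` and the disintegration of `μ` by the block end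
values turn it into the three-step construction (`map_path_eq_compProd_threeStepKernel`). -/

/-! ### Counting identities; the number of cycles of a uniform permutation -/

/-- Within a fiber of size `k` the numbers of later-or-equal elements run through `k, …, 1`. This
turns the factorials of face multiplicities into a product of ranks, which suits a recursion over
blocks. -/
theorem prod_factorial_card_fiber {α : Type*} [DecidableEq α] (f : ℕ → α) (s : Finset ℕ) :
    ∏ v ∈ s.image f, (s.filter fun i => f i = v).card ! =
      ∏ i ∈ s, (s.filter fun j => i ≤ j ∧ f j = f i).card := by
  induction s using Finset.induction_on_min with
  | empty => simp
  | insert a s ha ih =>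
    have has : a ∉ s := fun h => lt_irrefl _ (ha a h)
    rw [Finset.prod_insert has]
    have h1 : ((insert a s).filter fun j => a ≤ j ∧ f j = f a).card =
        (s.filter fun j => f j = f a).card + 1 := by
      rw [Finset.filter_insert, if_pos ⟨le_rfl, rfl⟩, Finset.card_insert_of_notMem (by simp [has])]
      congr 2
      ext j
      simp only [Finset.mem_filter]
      exact ⟨fun h => ⟨h.1, h.2.2⟩, fun h => ⟨h.1, (ha j h.1).le, h.2⟩⟩
    have h2 : ∀ i ∈ s, ((insert a s).filter fun j => i ≤ j ∧ f j = f i).card =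
        (s.filter fun j => i ≤ j ∧ f j = f i).card := by
      intro i hi
      rw [Finset.filter_insert, if_neg (fun h => absurd (ha i hi) (not_lt.2 h.1))]
    rw [h1, Finset.prod_congr rfl h2, ← ih, Finset.image_insert]
    have h3 : ∀ t : Finset α, f a ∉ t →
        ∏ v ∈ t, ((insert a s).filter fun i => f i = v).card ! =
        ∏ v ∈ t, (s.filter fun i => f i = v).card ! := by
      intro t ht
      refine Finset.prod_congr rfl fun v hv => ?_
      rw [Finset.filter_insert, if_neg (fun h : f a = v => ht (h ▸ hv))]
    have h4 : ((insert a s).filter fun i => f i = f a).card =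
        (s.filter fun i => f i = f a).card + 1 := by
      rw [Finset.filter_insert, if_pos rfl, Finset.card_insert_of_notMem (by simp [has])]
    by_cases hm : f a ∈ s.image f
    · rw [Finset.insert_eq_of_mem hm, ← Finset.insert_erase hm,
        Finset.prod_insert (Finset.notMem_erase _ _), Finset.prod_insert (Finset.notMem_erase _ _),
        h3 _ (Finset.notMem_erase _ _), h4, Nat.factorial_succ, mul_assoc]
    · rw [Finset.prod_insert hm, h3 _ hm, h4]
      have : (s.filter fun i => f i = f a) = ∅ := by
        rw [Finset.filter_eq_empty_iff]
        exact fun i hi h => hm (Finset.mem_image.2 ⟨i, hi, h⟩)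
      simp [this]

/-- The rank within `s` is a bijection onto `1, …, |s|`. It serves to index the touching times of a
face by their rank. -/
theorem sum_comp_rank {M : Type*} [AddCommMonoid M] (g : ℕ → M) (s : Finset ℕ) :
    ∑ b ∈ s, g (s.filter fun j => j ≤ b).card = ∑ c ∈ Finset.Icc 1 s.card, g c := by
  induction s using Finset.induction_on_max with
  | empty => simp
  | insert a s ha ih =>
    have has : a ∉ s := fun h => lt_irrefl _ (ha a h)
    rw [Finset.sum_insert has, Finset.card_insert_of_notMem has,
      Finset.sum_Icc_succ_top (by omega), ← ih, add_comm]
    congr 1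
    · refine Finset.sum_congr rfl fun b hb => ?_
      rw [Finset.filter_insert, if_neg (not_le.2 (ha b hb))]
    · rw [Finset.filter_true_of_mem, Finset.card_insert_of_notMem has]
      intro j hj
      rcases Finset.mem_insert.1 hj with rfl | hj
      · exact le_rfl
      · exact (ha j hj).le

/-- The sum of `(c₁ ⋯ c_k · k!)⁻¹` over the compositions `(c₁, …, c_k)` of `r` into `k` parts. -/
noncomputable def cycleWeight : ℕ → ℕ → NNReal
  | 0, r => if r = 0 then 1 else 0
  | k + 1, r => ∑ c ∈ Finset.Icc 1 r, ((c * (k + 1) : ℕ) : NNReal)⁻¹ * cycleWeight k (r - c)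

/-- With `ℓ = -log (1 - x)`, the generating function of `cycleWeight k` is `ℓ ^ k / k!`, and this is
the coefficient form of `x (ℓ ^ (k+1) / (k+1)!)' = (x / (1 - x)) ℓ ^ k / k!`. -/
theorem mul_cycleWeight_succ (k r : ℕ) :
    (r : NNReal) * cycleWeight (k + 1) r = ∑ q ∈ Finset.range r, cycleWeight k q := by
  induction k generalizing r with
  | zero =>
    rcases r with _ | r
    · simp
    · simp only [cycleWeight]
      rw [Finset.sum_eq_single (r + 1)]
      · simp [Finset.sum_ite_eq']
      · intro c hc hne
        have := Finset.mem_Icc.1 hc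
        rw [if_neg (by omega), mul_zero]
      · simp
  | succ k ih =>
    have key : ∀ c ∈ Finset.Icc 1 r, (r : NNReal) *
        (((c * (k + 1 + 1) : ℕ) : NNReal)⁻¹ * cycleWeight (k + 1) (r - c)) =
        ((k + 2 : ℕ) : NNReal)⁻¹ * ((c : NNReal)⁻¹ * ∑ q ∈ Finset.range (r - c), cycleWeight k q +
          cycleWeight (k + 1) (r - c)) := by
      intro c hc
      have hc' := Finset.mem_Icc.1 hc
      have h0 : (c : NNReal) ≠ 0 := by
        have : c ≠ 0 := by omega
        exact_mod_cast this
      -- Splitting `r` into the remainder `r - c`, to which the induction hypothesis applies, and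
      -- the first part `c`, which cancels its own reciprocal.
      have hr : (r : NNReal) = ((r - c : ℕ) : NNReal) + c := by
        rw [← Nat.cast_add]; congr 1; omega
      rw [← ih, hr]
      push_cast
      have h2 : (k : NNReal) + 1 + 1 ≠ 0 := by positivity
      have h3 : (k : NNReal) + 2 ≠ 0 := by positivity
      field_simp
      ring
    have hrefl : ∑ c ∈ Finset.Icc 1 r, cycleWeight (k + 1) (r - c) =
        ∑ q ∈ Finset.range r, cycleWeight (k + 1) q := by
      refine Finset.sum_bij' (fun c _ => r - c) (fun q _ => r - q) ?_ ?_ ?_ ?_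
        (fun _ _ => rfl) <;> intro a ha <;> simp only [Finset.mem_Icc, Finset.mem_range] at ha ⊢ <;>
        omega
    have hconv : ∑ c ∈ Finset.Icc 1 r, (c : NNReal)⁻¹ * ∑ q ∈ Finset.range (r - c), cycleWeight k q =
        ((k + 1 : ℕ) : NNReal) * ∑ q ∈ Finset.range r, cycleWeight (k + 1) q := by
      have e : ∀ q, ((k + 1 : ℕ) : NNReal) * cycleWeight (k + 1) q =
          ∑ c ∈ Finset.Icc 1 q, (c : NNReal)⁻¹ * cycleWeight k (q - c) := by
        intro q
        rw [cycleWeight, Finset.mul_sum]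
        refine Finset.sum_congr rfl fun c _ => ?_
        have h2 : ((k + 1 : ℕ) : NNReal) ≠ 0 := by positivity
        rw [Nat.cast_mul, mul_inv, ← mul_assoc, mul_comm (c : NNReal)⁻¹, ← mul_assoc,
          mul_inv_cancel₀ h2, one_mul]
      simp_rw [Finset.mul_sum, e]
      rw [Finset.sum_sigma', Finset.sum_sigma']
      refine Finset.sum_bij' (fun p _ => ⟨p.2 + p.1, p.1⟩) (fun p _ => ⟨p.2, p.1 - p.2⟩)
        ?_ ?_ ?_ ?_ ?_
      · rintro ⟨a, b⟩; simp only [Finset.mem_sigma, Finset.mem_Icc, Finset.mem_range]; omega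
      · rintro ⟨a, b⟩; simp only [Finset.mem_sigma, Finset.mem_Icc, Finset.mem_range]; omega
      · rintro ⟨a, b⟩; simp
      · rintro ⟨a, b⟩ h
        simp only [Finset.mem_sigma, Finset.mem_Icc, Finset.mem_range] at h
        simp only [Sigma.mk.injEq, heq_eq_eq, and_true]; omega
      · rintro ⟨a, b⟩; simp
    rw [cycleWeight, Finset.mul_sum, Finset.sum_congr rfl key, ← Finset.mul_sum,
      Finset.sum_add_distrib, hrefl, hconv]
    have h3 : (k : NNReal) + 2 ≠ 0 := by positivity
    push_cast
    field_simp
    ring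

/-- In generating functions, `exp ℓ = 1 / (1 - x)`. The terms with `k > r` vanish, so any bound `K >
r` will do. -/
theorem sum_cycleWeight {r K : ℕ} (h : r < K) :
    ∑ k ∈ Finset.range K, cycleWeight k r = 1 := by
  induction r using Nat.strong_induction_on generalizing K with
  | _ r ih =>
    obtain ⟨K, rfl⟩ : ∃ K', K = K' + 1 := ⟨K - 1, by omega⟩
    rcases Nat.eq_zero_or_pos r with rfl | hr
    · rw [Finset.sum_range_succ', Finset.sum_eq_zero]
      · simp [cycleWeight]
      · intro k _
        simp [cycleWeight]
    · have h0 : (r : NNReal) ≠ 0 := by exact_mod_cast hr.ne'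
      have : (r : NNReal) * ∑ k ∈ Finset.range (K + 1), cycleWeight k r = r := by
        rw [Finset.sum_range_succ', mul_add, Finset.mul_sum]
        simp_rw [mul_cycleWeight_succ]
        have hone : ∀ q ∈ Finset.range r, ∑ k ∈ Finset.range K, cycleWeight k q = 1 := by
          intro q hq
          have hqr := Finset.mem_range.1 hq
          exact ih q hqr (by omega)
        rw [Finset.sum_comm, Finset.sum_congr rfl hone]
        simp [cycleWeight, hr.ne']
      exact mul_left_cancel₀ h0 (this.trans (mul_one _).symm)

theorem sum_composition_succ {M : Type*} [AddCommMonoid M] (N : ℕ) (G : List ℕ → M) :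
    ∑ ν : Composition (N + 1), G ν.blocks =
      ∑ b ∈ Finset.Icc 1 (N + 1), ∑ ν : Composition (N + 1 - b), G (b :: ν.blocks) := by
  rw [Finset.sum_sigma']
  have hne : ∀ ν : Composition (N + 1), ν.blocks ≠ [] := fun ν h => by
    have := ν.blocks_sum; rw [h] at this; simp at this
  have hhd : ∀ ν : Composition (N + 1), ν.blocks.head (hne ν) :: ν.blocks.tail = ν.blocks :=
    fun ν => List.cons_head_tail _
  have hsum : ∀ ν : Composition (N + 1), ν.blocks.head (hne ν) + ν.blocks.tail.sum = N + 1 := by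
    intro ν
    rw [← List.sum_cons, hhd, ν.blocks_sum]
  have hpos : ∀ ν : Composition (N + 1), 1 ≤ ν.blocks.head (hne ν) := fun ν =>
    ν.blocks_pos (List.head_mem _)
  symm
  refine Finset.sum_bij'
    (fun p hp => (⟨p.1 :: p.2.blocks, ?_, ?_⟩ : Composition (N + 1)))
    (fun ν _ => ⟨ν.blocks.head (hne ν), ⟨ν.blocks.tail, ?_, ?_⟩⟩) ?_ ?_ ?_ ?_ ?_
  · intro i hi
    simp only [Finset.mem_sigma, Finset.mem_Icc] at hp
    rcases List.mem_cons.1 hi with rfl | hi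
    · omega
    · exact p.2.blocks_pos hi
  · simp only [Finset.mem_sigma, Finset.mem_Icc] at hp
    rw [List.sum_cons, p.2.blocks_sum]; omega
  · intro i hi
    exact ν.blocks_pos (List.mem_of_mem_tail hi)
  · have := hsum ν; omega
  · intros; simp
  · intro ν _
    have := hsum ν
    have := hpos ν
    simp only [Finset.mem_sigma, Finset.mem_Icc, Finset.mem_univ, and_true]
    omega
  · rintro ⟨b, ν⟩ h
    rfl
  · intro ν _
    ext1
    exact hhd ν
  · rintro ⟨b, ν⟩ h
    rfl

/-! ### Total mass of the segment weights of a fixed path -/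

/-- The slope of the chord of `s` over `[p, p + j]`. -/
noncomputable def chordSlope (s : ℕ → ℝ) (p j : ℕ) : ℝ := (s (p + j) - s p) / j

/-- The number of times in `(p, p + b]` at which `s` lies on the ray from `p` through the point at
time `p + b`. -/
noncomputable def touchCount (s : ℕ → ℝ) (p b : ℕ) : ℕ :=
  ((Finset.Icc 1 b).filter fun j => chordSlope s p j = chordSlope s p b).card

/-- The number of blocks with chord slope `m` among the consecutive blocks with lengths `l` that
start at `p`. -/
noncomputable def slopeCount (s : ℕ → ℝ) (m : ℝ) : ℕ → List ℕ → ℕ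
  | _, [] => 0
  | p, b :: l => (if chordSlope s p b = m then 1 else 0) + slopeCount s m (p + b) l

open Classical in
/-- The weight of the consecutive blocks with lengths `l` that start at `p`: it vanishes unless the
chords of the blocks form the concave majorant of `s` after `p`. -/
noncomputable def chainWeight (s : ℕ → ℝ) : ℕ → List ℕ → NNReal
  | _, [] => 1
  | p, b :: l =>
    if ∀ j, 1 ≤ j → j ≤ b + l.sum → chordSlope s p j ≤ chordSlope s p b then
      ((touchCount s p b * (slopeCount s (chordSlope s p b) (p + b) l + 1) : ℕ) : NNReal)⁻¹ *
        chainWeight s (p + b) l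
    else 0

theorem sub_eq_chordSlope_mul (s : ℕ → ℝ) (p : ℕ) {j : ℕ} (hj : 1 ≤ j) :
    s (p + j) - s p = chordSlope s p j * j := by
  have : (j : ℝ) ≠ 0 := by
    have : j ≠ 0 := by omega
    exact_mod_cast this
  rw [chordSlope, div_mul_cancel₀ _ this]

theorem chordSlope_le_iff (s : ℕ → ℝ) (p : ℕ) {j : ℕ} (hj : 1 ≤ j) (m : ℝ) :
    chordSlope s p j ≤ m ↔ s (p + j) - s p ≤ m * j := by
  have : (0 : ℝ) < j := by exact_mod_cast hj
  rw [chordSlope, div_le_iff₀ this]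

theorem chordSlope_eq_iff (s : ℕ → ℝ) (p : ℕ) {j : ℕ} (hj : 1 ≤ j) (m : ℝ) :
    chordSlope s p j = m ↔ s (p + j) - s p = m * j := by
  have : (j : ℝ) ≠ 0 := by
    have : j ≠ 0 := by omega
    exact_mod_cast this
  rw [chordSlope, div_eq_iff this]

/-- A point below the ray of slope `m` from `p` is also below the ray of slope `m` from `p + b`, as
the second starts on the first. -/
theorem chordSlope_le_of_le {s : ℕ → ℝ} {p b j : ℕ} {m : ℝ} (hb : 1 ≤ b) (hj : 1 ≤ j)
    (h : chordSlope s p (b + j) ≤ m) (hm : chordSlope s p b = m) :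
    chordSlope s (p + b) j ≤ m := by
  rw [chordSlope_le_iff _ _ (by omega)] at h ⊢
  rw [chordSlope_eq_iff _ _ hb] at hm
  rw [← add_assoc] at h
  push_cast at h
  linarith

theorem chordSlope_add_eq_iff {s : ℕ → ℝ} {p b j : ℕ} {m : ℝ} (hb : 1 ≤ b) (hj : 1 ≤ j)
    (hm : chordSlope s p b = m) :
    chordSlope s (p + b) j = m ↔ chordSlope s p (b + j) = m := by
  rw [chordSlope_eq_iff _ _ (by omega), chordSlope_eq_iff _ _ (by omega)]
  rw [chordSlope_eq_iff _ _ hb] at hm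
  rw [← add_assoc]
  push_cast
  constructor <;> intro h <;> linarith

/-- In a chain of nonzero weight no later chord is steeper than the first, so a slope that no
initial chord reaches never occurs. -/
theorem slopeCount_eq_zero {s : ℕ → ℝ} {m : ℝ} {p : ℕ} {l : List ℕ} (hl : ∀ b ∈ l, 0 < b)
    (hm : ∀ j, 1 ≤ j → j ≤ l.sum → chordSlope s p j < m) (hw : chainWeight s p l ≠ 0) :
    slopeCount s m p l = 0 := by
  induction l generalizing p with
  | nil => rfl
  | cons b l ih =>
    have hb : 0 < b := hl b (by simp)
    rw [chainWeight] at hw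
    split_ifs at hw with hadm
    · rw [slopeCount, if_neg (hm b hb (by simp)).ne, zero_add]
      refine ih (fun c hc => hl c (by simp [hc])) (fun j hj hjl => ?_) (right_ne_zero_of_mul hw)
      exact (chordSlope_le_of_le hb hj (hadm _ (by omega) (by omega)) rfl).trans_lt
        (hm b hb (by simp))
    · exact absurd rfl hw

theorem slopeCount_le_length (s : ℕ → ℝ) (m : ℝ) (p : ℕ) (l : List ℕ) :
    slopeCount s m p l ≤ l.length := by
  induction l generalizing p with
  | nil => simp [slopeCount]
  | cons b l ih =>
    have := ih (p + b)
    rw [slopeCount, List.length_cons]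
    split_ifs <;> omega

theorem sum_chainWeight_of_forall {s : ℕ → ℝ} {N p : ℕ} {m : ℝ}
    (hm : ∃ j, 1 ≤ j ∧ j ≤ N ∧ chordSlope s p j = m)
    (h : ∀ k, (∑ ν : Composition N,
      if slopeCount s m p ν.blocks = k then chainWeight s p ν.blocks else 0) =
        cycleWeight k ((Finset.Icc 1 N).filter fun j => chordSlope s p j = m).card) :
    ∑ ν : Composition N, chainWeight s p ν.blocks = 1 := by
  have hr : ((Finset.Icc 1 N).filter fun j => chordSlope s p j = m).card < N + 1 := by
    refine (Finset.card_filter_le _ _).trans_lt ?_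
    simp
  rw [← sum_cycleWeight hr, ← Finset.sum_congr rfl fun k _ => h k, Finset.sum_comm]
  refine Finset.sum_congr rfl fun ν _ => ?_
  rw [Finset.sum_ite_eq, if_pos]
  rw [Finset.mem_range]
  have := (slopeCount_le_length s m p ν.blocks).trans ν.length_le
  omega

/-- The refinement by the number `k` of blocks of slope `m` is what makes the induction close. If
the ray of slope `m` dominates the path and is touched at `r` times, the first block must end at a
touching time, say the `c`-th; it then has weight `1 / (c k)` and leaves `r - c` touching times and
`k - 1` blocks, which is the recursion of `cycleWeight`. Once the ray is used up, the rest of the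
path carries total mass `1`, which is the second half of the statement for a shorter path. -/
theorem sum_chainWeight_aux (s : ℕ → ℝ) (N : ℕ) : ∀ p : ℕ,
    (∀ (m : ℝ), (∀ j, 1 ≤ j → j ≤ N → chordSlope s p j ≤ m) →
      ∀ k, (∑ ν : Composition N,
        if slopeCount s m p ν.blocks = k then chainWeight s p ν.blocks else 0) =
          cycleWeight k ((Finset.Icc 1 N).filter fun j => chordSlope s p j = m).card) ∧
    ∑ ν : Composition N, chainWeight s p ν.blocks = 1 := by
  induction N using Nat.strong_induction_on with
  | _ N ih =>
  intro p
  rcases N with _ | N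
  · have hb : ∀ ν : Composition 0, ν.blocks = [] := fun ν => (ν.blocks_eq_nil).2 rfl
    refine ⟨fun m _ k => ?_, ?_⟩
    · simp only [hb, slopeCount, chainWeight]
      rcases k with _ | k
      · simp [cycleWeight, composition_card]
      · simp [cycleWeight]
    · simp [hb, chainWeight, composition_card]
  have hatt : ∀ (m : ℝ), (∀ j, 1 ≤ j → j ≤ N + 1 → chordSlope s p j ≤ m) →
      (∃ j, 1 ≤ j ∧ j ≤ N + 1 ∧ chordSlope s p j = m) →
      ∀ k, (∑ ν : Composition (N + 1),
        if slopeCount s m p ν.blocks = k then chainWeight s p ν.blocks else 0) =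
          cycleWeight k ((Finset.Icc 1 (N + 1)).filter fun j => chordSlope s p j = m).card := by
    intro m hm hex k
    set S := (Finset.Icc 1 (N + 1)).filter fun j => chordSlope s p j = m with hS
    rw [sum_composition_succ N (fun l => if slopeCount s m p l = k then chainWeight s p l else 0)]
    obtain ⟨j₀, hj1, hjN, hj0⟩ := hex
    have hj₀ : j₀ ∈ S := by simp [hS, hj1, hjN, hj0]
    -- A first block that does not end on the ray is less steep than the chord to the touching time
    -- `j₀`, so it is not admissible.
    have hnot : ∀ b ∈ Finset.Icc 1 (N + 1), b ∉ S → (∑ ν : Composition (N + 1 - b),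
        if slopeCount s m p (b :: ν.blocks) = k then chainWeight s p (b :: ν.blocks) else 0) =
        0 := by
      intro b hb hbS
      refine Finset.sum_eq_zero fun ν _ => ?_
      have hb' := Finset.mem_Icc.1 hb
      have : chainWeight s p (b :: ν.blocks) = 0 := by
        rw [chainWeight, if_neg]
        intro hcon
        have h1 := hcon j₀ hj1 (by rw [ν.blocks_sum]; omega)
        rw [hj0] at h1
        exact hbS (by
          rw [hS, Finset.mem_filter]
          exact ⟨hb, le_antisymm (hm b hb'.1 hb'.2) h1⟩)
      rw [this, ite_self]
    -- For a first block that ends at a touching time, `touchCount` is the rank of that time in `S`,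
    -- and the other factor of the weight is the total number `k` of blocks of slope `m`.
    have hin : ∀ b ∈ S, (∑ ν : Composition (N + 1 - b),
        if slopeCount s m p (b :: ν.blocks) = k then chainWeight s p (b :: ν.blocks) else 0) =
        (fun c => if k = 0 then 0 else
          ((c * k : ℕ) : NNReal)⁻¹ * cycleWeight (k - 1) (S.card - c))
          (S.filter fun j => j ≤ b).card := by
      intro b hbS
      rw [hS, Finset.mem_filter, Finset.mem_Icc] at hbS
      obtain ⟨⟨hb1, hbN⟩, hbm⟩ := hbS
      rcases k with _ | k
      · refine Finset.sum_eq_zero fun ν _ => ?_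
        rw [slopeCount, if_pos hbm, if_neg (by omega)]
      · have htouch : touchCount s p b = (S.filter fun j => j ≤ b).card := by
          rw [touchCount, hS, hbm, Finset.filter_filter]
          congr 1
          ext j
          simp only [Finset.mem_filter, Finset.mem_Icc]
          constructor
          · rintro ⟨h1, h2⟩; exact ⟨⟨h1.1, by omega⟩, h2, h1.2⟩
          · rintro ⟨h1, h2⟩; exact ⟨⟨h1.1, h2.2⟩, h2.1⟩
        have hcard : ((Finset.Icc 1 (N + 1 - b)).filter fun j => chordSlope s (p + b) j = m).card =
            S.card - (S.filter fun j => j ≤ b).card := by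
          rw [← Finset.card_filter_add_card_filter_not (s := S) (fun j => j ≤ b),
            Nat.add_sub_cancel_left]
          refine Finset.card_bij' (fun j _ => b + j) (fun j _ => j - b) ?_ ?_ ?_ ?_
          · intro j hj
            simp only [hS, Finset.mem_filter, Finset.mem_Icc] at hj ⊢
            refine ⟨⟨by omega, ?_⟩, by omega⟩
            exact (chordSlope_add_eq_iff hb1 hj.1.1 hbm).1 hj.2
          · intro j hj
            simp only [hS, Finset.mem_filter, Finset.mem_Icc] at hj ⊢
            refine ⟨by omega, ?_⟩
            rw [chordSlope_add_eq_iff hb1 (by omega) hbm]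
            rw [Nat.add_sub_cancel' (by omega)]
            exact hj.1.2
          · intro j _; simp
          · intro j hj
            simp only [hS, Finset.mem_filter, Finset.mem_Icc] at hj ⊢
            omega
        have hIH := (ih (N + 1 - b) (by omega) (p + b)).1 m (fun j hj1 hjN =>
          chordSlope_le_of_le hb1 hj1 (hm _ (by omega) (by omega)) hbm) k
        rw [hcard] at hIH
        simp only [Nat.add_sub_cancel, if_neg (Nat.succ_ne_zero k)]
        rw [← hIH, ← htouch, Finset.mul_sum]
        refine Finset.sum_congr rfl fun ν _ => ?_
        have hadm : ∀ j, 1 ≤ j → j ≤ b + ν.blocks.sum → chordSlope s p j ≤ chordSlope s p b := by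
          intro j hj1 hjN
          rw [hbm]
          exact hm j hj1 (by rw [ν.blocks_sum] at hjN; omega)
        rw [slopeCount, if_pos hbm, chainWeight, if_pos hadm, hbm]
        by_cases hk : slopeCount s m (p + b) ν.blocks = k
        · rw [if_pos (by omega), if_pos hk, hk]
        · rw [if_neg (by omega), if_neg hk, mul_zero]
    rw [← Finset.sum_subset (Finset.filter_subset _ _) hnot, Finset.sum_congr rfl hin,
      sum_comp_rank (fun c => if k = 0 then 0 else
        ((c * k : ℕ) : NNReal)⁻¹ * cycleWeight (k - 1) (S.card - c))]
    rcases k with _ | k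
    · rw [Finset.sum_congr rfl fun _ _ => if_pos rfl, Finset.sum_const_zero, cycleWeight, if_neg]
      exact (Finset.card_pos.2 ⟨j₀, hj₀⟩).ne'
    · simp only [Nat.add_sub_cancel, if_neg (Nat.succ_ne_zero k), cycleWeight]
  obtain ⟨j₁, hj₁, hmax⟩ := Finset.exists_max_image (Finset.Icc 1 (N + 1))
    (fun j => chordSlope s p j) ⟨1, by simp⟩
  have hj₁' := Finset.mem_Icc.1 hj₁
  have hM : ∀ j, 1 ≤ j → j ≤ N + 1 → chordSlope s p j ≤ chordSlope s p j₁ :=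
    fun j h1 h2 => hmax j (Finset.mem_Icc.2 ⟨h1, h2⟩)
  have hone : ∑ ν : Composition (N + 1), chainWeight s p ν.blocks = 1 :=
    sum_chainWeight_of_forall ⟨j₁, hj₁'.1, hj₁'.2, rfl⟩
      (hatt _ hM ⟨j₁, hj₁'.1, hj₁'.2, rfl⟩)
  refine ⟨fun m hm k => ?_, hone⟩
  by_cases hex : ∃ j, 1 ≤ j ∧ j ≤ N + 1 ∧ chordSlope s p j = m
  · exact hatt m hm hex k
  · push Not at hex
    have hempty : ((Finset.Icc 1 (N + 1)).filter fun j => chordSlope s p j = m) = ∅ := by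
      rw [Finset.filter_eq_empty_iff]
      intro j hj
      exact hex j (Finset.mem_Icc.1 hj).1 (Finset.mem_Icc.1 hj).2
    -- If the bound `m` is not attained, no block has slope `m`: all the mass `1` sits at `k = 0`,
    -- in agreement with `cycleWeight k 0`.
    have hterm : ∀ ν : Composition (N + 1),
        (if slopeCount s m p ν.blocks = k then chainWeight s p ν.blocks else 0) =
        if 0 = k then chainWeight s p ν.blocks else 0 := by
      intro ν
      by_cases hw : chainWeight s p ν.blocks = 0
      · rw [hw, ite_self, ite_self]
      · rw [slopeCount_eq_zero (fun b hb => ν.blocks_pos hb) _ hw]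
        intro j h1 h2
        rw [ν.blocks_sum] at h2
        exact lt_of_le_of_ne (hm j h1 h2) (hex j h1 h2)
    rw [hempty, Finset.sum_congr rfl fun ν _ => hterm ν]
    rcases k with _ | k
    · simp [cycleWeight, hone]
    · simp [cycleWeight]

theorem sum_chainWeight (s : ℕ → ℝ) (N p : ℕ) :
    ∑ ν : Composition N, chainWeight s p ν.blocks = 1 :=
  (sum_chainWeight_aux s N p).2

/-! ### The segment probabilities in terms of blocks -/

/-- The length of the `i`-th block of `ν`, counted from `0`. -/
def blockSize {n : ℕ} (ν : Composition n) (i : ℕ) : ℕ := ν.sizeUpTo (i + 1) - ν.sizeUpTo i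

/-- The slope of the chord of `s` over the `i`-th block of `ν`, counted from `0`. -/
noncomputable def blockSlope {n : ℕ} (ν : Composition n) (s : ℕ → ℝ) (i : ℕ) : ℝ :=
  chordSlope s (ν.sizeUpTo i) (blockSize ν i)

/-- The chord slopes of the blocks of `ν` are non-increasing. -/
def SlopesAntitone {n : ℕ} (ν : Composition n) (s : ℕ → ℝ) : Prop :=
  ∀ i j : ℕ, i ≤ j → j < ν.length → blockSlope ν s j ≤ blockSlope ν s i

/-- Within each block of `ν`, `s` does not exceed the chord of the block. -/
def BelowChords {n : ℕ} (ν : Composition n) (s : ℕ → ℝ) : Prop :=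
  ∀ i < ν.length, ∀ m, 1 ≤ m → m ≤ blockSize ν i →
    chordSlope s (ν.sizeUpTo i) m ≤ blockSlope ν s i

/-- The number of blocks of `ν` from the `i`-th on with the chord slope of the `i`-th block. -/
noncomputable def slopeRank {n : ℕ} (ν : Composition n) (s : ℕ → ℝ) (i : ℕ) : ℕ :=
  ((Finset.range ν.length).filter fun j => i ≤ j ∧ blockSlope ν s j = blockSlope ν s i).card

open Classical in
/-- The conditional probability that the segment composition is `ν`, given that the rearranged
walk is `s`. -/
noncomputable def segmentProb {n : ℕ} (ν : Composition n) (s : ℕ → ℝ) : NNReal :=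
  if SlopesAntitone ν s ∧ BelowChords ν s then
    ((∏ i ∈ Finset.range ν.length,
      touchCount s (ν.sizeUpTo i) (blockSize ν i) * slopeRank ν s i : ℕ) : NNReal)⁻¹
  else 0

theorem sizeUpTo_add_blockSize {n : ℕ} (ν : Composition n) (i : ℕ) :
    ν.sizeUpTo i + blockSize ν i = ν.sizeUpTo (i + 1) := by
  have := ν.monotone_sizeUpTo (Nat.le_succ i)
  simp only [Nat.succ_eq_add_one] at this
  rw [blockSize]; omega

theorem blockSize_pos {n : ℕ} (ν : Composition n) {i : ℕ} (hi : i < ν.length) :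
    1 ≤ blockSize ν i := by
  have := ν.sizeUpTo_strict_mono hi
  rw [blockSize]; omega

theorem blockSize_eq_blocksFun {n : ℕ} (ν : Composition n) (i : Fin ν.length) :
    blockSize ν i = ν.blocksFun i := by
  rw [blockSize, ν.sizeUpTo_succ' i, Nat.add_sub_cancel_left]

theorem blockSize_eq_getD {n : ℕ} (ν : Composition n) {i : ℕ} (hi : i < ν.length) :
    blockSize ν i = ν.blocks.getD i 0 := by
  rw [blockSize, ν.sizeUpTo_succ hi, Nat.add_sub_cancel_left]
  exact (List.getD_eq_getElem _ _ hi).symm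

theorem slopeCount_eq_card (s : ℕ → ℝ) (m : ℝ) (l : List ℕ) : ∀ p : ℕ,
    slopeCount s m p l = ((Finset.range l.length).filter fun i =>
      chordSlope s (p + (l.take i).sum) (l.getD i 0) = m).card := by
  induction l with
  | nil => intro p; simp [slopeCount]
  | cons b l ih =>
    intro p
    rw [slopeCount, ih, Finset.card_filter, Finset.card_filter, List.length_cons,
      Finset.sum_range_succ', add_comm]
    simp [add_assoc]

theorem chainWeight_eq (s : ℕ → ℝ) (l : List ℕ) : ∀ p : ℕ, [Decidable (∀ i < l.length, ∀ j,
      1 ≤ j → j ≤ (l.drop i).sum → chordSlope s (p + (l.take i).sum) j ≤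
        chordSlope s (p + (l.take i).sum) (l.getD i 0))] →
    chainWeight s p l =
      if ∀ i < l.length, ∀ j, 1 ≤ j → j ≤ (l.drop i).sum →
        chordSlope s (p + (l.take i).sum) j ≤ chordSlope s (p + (l.take i).sum) (l.getD i 0) then
        ∏ i ∈ Finset.range l.length, ((touchCount s (p + (l.take i).sum) (l.getD i 0) *
          (slopeCount s (chordSlope s (p + (l.take i).sum) (l.getD i 0))
            (p + (l.take (i + 1)).sum) (l.drop (i + 1)) + 1) : ℕ) : NNReal)⁻¹
      else 0 := by
  induction l with
  | nil => intro p _; simp [chainWeight]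
  | cons b l ih =>
    intro p _
    classical
    rw [chainWeight, ih]
    have hiff : (∀ i < (b :: l).length, ∀ j, 1 ≤ j → j ≤ ((b :: l).drop i).sum →
        chordSlope s (p + ((b :: l).take i).sum) j ≤
          chordSlope s (p + ((b :: l).take i).sum) ((b :: l).getD i 0)) ↔
        (∀ j, 1 ≤ j → j ≤ b + l.sum → chordSlope s p j ≤ chordSlope s p b) ∧
        ∀ i < l.length, ∀ j, 1 ≤ j → j ≤ (l.drop i).sum →
          chordSlope s (p + b + (l.take i).sum) j ≤
            chordSlope s (p + b + (l.take i).sum) (l.getD i 0) := by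
      constructor
      · intro h
        refine ⟨by simpa using h 0 (by simp), fun i hi => ?_⟩
        simpa [add_assoc] using h (i + 1) (by simpa using hi)
      · rintro ⟨h0, h⟩ i hi
        rcases i with _ | i
        · simpa using h0
        · simpa [add_assoc] using h i (by simpa using hi)
    by_cases h1 : ∀ j, 1 ≤ j → j ≤ b + l.sum → chordSlope s p j ≤ chordSlope s p b
    · rw [if_pos h1]
      by_cases h2 : ∀ i < l.length, ∀ j, 1 ≤ j → j ≤ (l.drop i).sum →
          chordSlope s (p + b + (l.take i).sum) j ≤
            chordSlope s (p + b + (l.take i).sum) (l.getD i 0)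
      · rw [if_pos h2, if_pos (hiff.2 ⟨h1, h2⟩), List.length_cons, Finset.prod_range_succ', mul_comm]
        simp only [List.drop_succ_cons, List.take_succ_cons, List.sum_cons, List.getD_cons_succ,
          List.take_zero, List.sum_nil, add_zero, List.getD_cons_zero, List.drop_zero, ← add_assoc]
      · rw [if_neg h2, if_neg (fun h => h2 (hiff.1 h).2), mul_zero]
    · rw [if_neg h1, if_neg (fun h => h1 (hiff.1 h).1)]

/-- Forwards: after the start of block `i` every block begins below the line with the slope of block
`i` and rises at most at that slope, hence the path never crosses this line. Backwards: the line
condition inside a block is the chord condition, and at the end of the next block it compares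
adjacent slopes. -/
theorem forall_chordSlope_le_iff {n : ℕ} (ν : Composition n) (s : ℕ → ℝ) :
    (SlopesAntitone ν s ∧ BelowChords ν s) ↔ ∀ i < ν.length, ∀ j, 1 ≤ j →
      j ≤ n - ν.sizeUpTo i → chordSlope s (ν.sizeUpTo i) j ≤ blockSlope ν s i := by
  constructor
  · rintro ⟨hanti, hbelow⟩ i hi
    have key : ∀ k, i + k ≤ ν.length → ∀ q, 1 ≤ q → ν.sizeUpTo i + q ≤ ν.sizeUpTo (i + k) →
        s (ν.sizeUpTo i + q) - s (ν.sizeUpTo i) ≤ blockSlope ν s i * q := by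
      intro k
      induction k with
      | zero => intro _ q h1 h2; rw [add_zero] at h2; omega
      | succ k ih =>
        intro hk q h1 h2
        by_cases hq : ν.sizeUpTo i + q ≤ ν.sizeUpTo (i + k)
        · exact ih (by omega) q h1 hq
        · have hmono : ν.sizeUpTo i ≤ ν.sizeUpTo (i + k) := ν.monotone_sizeUpTo (by omega)
          have hfull : s (ν.sizeUpTo (i + k)) - s (ν.sizeUpTo i) ≤
              blockSlope ν s i * ((ν.sizeUpTo (i + k) : ℝ) - ν.sizeUpTo i) := by
            rcases Nat.eq_or_lt_of_le hmono with he | hlt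
            · rw [← he]; simp
            · have := ih (by omega) (ν.sizeUpTo (i + k) - ν.sizeUpTo i) (by omega) (by omega)
              rwa [Nat.add_sub_cancel' hmono, Nat.cast_sub hmono] at this
          obtain ⟨m, hm⟩ : ∃ m, ν.sizeUpTo i + q = ν.sizeUpTo (i + k) + m :=
            ⟨ν.sizeUpTo i + q - ν.sizeUpTo (i + k), by omega⟩
          have hadd := sizeUpTo_add_blockSize ν (i + k)
          have hm1 : 1 ≤ m := by omega
          have h3 := hbelow (i + k) (by omega) m hm1 (by rw [← add_assoc] at h2; omega)
          have h4 := h3.trans (hanti i (i + k) (by omega) (by omega))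
          rw [chordSlope_le_iff _ _ hm1] at h4
          rw [hm]
          have hcast : (q : ℝ) = ν.sizeUpTo (i + k) + m - ν.sizeUpTo i := by
            have : (ν.sizeUpTo i : ℝ) + q = ν.sizeUpTo (i + k) + m := by exact_mod_cast hm
            linarith
          rw [hcast]
          linarith
    intro j h1 h2
    rw [chordSlope_le_iff _ _ h1]
    refine key (ν.length - i) (by omega) j h1 ?_
    rw [Nat.add_sub_cancel' hi.le, ν.sizeUpTo_length]
    have := ν.sizeUpTo_le i
    omega
  · intro h
    constructor
    · intro i j hij
      induction j, hij using Nat.le_induction with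
      | base => intro _; exact le_rfl
      | succ j hij ih =>
        intro hj
        refine le_trans ?_ (ih (by omega))
        have h1 := blockSize_pos ν (i := j) (by omega)
        have h2 := blockSize_pos ν (i := j + 1) hj
        have e1 := sizeUpTo_add_blockSize ν j
        have e2 := sizeUpTo_add_blockSize ν (j + 1)
        have e3 := ν.sizeUpTo_le (j + 1 + 1)
        have h3 := h j (by omega) (blockSize ν j + blockSize ν (j + 1)) (by omega) (by omega)
        have h4 := chordSlope_le_of_le h1 h2 h3 rfl
        rwa [e1] at h4
    · intro i hi m h1 h2
      have e1 := sizeUpTo_add_blockSize ν i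
      have e3 := ν.sizeUpTo_le (i + 1)
      exact h i hi m h1 (by omega)

theorem drop_sum_blocks {n : ℕ} (ν : Composition n) (i : ℕ) :
    (ν.blocks.drop i).sum = n - ν.sizeUpTo i := by
  have := List.sum_take_add_sum_drop ν.blocks i
  rw [ν.blocks_sum] at this
  rw [Composition.sizeUpTo]; omega

theorem segmentProb_eq_chainWeight {n : ℕ} (ν : Composition n) (s : ℕ → ℝ) :
    segmentProb ν s = chainWeight s 0 ν.blocks := by
  classical
  rw [chainWeight_eq, segmentProb]
  have hslope : ∀ i < ν.length, chordSlope s (0 + (ν.blocks.take i).sum) (ν.blocks.getD i 0) =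
      blockSlope ν s i := by
    intro i hi
    rw [blockSlope, blockSize_eq_getD ν hi, zero_add, Composition.sizeUpTo]
  have hiff : (∀ i < ν.blocks.length, ∀ j, 1 ≤ j → j ≤ (ν.blocks.drop i).sum →
      chordSlope s (0 + (ν.blocks.take i).sum) j ≤
        chordSlope s (0 + (ν.blocks.take i).sum) (ν.blocks.getD i 0)) ↔
      (SlopesAntitone ν s ∧ BelowChords ν s) := by
    rw [forall_chordSlope_le_iff]
    refine forall₂_congr fun i hi => ?_
    rw [hslope i hi, drop_sum_blocks, zero_add, Composition.sizeUpTo]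
  by_cases h : SlopesAntitone ν s ∧ BelowChords ν s
  · rw [if_pos h, if_pos (hiff.2 h), Nat.cast_prod, ← Finset.prod_inv_distrib]
    refine Finset.prod_congr rfl fun i hi => ?_
    have hi' : i < ν.length := Finset.mem_range.1 hi
    rw [hslope i hi', ← blockSize_eq_getD ν hi', zero_add, zero_add]
    congr 3
    rw [slopeCount_eq_card, slopeRank, Finset.card_filter, Finset.card_filter]
    -- `slopeRank` counts block `i` itself and the later blocks of equal slope; the latter are what
    -- `slopeCount` sees in the remaining list.
    have hlen : ν.length = (i + 1) + (ν.blocks.drop (i + 1)).length := by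
      rw [List.length_drop, ν.blocks_length]; omega
    rw [hlen, Finset.sum_range_add, Finset.sum_range_succ, if_pos ⟨le_rfl, rfl⟩,
      Finset.sum_eq_zero, zero_add, add_comm]
    · congr 1
      refine Finset.sum_congr rfl fun j hj => ?_
      have hj' := Finset.mem_range.1 hj
      rw [List.length_drop, ν.blocks_length] at hj'
      have e : chordSlope s ((ν.blocks.take (i + 1)).sum + ((ν.blocks.drop (i + 1)).take j).sum)
          ((ν.blocks.drop (i + 1)).getD j 0) = blockSlope ν s (i + 1 + j) := by
        rw [← hslope (i + 1 + j) (by omega), List.take_add (i := i + 1), List.sum_append, zero_add,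
          List.getD_eq_getElem?_getD, List.getElem?_drop, List.getD_eq_getElem?_getD]
      rw [e]
      simp only [(by omega : i ≤ i + 1 + j), true_and]
    · intro j hj
      have hj' := Finset.mem_range.1 hj
      rw [if_neg (by omega)]
  · rw [if_neg h, if_neg (fun h' => h (hiff.1 h'))]

theorem sum_segmentProb {n : ℕ} (s : ℕ → ℝ) : ∑ ν : Composition n, segmentProb ν s = 1 := by
  simp_rw [segmentProb_eq_chainWeight]
  exact sum_chainWeight s n 0

/-- Weights with sum `1` cannot all vanish, so no majorant has to be constructed. -/
theorem exists_slopesAntitone_belowChords (n : ℕ) (s : ℕ → ℝ) :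
    ∃ ν : Composition n, SlopesAntitone ν s ∧ BelowChords ν s := by
  by_contra! h
  have h1 : ∑ ν : Composition n, segmentProb ν s = 0 :=
    Finset.sum_eq_zero fun ν _ => if_neg fun h' => h ν h'.1 h'.2
  rw [sum_segmentProb] at h1
  exact one_ne_zero h1

/-! ### Cyclic shifts of a single block -/

/-- The cyclic shift by `r` of the increments `u 0, …, u (m - 1)` has a walk below its chord. -/
def RotationBelow (u : ℕ → ℝ) (m r : ℕ) : Prop :=
  ∀ J, 1 ≤ J → J ≤ m → (∑ j ∈ Finset.range J, u ((j + r) % m)) / J ≤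
    (∑ j ∈ Finset.range m, u ((j + r) % m)) / m

open Classical in
/-- The number of cyclic shifts of `u 0, …, u (m - 1)` with a walk below its chord. -/
noncomputable def rotationCount (u : ℕ → ℝ) (m : ℕ) : ℕ := m.count (RotationBelow u m)

/-- The walk with the `m`-periodic continuation of the increments `u 0, …, u (m - 1)`, centered so
as to be periodic. -/
noncomputable def centeredWalk (u : ℕ → ℝ) (m k : ℕ) : ℝ :=
  ∑ j ∈ Finset.range k, u (j % m) - k * ((∑ j ∈ Finset.range m, u j) / m)

theorem sum_mod_self (u : ℕ → ℝ) (m : ℕ) :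
    ∑ j ∈ Finset.range m, u (j % m) = ∑ j ∈ Finset.range m, u j :=
  Finset.sum_congr rfl fun j hj => by rw [Nat.mod_eq_of_lt (Finset.mem_range.1 hj)]

theorem centeredWalk_add_period (u : ℕ → ℝ) {m : ℕ} (hm : 1 ≤ m) (k : ℕ) :
    centeredWalk u m (m + k) = centeredWalk u m k := by
  have h0 : (m : ℝ) ≠ 0 := by
    have : m ≠ 0 := by omega
    exact_mod_cast this
  rw [centeredWalk, centeredWalk, Finset.sum_range_add, sum_mod_self]
  simp only [Nat.add_mod_left]
  push_cast
  field_simp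
  ring

theorem sum_rotation (u : ℕ → ℝ) (m r J : ℕ) :
    ∑ j ∈ Finset.range J, u ((j + r) % m) =
      centeredWalk u m (r + J) - centeredWalk u m r + J * ((∑ j ∈ Finset.range m, u j) / m) := by
  rw [centeredWalk, centeredWalk, Finset.sum_range_add]
  simp only [add_comm r]
  push_cast
  ring

theorem sum_full_rotation (u : ℕ → ℝ) {m : ℕ} (hm : 1 ≤ m) (r : ℕ) :
    ∑ j ∈ Finset.range m, u ((j + r) % m) = ∑ j ∈ Finset.range m, u j := by
  have h0 : (m : ℝ) ≠ 0 := by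
    have : m ≠ 0 := by omega
    exact_mod_cast this
  rw [sum_rotation, add_comm r, centeredWalk_add_period u hm, mul_div_cancel₀ _ h0]
  ring

theorem centeredWalk_mod (u : ℕ → ℝ) {m : ℕ} (hm : 1 ≤ m) (k : ℕ) :
    centeredWalk u m (k % m) = centeredWalk u m k := by
  have hp : Function.Periodic (centeredWalk u m) m := fun k => by
    rw [add_comm, centeredWalk_add_period u hm]
  exact hp.map_mod_nat k

/-- Subtracting the mean slope makes the periodically continued walk periodic and its chords
horizontal, so the good shifts are those that start at a maximum. -/
theorem rotationBelow_iff (u : ℕ → ℝ) {m : ℕ} (hm : 1 ≤ m) (r : ℕ) :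
    RotationBelow u m r ↔ ∀ k, centeredWalk u m k ≤ centeredWalk u m r := by
  have h1 : RotationBelow u m r ↔
      ∀ J, 1 ≤ J → J ≤ m → centeredWalk u m (r + J) ≤ centeredWalk u m r := by
    refine forall₃_congr fun J h1 h2 => ?_
    have : (0 : ℝ) < J := by exact_mod_cast h1
    rw [sum_full_rotation u hm, sum_rotation, div_le_iff₀ this]
    constructor <;> intro h <;> linarith
  rw [h1]
  refine ⟨fun h k => ?_, fun h J _ _ => h _⟩
  -- `J` is the representative in `1, …, m` of `k - r` modulo `m`; the multiple `(m - 1) * (r + 1)`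
  -- stands for `-(r + 1)` in natural numbers.
  obtain ⟨J, hJ1, hJm, hJ⟩ : ∃ J, 1 ≤ J ∧ J ≤ m ∧ (r + J) % m = k % m := by
    have hlt := Nat.mod_lt (k + (m - 1) * (r + 1)) (by omega : 0 < m)
    refine ⟨(k + (m - 1) * (r + 1)) % m + 1, by omega, by omega, ?_⟩
    have : r + ((k + (m - 1) * (r + 1)) % m + 1) = (k + (m - 1) * (r + 1)) % m + (r + 1) := by ring
    rw [this, Nat.mod_add_mod]
    have : k + (m - 1) * (r + 1) + (r + 1) = k + m * (r + 1) := by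
      obtain ⟨m', rfl⟩ : ∃ m', m = m' + 1 := ⟨m - 1, by omega⟩
      simp only [Nat.add_sub_cancel]; ring
    rw [this, Nat.add_mul_mod_self_left]
  have := h J hJ1 hJm
  rwa [← centeredWalk_mod u hm (r + J), hJ, centeredWalk_mod u hm] at this

theorem rotationBelow_periodic (u : ℕ → ℝ) {m : ℕ} (hm : 1 ≤ m) :
    Function.Periodic (RotationBelow u m) m := by
  intro r
  rw [rotationBelow_iff u hm, rotationBelow_iff u hm, add_comm, centeredWalk_add_period u hm]

theorem rotationCount_pos (u : ℕ → ℝ) {m : ℕ} (hm : 1 ≤ m) : 0 < rotationCount u m := by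
  obtain ⟨r, hr, hmax⟩ := Finset.exists_max_image (Finset.range m) (centeredWalk u m)
    ⟨0, Finset.mem_range.2 (by omega)⟩
  classical
  rw [rotationCount, Nat.count_eq_card_filter_range, Finset.card_pos]
  refine ⟨r, Finset.mem_filter.2 ⟨hr, (rotationBelow_iff u hm r).2 fun k => ?_⟩⟩
  rw [← centeredWalk_mod u hm k]
  exact hmax _ (Finset.mem_range.2 (Nat.mod_lt _ (by omega)))

/-- A shift of the increments translates the set of maximizers of the centered walk, and a periodic
set has the same number of elements in every window of one period. -/
theorem rotationCount_rotate {u u' : ℕ → ℝ} {m r₀ : ℕ} (hm : 1 ≤ m)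
    (h : ∀ j < m, u' j = u ((j + r₀) % m)) : rotationCount u' m = rotationCount u m := by
  have hsum : ∑ j ∈ Finset.range m, u' j = ∑ j ∈ Finset.range m, u j := by
    rw [← sum_full_rotation u hm r₀]
    exact Finset.sum_congr rfl fun j hj => h j (Finset.mem_range.1 hj)
  have hc : ∀ k, centeredWalk u' m k = centeredWalk u m (k + r₀) - centeredWalk u m r₀ := by
    intro k
    have h1 : ∑ j ∈ Finset.range k, u' (j % m) = ∑ j ∈ Finset.range k, u ((j + r₀) % m) := by
      refine Finset.sum_congr rfl fun j _ => ?_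
      rw [h _ (Nat.mod_lt _ (by omega)), Nat.mod_add_mod]
    rw [centeredWalk, h1, sum_rotation, hsum, add_comm k]
    ring
  have hiff : ∀ r, RotationBelow u' m r ↔ RotationBelow u m (r + r₀) := by
    intro r
    rw [rotationBelow_iff u' hm, rotationBelow_iff u hm]
    constructor
    · intro hr k
      have := hr (k + r₀ * (m - 1))
      rw [hc, hc] at this
      have e : k + r₀ * (m - 1) + r₀ = k + r₀ * m := by
        obtain ⟨m', rfl⟩ : ∃ m', m = m' + 1 := ⟨m - 1, by omega⟩
        simp only [Nat.add_sub_cancel]; ring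
      rw [e, ← centeredWalk_mod u hm (k + r₀ * m), Nat.add_mul_mod_self_right,
        centeredWalk_mod u hm] at this
      linarith
    · intro hr k
      rw [hc, hc]
      linarith [hr (k + r₀)]
  classical
  rw [rotationCount, rotationCount,
    ← Nat.filter_Ico_card_eq_of_periodic r₀ m _ (rotationBelow_periodic u hm),
    Nat.count_eq_card_filter_range]
  refine Finset.card_bij' (fun j _ => j + r₀) (fun j _ => j - r₀) ?_ ?_ ?_ ?_
  · intro j hj
    simp only [Finset.mem_filter, Finset.mem_range, Finset.mem_Ico] at hj ⊢
    exact ⟨by omega, (hiff j).1 hj.2⟩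
  · intro j hj
    simp only [Finset.mem_filter, Finset.mem_range, Finset.mem_Ico] at hj ⊢
    refine ⟨by omega, (hiff _).2 ?_⟩
    rw [Nat.sub_add_cancel hj.1.1]
    exact hj.2
  · intro j _; simp
  · intro j hj
    simp only [Finset.mem_filter, Finset.mem_Ico] at hj
    omega

/-- If the unshifted walk is good, the maximum of the centered walk is its value `0` at time `0`,
and the maximizers are the times at which the walk meets its chord. The window `1, …, m` replaces
`0, …, m - 1` to match `touchCount`. -/
theorem rotationCount_eq_card {u : ℕ → ℝ} {m : ℕ} (hm : 1 ≤ m) (h : RotationBelow u m 0) :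
    rotationCount u m = ((Finset.Icc 1 m).filter fun j : ℕ =>
      (∑ i ∈ Finset.range j, u i) / j = (∑ i ∈ Finset.range m, u i) / m).card := by
  classical
  have hz : centeredWalk u m 0 = 0 := by simp [centeredWalk]
  have h0 := (rotationBelow_iff u hm 0).1 h
  rw [rotationCount, ← Nat.filter_Ico_card_eq_of_periodic 1 m _ (rotationBelow_periodic u hm)]
  have hI : Finset.Ico 1 (1 + m) = Finset.Icc 1 m := by
    ext j; simp only [Finset.mem_Ico, Finset.mem_Icc]; omega
  rw [hI]
  congr 1
  refine Finset.filter_congr fun j hj => ?_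
  have hj' := Finset.mem_Icc.1 hj
  have hj0 : (j : ℝ) ≠ 0 := by
    have : j ≠ 0 := by omega
    exact_mod_cast this
  have hsum : ∑ i ∈ Finset.range j, u (i % m) = ∑ i ∈ Finset.range j, u i :=
    Finset.sum_congr rfl fun i hi => by
      rw [Nat.mod_eq_of_lt]
      have := Finset.mem_range.1 hi
      omega
  have hcw : (∑ i ∈ Finset.range j, u i) / j = (∑ i ∈ Finset.range m, u i) / m ↔
      centeredWalk u m j = 0 := by
    rw [centeredWalk, hsum, div_eq_iff hj0, sub_eq_zero, mul_comm]
  rw [hcw, rotationBelow_iff u hm]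
  constructor
  · intro hr
    exact le_antisymm (hz ▸ h0 j) (hz ▸ hr 0)
  · intro hr k
    rw [hr, ← hz]
    exact h0 k

theorem rotationCount_zero (m : ℕ) : rotationCount (fun _ => 0) m = m := by
  classical
  rw [rotationCount, Nat.count_eq_card_filter_range, Finset.filter_true_of_mem]
  · exact Finset.card_range m
  · intro r _ J _ _
    simp

/-! ### Block arrangements and the number of admissible ones -/

/-- The increments `x`, continued by `0`. -/
def increment {n : ℕ} (x : Fin n → ℝ) (a : ℕ) : ℝ := if h : a < n then x ⟨a, h⟩ else 0

theorem walk_eq_sum_increment {n : ℕ} (x : Fin n → ℝ) (j : ℕ) :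
    walk x j = ∑ a ∈ Finset.range j, increment x a := by
  have h1 : walk x j = ∑ i : Fin n, if (i : ℕ) < j then increment x i else 0 := by
    rw [walk, Finset.sum_filter]
    refine Finset.sum_congr rfl fun i _ => ?_
    simp [increment]
  rw [h1, Fin.sum_univ_eq_sum_range (fun a => if a < j then increment x a else 0) n,
    ← Finset.sum_filter]
  have h2 : (Finset.range n).filter (· < j) = (Finset.range j).filter (· < n) := by
    ext a; simp [and_comm]
  rw [h2, Finset.sum_filter]
  refine Finset.sum_congr rfl fun a _ => ?_
  split_ifs with h
  · rfl
  · simp [increment, h]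

theorem walk_zero {n : ℕ} (x : Fin n → ℝ) : walk x 0 = 0 := by
  simp [walk_eq_sum_increment]

theorem chordSlope_walk {n : ℕ} (x : Fin n → ℝ) (a m : ℕ) :
    chordSlope (walk x) a m = (∑ j ∈ Finset.range m, increment x (a + j)) / m := by
  rw [chordSlope, walk_eq_sum_increment, walk_eq_sum_increment, Finset.sum_range_add,
    add_sub_cancel_left]

section Arrange

variable {n : ℕ} (L : Composition n) (τ : Equiv.Perm (Fin L.length))

theorem arrange_length : (arrange L τ).length = L.length := by
  simp [arrange, Composition.length]

theorem arrange_one : arrange L 1 = L := by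
  ext1
  simp [arrange, Composition.ofFn_blocksFun]

theorem sizeUpTo_arrange_succ (i : Fin L.length) :
    (arrange L τ).sizeUpTo (i + 1) = (arrange L τ).sizeUpTo i + L.blocksFun (τ i) := by
  rw [(arrange L τ).sizeUpTo_succ (by rw [arrange_length]; exact i.2)]
  simp [arrange]

theorem blockSize_arrange (i : Fin L.length) :
    blockSize (arrange L τ) i = L.blocksFun (τ i) := by
  rw [blockSize, sizeUpTo_arrange_succ, Nat.add_sub_cancel_left]

theorem isMajorizing_iff (z : Fin n → ℝ) : IsMajorizing L τ z ↔
    SlopesAntitone (arrange L τ) (walk z) ∧ BelowChords (arrange L τ) (walk z) := by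
  have hs : ∀ i : Fin L.length, blockSlope (arrange L τ) (walk z) i =
      meanAfter z ((arrange L τ).sizeUpTo i) (L.blocksFun (τ i)) := by
    intro i
    rw [blockSlope, blockSize_arrange]; rfl
  have hl := arrange_length L τ
  constructor
  · rintro ⟨h1, h2⟩
    refine ⟨fun i j hij hj => ?_, fun i hi m hm1 hm2 => ?_⟩
    · have := h1 ⟨i, by omega⟩ ⟨j, by omega⟩ hij
      rwa [← hs, ← hs] at this
    · have := h2 ⟨i, by omega⟩ m hm1 (by rw [← blockSize_arrange]; exact hm2)
      rwa [← hs] at this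
  · rintro ⟨h1, h2⟩
    refine ⟨fun i j hij => ?_, fun i m hm1 hm2 => ?_⟩
    · rw [← hs, ← hs]
      exact h1 i j hij (by omega)
    · rw [← hs]
      exact h2 i (by omega) m hm1 (by rw [blockSize_arrange]; exact hm2)

/-- The places of `[n]`, listed as the `j`-th place of the `i`-th block in the order `τ`. -/
def arrangedPlace (p : Σ i : Fin L.length, Fin (L.blocksFun (τ i))) : Fin n :=
  ⟨(arrange L τ).sizeUpTo p.1 + p.2, by
    have h1 := sizeUpTo_arrange_succ L τ p.1
    have h2 := (arrange L τ).sizeUpTo_le (p.1 + 1)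
    have h3 := p.2.2
    omega⟩

theorem arrangedPlace_bijective : Function.Bijective (arrangedPlace L τ) := by
  rw [Fintype.bijective_iff_injective_and_card]
  constructor
  · rintro ⟨i, j⟩ ⟨i', j'⟩ h
    have h' : (arrange L τ).sizeUpTo i + j = (arrange L τ).sizeUpTo i' + j' :=
      congrArg Fin.val h
    have e1 := sizeUpTo_arrange_succ L τ i
    have e2 := sizeUpTo_arrange_succ L τ i'
    have hj := j.2
    have hj' := j'.2
    have hii : i = i' := by
      rcases lt_trichotomy i i' with hlt | heq | hgt
      · have := (arrange L τ).monotone_sizeUpTo (show (i : ℕ) + 1 ≤ i' from hlt)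
        omega
      · exact heq
      · have := (arrange L τ).monotone_sizeUpTo (show (i' : ℕ) + 1 ≤ i from hgt)
        omega
    subst hii
    have : j = j' := Fin.ext (by omega)
    rw [this]
  · rw [Fintype.card_sigma, Fintype.card_fin]
    simp only [Fintype.card_fin]
    rw [Equiv.sum_comp τ L.blocksFun, L.sum_blocksFun]

/-- The cyclic shift by `r`. -/
def rotateEquiv {m : ℕ} (r : Fin m) : Fin m ≃ Fin m :=
  haveI : NeZero m := ⟨by have := r.2; omega⟩
  Equiv.addRight r

theorem rotateEquiv_val {m : ℕ} (r j : Fin m) : (rotateEquiv r j : ℕ) = (j + r) % m := by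
  have : NeZero m := ⟨by have := r.2; omega⟩
  exact Fin.val_add j r

/-- The block arrangement with block order `τ` and shifts `r`. -/
noncomputable def blockPerm (r : ∀ i : Fin L.length, Fin (L.blocksFun (τ i))) :
    Equiv.Perm (Fin n) :=
  (Equiv.ofBijective _ (arrangedPlace_bijective L τ)).symm.trans
    ((Equiv.sigmaCongr τ fun i => rotateEquiv (r i)).trans L.blocksFinEquiv)

theorem blockPerm_apply (r : ∀ i : Fin L.length, Fin (L.blocksFun (τ i))) (i : Fin L.length)
    (j : Fin (L.blocksFun (τ i))) :
    (blockPerm L τ r (arrangedPlace L τ ⟨i, j⟩) : ℕ) =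
      L.sizeUpTo (τ i) + (j + r i) % L.blocksFun (τ i) := by
  have h : (Equiv.ofBijective _ (arrangedPlace_bijective L τ)).symm (arrangedPlace L τ ⟨i, j⟩) =
      ⟨i, j⟩ := Equiv.ofBijective_symm_apply_apply _ _ _
  rw [blockPerm, Equiv.trans_apply, Equiv.trans_apply, h, ← rotateEquiv_val]
  exact L.coe_embedding _ _

theorem eq_arrangedPlace {i : Fin L.length} {j : ℕ} (hj : j < L.blocksFun (τ i)) {a : Fin n}
    (ha : (a : ℕ) = (arrange L τ).sizeUpTo i + j) : a = arrangedPlace L τ ⟨i, ⟨j, hj⟩⟩ :=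
  Fin.ext ha

theorem isBlockArrangement_iff (σ : Equiv.Perm (Fin n)) :
    IsBlockArrangement L τ σ ↔ ∃ r, blockPerm L τ r = σ := by
  constructor
  · rintro ⟨r, hr⟩
    refine ⟨fun i => ⟨r i % L.blocksFun (τ i), Nat.mod_lt _ (L.one_le_blocksFun _)⟩, ?_⟩
    ext a
    obtain ⟨⟨i, j⟩, rfl⟩ := (arrangedPlace_bijective L τ).2 a
    rw [blockPerm_apply, hr i j j.2 _ rfl, Nat.add_mod_mod]
  · rintro ⟨r, rfl⟩
    refine ⟨fun i => r i, fun i j hj a ha => ?_⟩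
    rw [eq_arrangedPlace L τ hj ha, blockPerm_apply]

theorem blockPerm_injective : Function.Injective (blockPerm L τ) := by
  intro r r' h
  funext i
  have hpos : 0 < L.blocksFun (τ i) := L.one_le_blocksFun _
  have := congrArg (fun σ : Equiv.Perm (Fin n) => (σ (arrangedPlace L τ ⟨i, ⟨0, hpos⟩⟩) : ℕ)) h
  simp only [blockPerm_apply, zero_add, Nat.mod_eq_of_lt (r i).2, Nat.mod_eq_of_lt (r' i).2] at this
  exact Fin.ext (by omega)

/-- The increments in the `b`-th block of `L`. -/
def blockIncrement (x : Fin n → ℝ) (b : ℕ) (j : ℕ) : ℝ := increment x (L.sizeUpTo b + j)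

theorem increment_blockPerm (x : Fin n → ℝ) (r : ∀ i : Fin L.length, Fin (L.blocksFun (τ i)))
    (i : Fin L.length) {j : ℕ} (hj : j < L.blocksFun (τ i)) :
    increment (fun a => x (blockPerm L τ r a)) ((arrange L τ).sizeUpTo i + j) =
      blockIncrement L x (τ i) ((j + r i) % L.blocksFun (τ i)) := by
  have h1 := (arrangedPlace L τ ⟨i, ⟨j, hj⟩⟩).2
  have h2 : (arrange L τ).sizeUpTo i + j < n := h1
  have h3 := blockPerm_apply L τ r i ⟨j, hj⟩
  have h4 := (blockPerm L τ r (arrangedPlace L τ ⟨i, ⟨j, hj⟩⟩)).2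
  rw [h3] at h4
  rw [increment, dif_pos h2, blockIncrement, increment, dif_pos h4]
  congr 1
  exact Fin.ext h3

theorem chordSlope_blockPerm (x : Fin n → ℝ) (r : ∀ i : Fin L.length, Fin (L.blocksFun (τ i)))
    (i : Fin L.length) {J : ℕ} (hJ : J ≤ L.blocksFun (τ i)) :
    chordSlope (walk fun a => x (blockPerm L τ r a)) ((arrange L τ).sizeUpTo i) J =
      (∑ j ∈ Finset.range J,
        blockIncrement L x (τ i) ((j + r i) % L.blocksFun (τ i))) / J := by
  rw [chordSlope_walk]
  congr 1
  refine Finset.sum_congr rfl fun j hj => ?_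
  exact increment_blockPerm L τ x r i ((Finset.mem_range.1 hj).trans_le hJ)

/-- A cyclic shift keeps the sum over the full block. -/
theorem blockSlope_blockPerm (x : Fin n → ℝ) (r : ∀ i : Fin L.length, Fin (L.blocksFun (τ i)))
    (i : Fin L.length) :
    blockSlope (arrange L τ) (walk fun a => x (blockPerm L τ r a)) i =
      blockSlope L (walk x) (τ i) := by
  rw [blockSlope, blockSize_arrange, chordSlope_blockPerm L τ x r i le_rfl,
    sum_full_rotation _ (L.one_le_blocksFun _), blockSlope, blockSize_eq_blocksFun,
    chordSlope_walk]
  rfl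

theorem belowChords_blockPerm_iff (x : Fin n → ℝ)
    (r : ∀ i : Fin L.length, Fin (L.blocksFun (τ i))) :
    BelowChords (arrange L τ) (walk fun a => x (blockPerm L τ r a)) ↔
      ∀ i, RotationBelow (blockIncrement L x (τ i)) (L.blocksFun (τ i)) (r i) := by
  have key : ∀ i : Fin L.length, (∀ m, 1 ≤ m → m ≤ blockSize (arrange L τ) i →
      chordSlope (walk fun a => x (blockPerm L τ r a)) ((arrange L τ).sizeUpTo i) m ≤
        blockSlope (arrange L τ) (walk fun a => x (blockPerm L τ r a)) i) ↔
      RotationBelow (blockIncrement L x (τ i)) (L.blocksFun (τ i)) (r i) := by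
    intro i
    rw [blockSlope, blockSize_arrange]
    refine forall₃_congr fun J h1 h2 => ?_
    rw [chordSlope_blockPerm L τ x r i le_rfl, chordSlope_blockPerm L τ x r i h2]
  constructor
  · intro h i
    exact (key i).1 (h i (by rw [arrange_length]; exact i.2))
  · intro h i hi
    rw [arrange_length] at hi
    exact (key ⟨i, hi⟩).2 (h ⟨i, hi⟩)

/-- The number of ways to shift cyclically the increments in the blocks of `L` such that the walk
stays below the chords of the blocks. -/
noncomputable def shiftCount (x : Fin n → ℝ) : ℕ :=
  ∏ b : Fin L.length, rotationCount (blockIncrement L x b) (L.blocksFun b)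

theorem shiftCount_pos (x : Fin n → ℝ) : 0 < shiftCount L x :=
  Finset.prod_pos fun b _ => rotationCount_pos _ (L.one_le_blocksFun b)

/-- The shifts of different blocks are chosen independently, and each chord condition concerns one
block only; so the number does not depend on `τ`. -/
theorem card_belowChords (x : Fin n → ℝ)
    [DecidablePred fun σ : Equiv.Perm (Fin n) => IsBlockArrangement L τ σ ∧
      BelowChords (arrange L τ) (walk fun a => x (σ a))] :
    (Finset.univ.filter fun σ : Equiv.Perm (Fin n) => IsBlockArrangement L τ σ ∧
      BelowChords (arrange L τ) (walk fun a => x (σ a))).card = shiftCount L x := by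
  classical
  have himg : (Finset.univ.filter fun σ : Equiv.Perm (Fin n) => IsBlockArrangement L τ σ ∧
      BelowChords (arrange L τ) (walk fun a => x (σ a))) =
      (Fintype.piFinset fun i : Fin L.length => Finset.univ.filter
        fun r : Fin (L.blocksFun (τ i)) =>
          RotationBelow (blockIncrement L x (τ i)) (L.blocksFun (τ i)) r).image
        (blockPerm L τ) := by
    ext σ
    simp only [Finset.mem_filter, Finset.mem_univ, true_and, Finset.mem_image,
      Fintype.mem_piFinset, isBlockArrangement_iff]
    constructor
    · rintro ⟨⟨r, rfl⟩, h⟩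
      exact ⟨r, (belowChords_blockPerm_iff L τ x r).1 h, rfl⟩
    · rintro ⟨r, h, rfl⟩
      exact ⟨⟨r, rfl⟩, (belowChords_blockPerm_iff L τ x r).2 h⟩
  rw [himg, Finset.card_image_of_injective _ (blockPerm_injective L τ), Fintype.card_piFinset,
    shiftCount, ← Equiv.prod_comp τ
      (fun b : Fin L.length => rotationCount (blockIncrement L x b) (L.blocksFun b))]
  refine Finset.prod_congr rfl fun i _ => ?_
  rw [rotationCount, Nat.count_eq_card_filter_range, Finset.card_filter, Finset.card_filter]
  exact Fin.sum_univ_eq_sum_range (fun r => if RotationBelow (blockIncrement L x (τ i))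
    (L.blocksFun (τ i)) r then 1 else 0) _

theorem card_isBlockArrangement [DecidablePred (IsBlockArrangement L τ)] :
    (Finset.univ.filter fun σ => IsBlockArrangement L τ σ).card = ∏ b, L.blocksFun b := by
  classical
  -- For zero increments every arrangement is good, so the count of good arrangements counts them
  -- all.
  have h0 : ∀ σ : Equiv.Perm (Fin n), BelowChords (arrange L τ)
      (walk fun a => (0 : Fin n → ℝ) (σ a)) := by
    intro σ i hi m _ _
    have : ∀ k, walk (fun a => (0 : Fin n → ℝ) (σ a)) k = 0 := fun k => by simp [walk]
    simp only [blockSlope, chordSlope, this, sub_self, zero_div, le_refl]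
  have := card_belowChords L τ 0
  simp only [h0, and_true] at this
  rw [this, shiftCount]
  refine Finset.prod_congr rfl fun b _ => ?_
  have e : blockIncrement L (0 : Fin n → ℝ) b = fun _ => 0 := by
    funext j; simp [blockIncrement, increment]
  rw [e, rotationCount_zero]

variable {L τ}

/-- The number of good shifts depends only on the cyclic order within blocks, so it can be computed
from the rearranged increments. -/
theorem IsBlockArrangement.shiftCount_eq {σ : Equiv.Perm (Fin n)} (h : IsBlockArrangement L τ σ)
    (x : Fin n → ℝ) : shiftCount (arrange L τ) (fun a => x (σ a)) = shiftCount L x := by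
  obtain ⟨r, rfl⟩ := (isBlockArrangement_iff L τ σ).1 h
  rw [shiftCount, shiftCount, ← Equiv.prod_comp τ]
  refine Fintype.prod_equiv (finCongr (arrange_length L τ)) _ _ fun i => ?_
  have hi : (i : ℕ) < L.length := i.2.trans_eq (arrange_length L τ)
  rw [← blockSize_eq_blocksFun, show (i : ℕ) = ((⟨i, hi⟩ : Fin L.length) : ℕ) from rfl,
    blockSize_arrange]
  refine rotationCount_rotate (r₀ := r ⟨i, hi⟩) (L.one_le_blocksFun _) fun j hj => ?_
  exact increment_blockPerm L τ x r ⟨i, hi⟩ hj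

theorem IsBlockArrangement.blockSlope_eq {σ : Equiv.Perm (Fin n)} (h : IsBlockArrangement L τ σ)
    (x : Fin n → ℝ) (i : Fin L.length) :
    blockSlope (arrange L τ) (walk fun a => x (σ a)) i = blockSlope L (walk x) (τ i) := by
  obtain ⟨r, rfl⟩ := (isBlockArrangement_iff L τ σ).1 h
  exact blockSlope_blockPerm L τ x r i

end Arrange

theorem BelowChords.shiftCount_eq {n : ℕ} {ν : Composition n} {x : Fin n → ℝ}
    (h : BelowChords ν (walk x)) : shiftCount ν x =
      ∏ i ∈ Finset.range ν.length, touchCount (walk x) (ν.sizeUpTo i) (blockSize ν i) := by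
  rw [← Fin.prod_univ_eq_prod_range
    (fun i => touchCount (walk x) (ν.sizeUpTo i) (blockSize ν i)), shiftCount]
  refine Finset.prod_congr rfl fun i _ => ?_
  have hs : ∀ J, chordSlope (walk x) (ν.sizeUpTo i) J =
      (∑ j ∈ Finset.range J, blockIncrement ν x i j) / J := fun J => chordSlope_walk x _ J
  have hm : ∀ J ≤ ν.blocksFun i, ∑ j ∈ Finset.range J,
      blockIncrement ν x i ((j + 0) % ν.blocksFun i) =
      ∑ j ∈ Finset.range J, blockIncrement ν x i j := fun J hJ =>
    Finset.sum_congr rfl fun j hj => by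
      rw [add_zero, Nat.mod_eq_of_lt ((Finset.mem_range.1 hj).trans_le hJ)]
  rw [blockSize_eq_blocksFun, rotationCount_eq_card (ν.one_le_blocksFun i), touchCount]
  · simp only [hs]
  · intro J h1 h2
    rw [hm J h2, hm _ le_rfl, ← hs, ← hs]
    have := h i i.2 J h1 (by rw [blockSize_eq_blocksFun]; exact h2)
    rwa [blockSlope, blockSize_eq_blocksFun] at this

/-- These permutations form a coset of the stabilizer of `f`, which is a product of symmetric groups
on the fibers. -/
theorem card_perm_comp_eq {k : ℕ} {α : Type*} [DecidableEq α] (f : Fin k → α)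
    (τ₀ : Equiv.Perm (Fin k)) :
    (Finset.univ.filter fun τ : Equiv.Perm (Fin k) => f ∘ τ = f ∘ τ₀).card =
      ∏ v ∈ Finset.univ.image f, (Finset.univ.filter fun a => f a = v).card ! := by
  have h := DomMulAct.stabilizer_card' (f := f)
  rw [Fintype.card_subtype] at h
  simp only [Fintype.card_subtype] at h
  rw [← h]
  refine Finset.card_bij' (fun τ _ => τ₀.symm.trans τ) (fun g _ => τ₀.trans g) ?_ ?_ ?_ ?_
  · intro τ hτ
    simp only [Finset.mem_filter, Finset.mem_univ, true_and] at hτ ⊢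
    funext a
    have := congrFun hτ (τ₀.symm a)
    simpa using this
  · intro g hg
    simp only [Finset.mem_filter, Finset.mem_univ, true_and] at hg ⊢
    funext a
    exact congrFun hg (τ₀ a)
  · intro τ _; ext a; simp
  · intro τ _; ext a; simp

theorem prod_slopeRank {n : ℕ} {ν : Composition n} {s : ℕ → ℝ} {k : ℕ} (hk : ν.length = k)
    (f : Fin k → ℝ) (τ : Equiv.Perm (Fin k)) (h : ∀ i : Fin k, blockSlope ν s i = f (τ i)) :
    ∏ i ∈ Finset.range ν.length, slopeRank ν s i =
      ∏ v ∈ Finset.univ.image f, (Finset.univ.filter fun a => f a = v).card ! := by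
  have h1 := prod_factorial_card_fiber (blockSlope ν s) (Finset.range k)
  simp only [slopeRank, hk]
  rw [← h1]
  have himg : (Finset.range k).image (blockSlope ν s) = Finset.univ.image f := by
    ext v
    simp only [Finset.mem_image, Finset.mem_range, Finset.mem_univ, true_and]
    constructor
    · rintro ⟨i, hi, rfl⟩
      exact ⟨τ ⟨i, hi⟩, (h ⟨i, hi⟩).symm⟩
    · rintro ⟨a, rfl⟩
      exact ⟨τ.symm a, (τ.symm a).2, by rw [h, Equiv.apply_symm_apply]⟩
  rw [himg]
  refine Finset.prod_congr rfl fun v _ => ?_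
  congr 1
  rw [Finset.card_filter, Finset.card_filter,
    ← Fin.sum_univ_eq_sum_range (fun i => if blockSlope ν s i = v then 1 else 0),
    ← Equiv.sum_comp τ (fun a => if f a = v then 1 else 0)]
  simp only [h]

/-- The order is free among blocks of equal slope and the shifts are independent of it. The point is
that the right side involves only `arrange L τ` and the rearranged increments: its reciprocal is
`segmentProb` there, and exchangeability becomes applicable. -/
theorem card_goodArrangements {n : ℕ} {L : Composition n} {τ : Equiv.Perm (Fin L.length)}
    {σ : Equiv.Perm (Fin n)} {x : Fin n → ℝ} (hσ : IsBlockArrangement L τ σ)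
    (hmaj : IsMajorizing L τ fun i => x (σ i)) :
    (goodArrangements L x).card =
      shiftCount (arrange L τ) (fun i => x (σ i)) *
        ∏ i ∈ Finset.range (arrange L τ).length,
          slopeRank (arrange L τ) (walk fun i => x (σ i)) i := by
  classical
  set f : Fin L.length → ℝ := fun b => blockSlope L (walk x) b with hf
  have hanti : ∀ τ' : Equiv.Perm (Fin L.length), ∀ σ' : Equiv.Perm (Fin n),
      IsBlockArrangement L τ' σ' →
      (SlopesAntitone (arrange L τ') (walk fun i => x (σ' i)) ↔ Antitone (f ∘ τ')) := by
    intro τ' σ' h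
    constructor
    · intro h' i j hij
      have := h' i j hij (j.2.trans_eq (arrange_length L τ').symm)
      rwa [h.blockSlope_eq, h.blockSlope_eq] at this
    · intro h' i j hij hj
      have hj' : j < L.length := hj.trans_eq (arrange_length L τ')
      have := h' (show (⟨i, by omega⟩ : Fin L.length) ≤ ⟨j, hj'⟩ from hij)
      have e1 := h.blockSlope_eq x ⟨i, by omega⟩
      have e2 := h.blockSlope_eq x ⟨j, hj'⟩
      simp only at e1 e2
      rw [e1, e2]
      exact this
  have h0 := (hanti τ σ hσ).1 ((isMajorizing_iff L τ _).1 hmaj).1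
  have hinner : ∀ τ' : Equiv.Perm (Fin L.length),
      (∑ σ' : Equiv.Perm (Fin n), if IsBlockArrangement L τ' σ' ∧
        IsMajorizing L τ' (fun i => x (σ' i)) then 1 else 0) =
      if f ∘ τ' = f ∘ τ then shiftCount L x else 0 := by
    intro τ'
    have hiff : ∀ σ' : Equiv.Perm (Fin n), (IsBlockArrangement L τ' σ' ∧
        IsMajorizing L τ' (fun i => x (σ' i))) ↔ (Antitone (f ∘ τ') ∧ IsBlockArrangement L τ' σ' ∧
        BelowChords (arrange L τ') (walk fun i => x (σ' i))) := by
      intro σ'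
      rw [isMajorizing_iff]
      constructor
      · rintro ⟨h1, h2, h3⟩
        exact ⟨(hanti τ' σ' h1).1 h2, h1, h3⟩
      · rintro ⟨h1, h2, h3⟩
        exact ⟨h2, (hanti τ' σ' h2).2 h1, h3⟩
    simp only [hiff]
    by_cases ha : Antitone (f ∘ τ')
    -- Two orders that both sort the slopes give the same sorted sequence, so the admissible `τ'`
    -- are exactly those with `f ∘ τ' = f ∘ τ`.
    · rw [if_pos (Tuple.unique_antitone ha h0), ← card_belowChords L τ' x, Finset.card_filter]
      simp only [ha, true_and]
    · rw [if_neg fun h : f ∘ τ' = f ∘ τ => ha (by rw [h]; exact h0)]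
      simp [ha]
  rw [goodArrangements, Finset.card_filter, Fintype.sum_prod_type]
  simp only
  rw [Finset.sum_congr rfl fun τ' _ => hinner τ', ← Finset.sum_filter, Finset.sum_const,
    card_perm_comp_eq, smul_eq_mul, mul_comm, hσ.shiftCount_eq,
    prod_slopeRank (arrange_length L τ) f τ (fun i => hσ.blockSlope_eq x i)]

/-! ### Cycle lengths: permutations and block orders that yield a given composition -/

/-- This is the size of a conjugacy class of the symmetric group. As `cycleType` omits fixed points,
the parts equal to `1` are split off; they contribute the factor `c!`. -/
theorem card_cycleLengths {n : ℕ} {M : Multiset ℕ} (hpos : ∀ i ∈ M, 0 < i) (hsum : M.sum = n) :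
    (Finset.univ.filter fun π : Equiv.Perm (Fin n) => π.partition.parts = M).card *
      (M.prod * ∏ v ∈ M.toFinset, (M.count v)!) = n ! := by
  set m := M.filter (fun i => 2 ≤ i) with hm
  obtain ⟨c, hc⟩ : ∃ c, M = m + Multiset.replicate c 1 := by
    refine ⟨(M.filter fun i => ¬ 2 ≤ i).card, ?_⟩
    have h1 : M.filter (fun i => ¬ 2 ≤ i) =
        Multiset.replicate (M.filter fun i => ¬ 2 ≤ i).card 1 := by
      rw [Multiset.eq_replicate]
      refine ⟨rfl, fun i hi => ?_⟩
      have h2 := hpos i (Multiset.mem_of_mem_filter hi)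
      have h3 := (Multiset.mem_filter.1 hi).2
      omega
    rw [← h1, hm, Multiset.filter_add_not]
  have h2m : ∀ a ∈ m, 2 ≤ a := fun a ha => (Multiset.mem_filter.1 ha).2
  have h1m : 1 ∉ m := fun h => by have := h2m 1 h; omega
  have hcsum : m.sum + c = n := by
    rw [← hsum]
    conv_rhs => rw [hc]
    simp
  have hiff : ∀ π : Equiv.Perm (Fin n), π.partition.parts = M ↔ π.cycleType = m := by
    intro π
    constructor
    · intro h
      rw [← Equiv.Perm.filter_parts_partition_eq_cycleType, h]
    · intro h
      rw [Equiv.Perm.parts_partition, ← Equiv.Perm.sum_cycleType, h, hc, Fintype.card_fin]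
      congr 2
      omega
  have key := Equiv.Perm.card_of_cycleType_mul_eq (Fin n) m
  rw [Fintype.card_fin, if_pos ⟨by omega, h2m⟩] at key
  simp only [hiff]
  rw [← key]
  congr 1
  have hprod : M.prod = m.prod := by
    conv_lhs => rw [hc]
    simp
  have hcount1 : M.count 1 = c := by
    conv_lhs => rw [hc]
    simp [Multiset.count_eq_zero_of_notMem h1m]
  have hcount : ∀ v ∈ m.toFinset, M.count v = m.count v := by
    intro v hv
    have : v ≠ 1 := by
      rintro rfl
      exact h1m (Multiset.mem_toFinset.1 hv)
    conv_lhs => rw [hc]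
    simp [Multiset.count_replicate, this.symm]
  have hsub : M.toFinset ⊆ insert 1 m.toFinset := by
    intro v hv
    rw [Multiset.mem_toFinset, hc, Multiset.mem_add] at hv
    rcases hv with hv | hv
    · exact Finset.mem_insert_of_mem (Multiset.mem_toFinset.2 hv)
    · rw [Multiset.eq_of_mem_replicate hv]
      exact Finset.mem_insert_self _ _
  have hfac : ∏ v ∈ M.toFinset, (M.count v)! = c ! * ∏ v ∈ m.toFinset, (m.count v)! := by
    rw [Finset.prod_subset hsub, Finset.prod_insert, hcount1]
    · congr 1
      exact Finset.prod_congr rfl fun v hv => by rw [hcount v hv]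
    · exact fun h => h1m (Multiset.mem_toFinset.1 h)
    · intro v _ hv
      rw [Multiset.count_eq_zero_of_notMem fun h => hv (Multiset.mem_toFinset.2 h)]
      rfl
  rw [hfac, hprod, show n - m.sum = c by omega]
  ring

theorem exists_comp_perm_eq {k : ℕ} {f g : Fin k → ℕ} (h : (List.ofFn f).Perm (List.ofFn g)) :
    ∃ τ : Equiv.Perm (Fin k), f ∘ τ = g := by
  have h1 : f ∘ Tuple.sort f = g ∘ Tuple.sort g := by
    exact List.ofFn_injective
      (((((Tuple.sort f).ofFn_comp_perm f).trans h).trans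
        ((Tuple.sort g).ofFn_comp_perm g).symm).eq_of_pairwise'
        (Tuple.monotone_sort f).sortedLE_ofFn.pairwise
        (Tuple.monotone_sort g).sortedLE_ofFn.pairwise)
  refine ⟨(Tuple.sort g).symm.trans (Tuple.sort f), ?_⟩
  funext a
  have := congrFun h1 ((Tuple.sort g).symm a)
  simpa using this

/-- Only permutations of positions with equal block length leave the arranged composition unchanged.
-/
theorem card_arrange_eq {n : ℕ} (L ν : Composition n) :
    (Finset.univ.filter fun τ : Equiv.Perm (Fin L.length) => arrange L τ = ν).card =
      if (L.blocks : Multiset ℕ) = ν.blocks then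
        ∏ v ∈ (ν.blocks : Multiset ℕ).toFinset, ((ν.blocks : Multiset ℕ).count v)! else 0 := by
  classical
  split_ifs with h
  · have hlen : ν.blocks.length = L.length := by
      have := congrArg Multiset.card h
      simpa using this.symm
    obtain ⟨g, hg⟩ : ∃ g : Fin L.length → ℕ, ν.blocks = List.ofFn g :=
      ⟨fun i => ν.blocks.get (i.cast hlen.symm), by
        rw [← List.ofFn_congr hlen, List.ofFn_get]⟩
    have hperm : (List.ofFn L.blocksFun).Perm (List.ofFn g) := by
      rw [← hg, L.ofFn_blocksFun]
      exact Multiset.coe_eq_coe.1 h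
    obtain ⟨τ₀, hτ₀⟩ := exists_comp_perm_eq hperm
    have hiff : ∀ τ : Equiv.Perm (Fin L.length), arrange L τ = ν ↔
        L.blocksFun ∘ τ = L.blocksFun ∘ τ₀ := by
      intro τ
      rw [hτ₀, Composition.ext_iff, hg]
      exact List.ofFn_inj
    have hM : (ν.blocks : Multiset ℕ) = Multiset.map L.blocksFun Finset.univ.val := by
      rw [← h]
      conv_lhs => rw [← L.ofFn_blocksFun, List.ofFn_eq_map]
      rfl
    simp only [hiff]
    rw [card_perm_comp_eq, hM]
    refine Finset.prod_congr rfl fun v _ => ?_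
    rw [Multiset.count_map]
    congr 1
    rw [Finset.card, Finset.filter_val]
    congr 1
    exact Multiset.filter_congr fun a _ => eq_comm
  · rw [Finset.card_eq_zero, Finset.filter_eq_empty_iff]
    rintro τ - rfl
    apply h
    rw [Multiset.coe_eq_coe]
    conv_lhs => rw [← L.ofFn_blocksFun]
    exact (τ.ofFn_comp_perm L.blocksFun).symm

/-- The multiplicity factorials in the size of the conjugacy class cancel against the number of
orders `τ` that produce `ν`. -/
theorem sum_arrange_cycleLengths {n : ℕ} (ν : Composition n) :
    ∑ π : Equiv.Perm (Fin n), (Finset.univ.filter fun τ : Equiv.Perm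
      (Fin (cycleLengths π).length) => arrange (cycleLengths π) τ = ν).card * ν.blocks.prod =
        n ! := by
  have hL : ∀ π : Equiv.Perm (Fin n), ((cycleLengths π).blocks : Multiset ℕ) =
      π.partition.parts := fun π => Multiset.sort_eq π.partition.parts (fun a b => b ≤ a)
  simp only [card_arrange_eq, hL]
  rw [← Finset.sum_mul, ← Finset.sum_filter, Finset.sum_const, smul_eq_mul, mul_assoc,
    ← card_cycleLengths (M := (ν.blocks : Multiset ℕ)) (fun i hi => ν.blocks_pos hi)
      (by rw [Multiset.sum_coe, ν.blocks_sum]), Multiset.prod_coe, mul_comm ν.blocks.prod]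

/-! ### The concave majorant as a piecewise affine function -/

theorem exists_block {n : ℕ} (hn : 1 ≤ n) (ν : Composition n) {t : ℝ} (h0 : 0 ≤ t)
    (ht : t ≤ n) : ∃ i < ν.length, (ν.sizeUpTo i : ℝ) ≤ t ∧ t ≤ ν.sizeUpTo (i + 1) := by
  have key : ∀ k, t ≤ ν.sizeUpTo (k + 1) →
      ∃ i ≤ k, (ν.sizeUpTo i : ℝ) ≤ t ∧ t ≤ ν.sizeUpTo (i + 1) := by
    intro k
    induction k with
    | zero => intro h; exact ⟨0, le_rfl, by simpa using h0, h⟩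
    | succ k ih =>
      intro h
      rcases le_total t (ν.sizeUpTo (k + 1)) with h' | h'
      · obtain ⟨i, hi, h''⟩ := ih h'
        exact ⟨i, by omega, h''⟩
      · exact ⟨k + 1, le_rfl, h', h⟩
  have hlen : 0 < ν.length := ν.length_pos_iff.2 hn
  obtain ⟨i, hi, h⟩ := key (ν.length - 1) (by
    rw [Nat.sub_add_cancel hlen, ν.sizeUpTo_length]; exact ht)
  exact ⟨i, by omega, h⟩

/-- The part of the `i`-th block of `ν` that lies to the left of `t`. -/
noncomputable def ramp {n : ℕ} (ν : Composition n) (i : ℕ) (t : ℝ) : ℝ :=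
  max 0 (min (t - ν.sizeUpTo i) (blockSize ν i))

theorem cast_blockSize {n : ℕ} (ν : Composition n) (i : ℕ) :
    (blockSize ν i : ℝ) = ν.sizeUpTo (i + 1) - ν.sizeUpTo i := by
  rw [← sizeUpTo_add_blockSize]; push_cast; ring

theorem ramp_nonneg {n : ℕ} (ν : Composition n) (i : ℕ) (t : ℝ) : 0 ≤ ramp ν i t :=
  le_max_left _ _

theorem ramp_le {n : ℕ} (ν : Composition n) (i : ℕ) (t : ℝ) : ramp ν i t ≤ blockSize ν i :=
  max_le (Nat.cast_nonneg _) (min_le_right _ _)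

theorem ramp_of_le {n : ℕ} (ν : Composition n) {i : ℕ} {t : ℝ} (h : t ≤ ν.sizeUpTo i) :
    ramp ν i t = 0 :=
  max_eq_left ((min_le_left _ _).trans (by linarith))

theorem ramp_of_ge {n : ℕ} (ν : Composition n) {i : ℕ} {t : ℝ} (h : ν.sizeUpTo (i + 1) ≤ t) :
    ramp ν i t = blockSize ν i := by
  have h0 : (0 : ℝ) ≤ blockSize ν i := Nat.cast_nonneg _
  rw [ramp, min_eq_right, max_eq_right h0]
  rw [cast_blockSize]; linarith

theorem ramp_of_mem {n : ℕ} (ν : Composition n) {i : ℕ} {t : ℝ} (h1 : ν.sizeUpTo i ≤ t)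
    (h2 : t ≤ ν.sizeUpTo (i + 1)) : ramp ν i t = t - ν.sizeUpTo i := by
  rw [ramp, min_eq_left, max_eq_right (by linarith)]
  rw [cast_blockSize]; linarith

theorem sum_mul_ramp {n : ℕ} (ν : Composition n) (a : ℕ → ℝ) {i : ℕ} (hi : i < ν.length) {t : ℝ}
    (h1 : ν.sizeUpTo i ≤ t) (h2 : t ≤ ν.sizeUpTo (i + 1)) :
    ∑ k ∈ Finset.range ν.length, a k * ramp ν k t =
      ∑ k ∈ Finset.range i, a k * blockSize ν k + a i * (t - ν.sizeUpTo i) := by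
  obtain ⟨d, hd⟩ : ∃ d, ν.length = i + 1 + d := ⟨ν.length - (i + 1), by omega⟩
  rw [hd, Finset.sum_range_add, Finset.sum_range_succ, ramp_of_mem ν h1 h2]
  have h3 : ∑ x ∈ Finset.range d, a (i + 1 + x) * ramp ν (i + 1 + x) t = 0 := by
    refine Finset.sum_eq_zero fun k _ => ?_
    have : ν.sizeUpTo (i + 1) ≤ ν.sizeUpTo (i + 1 + k) := ν.monotone_sizeUpTo (by omega)
    rw [ramp_of_le ν (h2.trans (by exact_mod_cast this)), mul_zero]
  rw [h3, add_zero]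
  congr 1
  refine Finset.sum_congr rfl fun k hk => ?_
  have hk' := Finset.mem_range.1 hk
  have : ν.sizeUpTo (k + 1) ≤ ν.sizeUpTo i := ν.monotone_sizeUpTo (by omega)
  rw [ramp_of_ge ν (le_trans (by exact_mod_cast this) h1)]

theorem sum_ramp {n : ℕ} (hn : 1 ≤ n) (ν : Composition n) {t : ℝ} (h0 : 0 ≤ t) (ht : t ≤ n) :
    ∑ k ∈ Finset.range ν.length, ramp ν k t = t := by
  obtain ⟨i, hi, h1, h2⟩ := exists_block hn ν h0 ht
  have := sum_mul_ramp ν (fun _ => 1) hi h1 h2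
  simp only [one_mul, cast_blockSize] at this
  rw [this, Finset.sum_range_sub (fun k => (ν.sizeUpTo k : ℝ))]
  simp

/-- The piecewise affine interpolation of `s` between the block end points of `ν`. -/
noncomputable def chordFun {n : ℕ} (ν : Composition n) (s : ℕ → ℝ) (t : ℝ) : ℝ :=
  s 0 + ∑ k ∈ Finset.range ν.length, blockSlope ν s k * ramp ν k t

theorem blockSlope_mul_blockSize {n : ℕ} (ν : Composition n) (s : ℕ → ℝ) {i : ℕ}
    (hi : i < ν.length) :
    blockSlope ν s i * blockSize ν i = s (ν.sizeUpTo (i + 1)) - s (ν.sizeUpTo i) := by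
  rw [blockSlope, ← sub_eq_chordSlope_mul _ _ (blockSize_pos ν hi), sizeUpTo_add_blockSize]

theorem chordFun_of_mem {n : ℕ} (ν : Composition n) (s : ℕ → ℝ) {i : ℕ} (hi : i < ν.length)
    {t : ℝ} (h1 : ν.sizeUpTo i ≤ t) (h2 : t ≤ ν.sizeUpTo (i + 1)) :
    chordFun ν s t = s (ν.sizeUpTo i) + blockSlope ν s i * (t - ν.sizeUpTo i) := by
  rw [chordFun, sum_mul_ramp ν _ hi h1 h2, Finset.sum_congr rfl fun k hk =>
    blockSlope_mul_blockSize ν s ((Finset.mem_range.1 hk).trans hi),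
    Finset.sum_range_sub (fun k => s (ν.sizeUpTo k))]
  simp only [Composition.sizeUpTo_zero]
  ring

theorem chordFun_sizeUpTo {n : ℕ} (ν : Composition n) (s : ℕ → ℝ) {i : ℕ} (hi : i < ν.length) :
    chordFun ν s (ν.sizeUpTo i) = s (ν.sizeUpTo i) := by
  have : ν.sizeUpTo i ≤ ν.sizeUpTo (i + 1) := ν.monotone_sizeUpTo (by omega)
  rw [chordFun_of_mem ν s hi le_rfl (by exact_mod_cast this)]
  simp

theorem chordFun_sizeUpTo_succ {n : ℕ} (ν : Composition n) (s : ℕ → ℝ) {i : ℕ}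
    (hi : i < ν.length) : chordFun ν s (ν.sizeUpTo (i + 1)) = s (ν.sizeUpTo (i + 1)) := by
  have : ν.sizeUpTo i ≤ ν.sizeUpTo (i + 1) := ν.monotone_sizeUpTo (by omega)
  rw [chordFun_of_mem ν s hi (by exact_mod_cast this) le_rfl, ← cast_blockSize,
    blockSlope_mul_blockSize ν s hi]
  ring

theorem blockChords_eq_chordFun {n : ℕ} (ν : Composition n) (x : Fin n → ℝ)
    (t : Set.Icc (0 : ℝ) n) : blockChords ν x t = chordFun ν (walk x) t := by
  rw [chordFun, walk_zero, zero_add, ← Fin.sum_univ_eq_sum_range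
    (fun k => blockSlope ν (walk x) k * ramp ν k t), blockChords]
  refine Finset.sum_congr rfl fun i _ => ?_
  rw [blockSlope, ramp, blockSize_eq_blocksFun]
  rfl

theorem blockChords_val {n : ℕ} (ν : Composition n) (x : Fin n → ℝ) {t : ℝ} (h0 : 0 ≤ t)
    (ht : t ≤ n) : (blockChords ν x).val t = chordFun ν (walk x) t := by
  rw [Profile.val, Set.IccExtend_of_mem _ _ ⟨h0, ht⟩, blockChords_eq_chordFun]

/-- Each affine piece extends to a supporting line: to its right the slopes are smaller, to its left
they are larger, and the comparison is made block by block through the `ramp` sums. -/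
theorem SlopesAntitone.chordFun_le {n : ℕ} (hn : 1 ≤ n) {ν : Composition n} {s : ℕ → ℝ}
    (h : SlopesAntitone ν s) {i : ℕ} (hi : i < ν.length) {t : ℝ} (h0 : 0 ≤ t) (ht : t ≤ n) :
    chordFun ν s t ≤ s (ν.sizeUpTo i) + blockSlope ν s i * (t - ν.sizeUpTo i) := by
  have hle : ∀ j, (ν.sizeUpTo j : ℝ) ≤ n := fun j => by exact_mod_cast ν.sizeUpTo_le j
  have h1 : chordFun ν s t - chordFun ν s (ν.sizeUpTo i) ≤
      blockSlope ν s i * (t - ν.sizeUpTo i) := by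
    conv_rhs => rw [← sum_ramp hn ν h0 ht, ← sum_ramp hn ν (Nat.cast_nonneg _) (hle i)]
    rw [chordFun, chordFun, add_sub_add_left_eq_sub, ← Finset.sum_sub_distrib,
      ← Finset.sum_sub_distrib, Finset.mul_sum]
    refine Finset.sum_le_sum fun k hk => ?_
    have hk' := Finset.mem_range.1 hk
    rw [← mul_sub]
    rcases le_or_gt i k with hik | hki
    · have hm : ν.sizeUpTo i ≤ ν.sizeUpTo k := ν.monotone_sizeUpTo hik
      rw [ramp_of_le ν (t := ν.sizeUpTo i) (by exact_mod_cast hm), sub_zero]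
      exact mul_le_mul_of_nonneg_right (h i k hik hk') (ramp_nonneg _ _ _)
    · have hm : ν.sizeUpTo (k + 1) ≤ ν.sizeUpTo i := ν.monotone_sizeUpTo hki
      rw [ramp_of_ge ν (t := ν.sizeUpTo i) (by exact_mod_cast hm)]
      exact mul_le_mul_of_nonpos_right (h k i hki.le hi) (by linarith [ramp_le ν k t])
  rw [chordFun_sizeUpTo ν s hi] at h1
  linarith

/-- At the convex combination, the function equals one of its supporting lines, which dominates it
at both end points. -/
theorem SlopesAntitone.concaveOn {n : ℕ} (hn : 1 ≤ n) {ν : Composition n} {s : ℕ → ℝ}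
    (h : SlopesAntitone ν s) : ConcaveOn ℝ (Set.Icc (0 : ℝ) n) (chordFun ν s) := by
  refine ⟨convex_Icc _ _, fun u hu v hv a b ha hb hab => ?_⟩
  have hz := (convex_Icc (0 : ℝ) n) hu hv ha hb hab
  obtain ⟨i, hi, h1, h2⟩ := exists_block hn ν hz.1 hz.2
  rw [chordFun_of_mem ν s hi h1 h2]
  have e1 := mul_le_mul_of_nonneg_left (h.chordFun_le hn hi hu.1 hu.2) ha
  have e2 := mul_le_mul_of_nonneg_left (h.chordFun_le hn hi hv.1 hv.2) hb
  simp only [smul_eq_mul]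
  have hb' : b = 1 - a := by linarith
  subst hb'
  nlinarith

theorem slopesAntitone_of_concaveOn {n : ℕ} {ν : Composition n} {s : ℕ → ℝ}
    (h : ConcaveOn ℝ (Set.Icc (0 : ℝ) n) (chordFun ν s)) : SlopesAntitone ν s := by
  intro i j hij
  induction j, hij using Nat.le_induction with
  | base => intro _; exact le_rfl
  | succ j hij ih =>
    intro hj
    refine le_trans ?_ (ih (by omega))
    have hmem : ∀ k, (ν.sizeUpTo k : ℝ) ∈ Set.Icc (0 : ℝ) n := fun k =>
      ⟨Nat.cast_nonneg _, by exact_mod_cast ν.sizeUpTo_le k⟩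
    have h1 := ν.sizeUpTo_strict_mono (i := j) (by omega)
    have h2 := ν.sizeUpTo_strict_mono hj
    have key := h.slope_anti_adjacent (y := (ν.sizeUpTo (j + 1) : ℝ)) (hmem j) (hmem (j + 1 + 1))
      (by exact_mod_cast h1)
      (by exact_mod_cast h2)
    rw [chordFun_sizeUpTo_succ ν s hj, chordFun_sizeUpTo ν s hj,
      chordFun_sizeUpTo ν s (show j < ν.length by omega), ← cast_blockSize, ← cast_blockSize] at key
    rw [blockSlope, blockSlope, chordSlope, chordSlope, sizeUpTo_add_blockSize,
      sizeUpTo_add_blockSize]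
    exact key

theorem concaveOn_blockChords_iff {n : ℕ} (hn : 1 ≤ n) (ν : Composition n) (x : Fin n → ℝ) :
    ConcaveOn ℝ (Set.Icc (0 : ℝ) n) (blockChords ν x).val ↔ SlopesAntitone ν (walk x) := by
  have he : Set.EqOn (blockChords ν x).val (chordFun ν (walk x)) (Set.Icc (0 : ℝ) n) :=
    fun t ht => blockChords_val ν x ht.1 ht.2
  exact ⟨fun h => slopesAntitone_of_concaveOn (h.congr he),
    fun h => (h.concaveOn hn).congr he.symm⟩

theorem chordFun_le_of_concaveOn {n : ℕ} (hn : 1 ≤ n) (ν : Composition n) (s : ℕ → ℝ) {g : ℝ → ℝ}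
    (hg : ConcaveOn ℝ (Set.Icc (0 : ℝ) n) g) (h : ∀ j ≤ n, s j ≤ g j) {t : ℝ} (h0 : 0 ≤ t)
    (ht : t ≤ n) : chordFun ν s t ≤ g t := by
  obtain ⟨i, hi, h1, h2⟩ := exists_block hn ν h0 ht
  rw [chordFun_of_mem ν s hi h1 h2]
  have hmem : ∀ k, (ν.sizeUpTo k : ℝ) ∈ Set.Icc (0 : ℝ) n := fun k =>
    ⟨Nat.cast_nonneg _, by exact_mod_cast ν.sizeUpTo_le k⟩
  have hpos : (0 : ℝ) < blockSize ν i := by exact_mod_cast blockSize_pos ν hi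
  have hsz := cast_blockSize ν i
  have hA : 0 ≤ ((ν.sizeUpTo (i + 1) : ℝ) - t) / (blockSize ν i : ℝ) :=
    div_nonneg (by linarith) hpos.le
  have hB : 0 ≤ (t - (ν.sizeUpTo i : ℝ)) / (blockSize ν i : ℝ) :=
    div_nonneg (by linarith) hpos.le
  have key := hg.2 (hmem i) (hmem (i + 1)) hA hB (by field_simp; linarith)
  simp only [smul_eq_mul] at key
  have et : ((ν.sizeUpTo (i + 1) : ℝ) - t) / (blockSize ν i : ℝ) * (ν.sizeUpTo i : ℝ) +
      (t - (ν.sizeUpTo i : ℝ)) / (blockSize ν i : ℝ) * (ν.sizeUpTo (i + 1) : ℝ) = t := by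
    field_simp
    rw [hsz]; ring
  rw [et] at key
  refine le_trans ?_ key
  have b1 := mul_le_mul_of_nonneg_left (h _ (ν.sizeUpTo_le i)) hA
  have b2 := mul_le_mul_of_nonneg_left (h _ (ν.sizeUpTo_le (i + 1))) hB
  refine le_trans (le_of_eq ?_) (add_le_add b1 b2)
  have hm := blockSlope_mul_blockSize ν s hi
  have hs : s (ν.sizeUpTo (i + 1)) = s (ν.sizeUpTo i) + blockSlope ν s i * blockSize ν i := by
    linarith
  rw [hs]
  field_simp
  rw [hsz]; ring

theorem belowChords_iff_le_chordFun {n : ℕ} (hn : 1 ≤ n) (ν : Composition n) (s : ℕ → ℝ) :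
    BelowChords ν s ↔ ∀ j ≤ n, s j ≤ chordFun ν s j := by
  constructor
  · intro h j hj
    obtain ⟨i, hi, h1, h2⟩ := exists_block hn ν (Nat.cast_nonneg j) (by exact_mod_cast hj)
    rw [chordFun_of_mem ν s hi h1 h2]
    have h1' : ν.sizeUpTo i ≤ j := by exact_mod_cast h1
    have h2' : j ≤ ν.sizeUpTo (i + 1) := by exact_mod_cast h2
    obtain ⟨m, rfl⟩ := Nat.exists_eq_add_of_le h1'
    rcases Nat.eq_zero_or_pos m with rfl | hm
    · simp
    · have hb := sizeUpTo_add_blockSize ν i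
      have := (chordSlope_le_iff s _ hm _).1 (h i hi m hm (by omega))
      push_cast
      linarith
  · intro h i hi m h1 h2
    have hb := sizeUpTo_add_blockSize ν i
    have hle := ν.sizeUpTo_le (i + 1)
    have := h (ν.sizeUpTo i + m) (by omega)
    rw [chordFun_of_mem ν s hi (by push_cast; linarith [Nat.cast_nonneg (α := ℝ) m])
      (by exact_mod_cast (by omega : ν.sizeUpTo i + m ≤ ν.sizeUpTo (i + 1)))] at this
    rw [chordSlope_le_iff s _ h1]
    push_cast at this
    linarith

/-- Antitone slopes make the chord function concave, the chord conditions make it a majorant, and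
any concave majorant lies above the chords between points of the walk. -/
theorem concaveMajorant_eq_blockChords {n : ℕ} (hn : 1 ≤ n) {ν : Composition n} {x : Fin n → ℝ}
    (h1 : SlopesAntitone ν (walk x)) (h2 : BelowChords ν (walk x)) :
    concaveMajorant (path x) = blockChords ν x := by
  funext t
  rw [blockChords_eq_chordFun]
  refine IsLeast.csInf_eq ⟨⟨chordFun ν (walk x), h1.concaveOn hn, fun j => ?_, rfl⟩, ?_⟩
  · exact (belowChords_iff_le_chordFun hn ν _).1 h2 j (Nat.lt_succ_iff.1 j.2)
  · rintro y ⟨g, hg, hgs, rfl⟩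
    exact chordFun_le_of_concaveOn hn ν _ hg
      (fun j hj => hgs ⟨j, Nat.lt_succ_iff.2 hj⟩) t.2.1 t.2.2

/-- Needed for measurability on all vectors `s`, whereas walks start at `0`. -/
theorem concaveMajorant_add_const {n : ℕ} (s : Fin (n + 1) → ℝ) (a : ℝ) (t : Set.Icc (0 : ℝ) n) :
    concaveMajorant (fun j => s j + a) t = concaveMajorant s t + a := by
  have hset : {y : ℝ | ∃ g : ℝ → ℝ, ConcaveOn ℝ (Set.Icc (0 : ℝ) n) g ∧
      (∀ j : Fin (n + 1), s j + a ≤ g (j : ℕ)) ∧ g t = y} =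
      (OrderIso.addRight a) '' {y : ℝ | ∃ g : ℝ → ℝ, ConcaveOn ℝ (Set.Icc (0 : ℝ) n) g ∧
        (∀ j : Fin (n + 1), s j ≤ g (j : ℕ)) ∧ g t = y} := by
    ext y
    constructor
    · rintro ⟨g, hg, hgs, rfl⟩
      refine ⟨g t - a, ⟨fun u => g u - a, hg.sub (convexOn_const a hg.1), fun j => ?_, rfl⟩, ?_⟩
      · linarith [hgs j]
      · simp
    · rintro ⟨_, ⟨g, hg, hgs, rfl⟩, rfl⟩
      refine ⟨fun u => g u + a, hg.add (concaveOn_const a hg.1), fun j => ?_, rfl⟩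
      linarith [hgs j]
  have hne : {y : ℝ | ∃ g : ℝ → ℝ, ConcaveOn ℝ (Set.Icc (0 : ℝ) n) g ∧
      (∀ j : Fin (n + 1), s j ≤ g (j : ℕ)) ∧ g t = y}.Nonempty := by
    refine ⟨_, fun _ => ∑ j, |s j|, concaveOn_const _ (convex_Icc _ _), fun j => ?_, rfl⟩
    exact (le_abs_self _).trans
      (Finset.single_le_sum (f := fun j => |s j|) (fun _ _ => abs_nonneg _) (Finset.mem_univ j))
  have hbdd : BddBelow {y : ℝ | ∃ g : ℝ → ℝ, ConcaveOn ℝ (Set.Icc (0 : ℝ) n) g ∧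
      (∀ j : Fin (n + 1), s j ≤ g (j : ℕ)) ∧ g t = y} := by
    -- A concave function on an interval is at least the smaller of its two boundary values.
    refine ⟨min (s 0) (s (Fin.last n)), ?_⟩
    rintro _ ⟨g, hg, hgs, rfl⟩
    have hnn : (0 : ℝ) ≤ n := Nat.cast_nonneg n
    refine le_trans (le_min ?_ ?_)
      (hg.ge_on_segment (Set.left_mem_Icc.2 hnn) (Set.right_mem_Icc.2 hnn) (z := t) ?_)
    · exact (min_le_left _ _).trans (by simpa using hgs 0)
    · exact (min_le_right _ _).trans (by simpa using hgs (Fin.last n))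
    · rw [segment_eq_Icc hnn]; exact t.2
  rw [concaveMajorant, concaveMajorant, hset, ← OrderIso.map_csInf' _ hne hbdd]
  rfl

/-! ### Faces and the explicit weights -/

theorem mem_boundaries_iff {n : ℕ} (ν : Composition n) (j : Fin (n + 1)) :
    j ∈ ν.boundaries ↔ ∃ i ≤ ν.length, ν.sizeUpTo i = j := by
  rw [Composition.boundaries, Finset.mem_map]
  constructor
  · rintro ⟨i, -, rfl⟩
    exact ⟨i, Nat.lt_succ_iff.1 i.2, rfl⟩
  · rintro ⟨i, hi, hij⟩
    exact ⟨⟨i, Nat.lt_succ_iff.2 hi⟩, Finset.mem_univ _, Fin.ext hij⟩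

theorem boundaries_faces {n : ℕ} (c : Profile n) : (faces c).boundaries = (faceEnds c).boundaries :=
  (faceEnds c).toComposition_boundaries

section Faces

variable {n : ℕ} (ν : Composition n) (x : Fin n → ℝ)

theorem blockChords_val_sub {i : ℕ} (hi : i < ν.length) {a b : ℝ} (ha : ν.sizeUpTo i ≤ a)
    (hab : a ≤ b) (hb : b ≤ ν.sizeUpTo (i + 1)) :
    (blockChords ν x).val b - (blockChords ν x).val a = blockSlope ν (walk x) i * (b - a) := by
  have h0 : (0 : ℝ) ≤ ν.sizeUpTo i := Nat.cast_nonneg _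
  have h1 : (ν.sizeUpTo (i + 1) : ℝ) ≤ n := by exact_mod_cast ν.sizeUpTo_le _
  rw [blockChords_val ν x (by linarith) (by linarith),
    blockChords_val ν x (by linarith) (by linarith),
    chordFun_of_mem ν _ hi (by linarith) hb, chordFun_of_mem ν _ hi ha (by linarith)]
  ring

/-- At an integer strictly inside a block the slope does not change, so faces can only end at block
ends. -/
theorem refinesFaces_blockChords (hn : 1 ≤ n) : RefinesFaces ν (blockChords ν x) := by
  intro j hj
  simp only [faceEnds, Finset.mem_filter, Finset.mem_univ, true_and] at hj
  rw [mem_boundaries_iff]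
  rcases hj with rfl | rfl | hj
  · exact ⟨0, Nat.zero_le _, by simp⟩
  · exact ⟨ν.length, le_rfl, by simp⟩
  · by_contra! hcon
    apply hj
    obtain ⟨i, hi, h1, h2⟩ := exists_block hn ν (Nat.cast_nonneg (j : ℕ))
      (by exact_mod_cast Nat.lt_succ_iff.1 j.2)
    have h1' : ν.sizeUpTo i < j := lt_of_le_of_ne (by exact_mod_cast h1) (hcon i hi.le)
    have h2' : (j : ℕ) < ν.sizeUpTo (i + 1) :=
      lt_of_le_of_ne (by exact_mod_cast h2) (hcon (i + 1) hi).symm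
    have h3 : (ν.sizeUpTo i : ℝ) + 1 ≤ (j : ℕ) := by exact_mod_cast h1'
    have h4 : ((j : ℕ) : ℝ) + 1 ≤ ν.sizeUpTo (i + 1) := by exact_mod_cast h2'
    rw [blockChords_val_sub ν x hi h1 (by linarith) h4,
      blockChords_val_sub ν x hi (by linarith) (by linarith) h2]
    ring

theorem sizeUpTo_mem_faceEnds_iff {i : ℕ} (hi : i + 1 < ν.length) {j : Fin (n + 1)}
    (hj : ν.sizeUpTo (i + 1) = j) : j ∈ (faceEnds (blockChords ν x)).boundaries ↔
      blockSlope ν (walk x) (i + 1) ≠ blockSlope ν (walk x) i := by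
  have h1 := ν.sizeUpTo_strict_mono (i := i) (by omega)
  have h2 := ν.sizeUpTo_strict_mono hi
  have hlt := ν.sizeUpTo_le (i + 1 + 1)
  have h1' : (ν.sizeUpTo i : ℝ) + 1 ≤ ν.sizeUpTo (i + 1) := by exact_mod_cast h1
  have h2' : (ν.sizeUpTo (i + 1) : ℝ) + 1 ≤ ν.sizeUpTo (i + 1 + 1) := by exact_mod_cast h2
  have hj0 : j ≠ 0 := by rintro rfl; simp at hj; omega
  have hjn : j ≠ Fin.last n := by rintro rfl; simp at hj; omega
  simp only [faceEnds, Finset.mem_filter, Finset.mem_univ, true_and, hj0, hjn, false_or, ← hj]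
  rw [blockChords_val_sub ν x hi le_rfl (by linarith) h2',
    blockChords_val_sub ν x (show i < ν.length by omega) (by linarith) (by linarith) le_rfl]
  rw [add_sub_cancel_left, sub_sub_cancel, mul_one, mul_one]

/-- The face of `blockChords ν x` in which the `i`-th block of `ν` lies. -/
noncomputable def faceOfBlock (i : Fin ν.length) : Fin (faces (blockChords ν x)).length :=
  (faces (blockChords ν x)).index ⟨ν.sizeUpTo i, by
    have := ν.sizeUpTo_strict_mono i.2
    have := ν.sizeUpTo_le (i + 1)
    omega⟩

theorem sizeUpTo_faceOfBlock_le (i : Fin ν.length) :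
    (faces (blockChords ν x)).sizeUpTo (faceOfBlock ν x i) ≤ ν.sizeUpTo i :=
  (faces (blockChords ν x)).sizeUpTo_index_le _

theorem lt_sizeUpTo_faceOfBlock_succ (i : Fin ν.length) :
    ν.sizeUpTo i < (faces (blockChords ν x)).sizeUpTo (faceOfBlock ν x i + 1) :=
  (faces (blockChords ν x)).lt_sizeUpTo_index_succ ⟨ν.sizeUpTo i, _⟩

theorem faceOfBlock_eq {i : Fin ν.length} {j : Fin (faces (blockChords ν x)).length}
    (h1 : (faces (blockChords ν x)).sizeUpTo j ≤ ν.sizeUpTo i)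
    (h2 : ν.sizeUpTo i < (faces (blockChords ν x)).sizeUpTo (j + 1)) : faceOfBlock ν x i = j := by
  have h3 := sizeUpTo_faceOfBlock_le ν x i
  have h4 := lt_sizeUpTo_faceOfBlock_succ ν x i
  rcases lt_trichotomy (faceOfBlock ν x i) j with h | h | h
  · have := (faces (blockChords ν x)).monotone_sizeUpTo
      (show (faceOfBlock ν x i : ℕ) + 1 ≤ j from h)
    omega
  · exact h
  · have := (faces (blockChords ν x)).monotone_sizeUpTo
      (show (j : ℕ) + 1 ≤ faceOfBlock ν x i from h)
    omega

theorem exists_sizeUpTo_eq_face (hn : 1 ≤ n) (j : ℕ) :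
    ∃ k ≤ ν.length, ν.sizeUpTo k = (faces (blockChords ν x)).sizeUpTo j := by
  set μ := faces (blockChords ν x) with hμ
  have hb : (⟨μ.sizeUpTo j, Nat.lt_succ_iff.2 (μ.sizeUpTo_le j)⟩ : Fin (n + 1)) ∈
      μ.boundaries := by
    rw [mem_boundaries_iff]
    rcases le_total j μ.length with h | h
    · exact ⟨j, h, rfl⟩
    · exact ⟨μ.length, le_rfl, by rw [μ.sizeUpTo_length]; exact (μ.sizeUpTo_ofLength_le j h).symm⟩
  rw [hμ, boundaries_faces] at hb
  exact (mem_boundaries_iff ν _).1 (refinesFaces_blockChords ν x hn hb)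

theorem blocksInFace_eq (hn : 1 ≤ n) (j : Fin (faces (blockChords ν x)).length) :
    blocksInFace ν (blockChords ν x) j =
      (Finset.univ.filter fun i => faceOfBlock ν x i = j).card := by
  rw [blocksInFace]
  congr 1
  refine Finset.filter_congr fun i _ => ?_
  constructor
  · rintro ⟨h1, h2⟩
    exact faceOfBlock_eq ν x h1 ((ν.sizeUpTo_strict_mono i.2).trans_le h2)
  · rintro rfl
    refine ⟨sizeUpTo_faceOfBlock_le ν x i, ?_⟩
    have h := lt_sizeUpTo_faceOfBlock_succ ν x i
    obtain ⟨k, -, hk⟩ := exists_sizeUpTo_eq_face ν x hn (faceOfBlock ν x i + 1)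
    rw [← hk] at h ⊢
    exact ν.monotone_sizeUpTo (ν.monotone_sizeUpTo.reflect_lt h)

variable {ν x}

/-- A change of slope between the two blocks would be a face end separating them. Conversely, a face
end in between would be a strict drop of the slope, and antitone slopes cannot recover from it. -/
theorem faceOfBlock_eq_iff (hn : 1 ≤ n) (h : SlopesAntitone ν (walk x)) {i i' : Fin ν.length} (hii : i ≤ i') :
    faceOfBlock ν x i' = faceOfBlock ν x i ↔
      blockSlope ν (walk x) i' = blockSlope ν (walk x) i := by
  set μ := faces (blockChords ν x) with hμ
  constructor
  · intro hf
    by_contra hne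
    have hex : ∃ k, (i : ℕ) ≤ k ∧ k < i' ∧
        blockSlope ν (walk x) (k + 1) ≠ blockSlope ν (walk x) k := by
      by_contra! hcon
      apply hne
      have : ∀ k, (i : ℕ) ≤ k → k ≤ i' → blockSlope ν (walk x) k = blockSlope ν (walk x) i := by
        intro k hk
        induction k, hk using Nat.le_induction with
        | base => intro _; rfl
        | succ k hk ih =>
          intro hk'
          rw [hcon k hk (by omega), ih (by omega)]
      exact this i' hii le_rfl
    obtain ⟨k, hik, hki, hk⟩ := hex
    have hk1 : k + 1 < ν.length := by omega
    have hmem := (sizeUpTo_mem_faceEnds_iff ν x hk1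
      (j := ⟨ν.sizeUpTo (k + 1), Nat.lt_succ_iff.2 (ν.sizeUpTo_le _)⟩) rfl).2 hk
    rw [← boundaries_faces, mem_boundaries_iff] at hmem
    obtain ⟨a, ha, hae⟩ := hmem
    simp only at hae
    have h1 := sizeUpTo_faceOfBlock_le ν x i
    have h2 := lt_sizeUpTo_faceOfBlock_succ ν x i'
    rw [hf] at h2
    have h3 : ν.sizeUpTo i < ν.sizeUpTo (k + 1) :=
      (ν.sizeUpTo_strict_mono i.2).trans_le (ν.monotone_sizeUpTo (by omega))
    have h4 : ν.sizeUpTo (k + 1) ≤ ν.sizeUpTo i' := ν.monotone_sizeUpTo (by omega)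
    have h5 : (faceOfBlock ν x i : ℕ) < a :=
      (faces (blockChords ν x)).monotone_sizeUpTo.reflect_lt (by omega)
    have h6 : a < (faceOfBlock ν x i : ℕ) + 1 :=
      (faces (blockChords ν x)).monotone_sizeUpTo.reflect_lt (by omega)
    omega
  · intro hs
    refine faceOfBlock_eq ν x
      ((sizeUpTo_faceOfBlock_le ν x i).trans (ν.monotone_sizeUpTo hii)) ?_
    by_contra! hcon
    have h2 := lt_sizeUpTo_faceOfBlock_succ ν x i
    obtain ⟨k, hk, hke⟩ := exists_sizeUpTo_eq_face ν x hn (faceOfBlock ν x i + 1)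
    rw [← hke] at h2 hcon
    have hik : (i : ℕ) < k := ν.monotone_sizeUpTo.reflect_lt h2
    have hki : k ≤ i' := by
      by_contra! hlt
      have := (ν.sizeUpTo_strict_mono i'.2).trans_le (ν.monotone_sizeUpTo hlt)
      omega
    obtain ⟨k, rfl⟩ : ∃ k', k = k' + 1 := ⟨k - 1, by omega⟩
    have hk1 : k + 1 < ν.length := by omega
    have hmem : (⟨ν.sizeUpTo (k + 1), Nat.lt_succ_iff.2 (ν.sizeUpTo_le _)⟩ : Fin (n + 1)) ∈
        (faceEnds (blockChords ν x)).boundaries := by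
      rw [← boundaries_faces, mem_boundaries_iff]
      exact ⟨faceOfBlock ν x i + 1, (faceOfBlock ν x i).2, hke.symm⟩
    rw [sizeUpTo_mem_faceEnds_iff ν x hk1 rfl] at hmem
    apply hmem
    have h3 := h k (k + 1) (by omega) hk1
    have h4 := h i k (by omega) (by omega)
    have h5 := h (k + 1) i' hki i'.2
    linarith

/-- Faces are the classes of blocks with equal slope, so both sides multiply out the ranks within
the classes. -/
theorem prod_factorial_blocksInFace (hn : 1 ≤ n) (h : SlopesAntitone ν (walk x)) :
    ∏ j, (blocksInFace ν (blockChords ν x) j)! =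
      ∏ i ∈ Finset.range ν.length, slopeRank ν (walk x) i := by
  classical
  obtain ⟨idx, hidx⟩ : ∃ idx : ℕ → ℕ, ∀ i : Fin ν.length, idx i = faceOfBlock ν x i :=
    ⟨fun i => if hi : i < ν.length then faceOfBlock ν x ⟨i, hi⟩ else 0, fun i => by simp⟩
  have h1 : ∀ i ∈ Finset.range ν.length, slopeRank ν (walk x) i =
      ((Finset.range ν.length).filter fun j => i ≤ j ∧ idx j = idx i).card := by
    intro i hi
    have hi' := Finset.mem_range.1 hi
    rw [slopeRank]
    congr 1
    refine Finset.filter_congr fun j hj => ?_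
    have hj' := Finset.mem_range.1 hj
    refine and_congr_right fun hij => ?_
    have e := faceOfBlock_eq_iff hn h (show (⟨i, hi'⟩ : Fin ν.length) ≤ ⟨j, hj'⟩ from hij)
    rw [← e, ← Fin.val_inj, ← hidx, ← hidx]
  rw [Finset.prod_congr rfl h1, ← prod_factorial_card_fiber]
  have h2 : ∀ j : Fin (faces (blockChords ν x)).length, blocksInFace ν (blockChords ν x) j =
      ((Finset.range ν.length).filter fun i => idx i = j).card := by
    intro j
    rw [blocksInFace_eq ν x hn, Finset.card_filter, Finset.card_filter,
      ← Fin.sum_univ_eq_sum_range (fun i => if idx i = j then 1 else 0)]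
    simp only [hidx, Fin.val_inj]
  simp only [h2]
  rw [Fin.prod_univ_eq_prod_range (fun j => ((Finset.range ν.length).filter fun i => idx i = j).card !)]
  refine (Finset.prod_subset ?_ ?_).symm
  · intro v hv
    obtain ⟨i, hi, rfl⟩ := Finset.mem_image.1 hv
    rw [hidx ⟨i, Finset.mem_range.1 hi⟩]
    exact Finset.mem_range.2 (faceOfBlock ν x _).2
  · intro v _ hv
    rw [Finset.filter_eq_empty_iff.2 fun i hi he => hv (Finset.mem_image.2 ⟨i, hi, he⟩)]
    rfl

open Classical in
theorem segmentWeight_blockChords (hn : 1 ≤ n) : segmentWeight ν (blockChords ν x) =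
    if SlopesAntitone ν (walk x) then
      ((ν.blocks.prod * ∏ i ∈ Finset.range ν.length, slopeRank ν (walk x) i : ℕ) : ℝ≥0∞)⁻¹
    else 0 := by
  rw [segmentWeight]
  by_cases h : SlopesAntitone ν (walk x)
  · rw [if_pos h, if_pos ⟨(concaveOn_blockChords_iff hn ν x).2 h, refinesFaces_blockChords ν x hn⟩,
      prod_factorial_blocksInFace hn h, ← List.prod_ofFn, ν.ofFn_blocksFun]
  · rw [if_neg h, if_neg fun h' => h ((concaveOn_blockChords_iff hn ν x).1 h'.1)]

end Faces

/-! ### Permutations that act cyclically on each block -/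

section Cyclic

variable {n : ℕ} {ν : Composition n} {σ : Equiv.Perm (Fin n)}

theorem isBlockCyclic_iff : IsBlockCyclic ν σ ↔ IsBlockArrangement ν 1 σ := by
  rw [IsBlockCyclic, IsBlockArrangement, arrange_one]
  rfl

theorem IsBlockCyclic.blockSlope_eq (h : IsBlockCyclic ν σ) (x : Fin n → ℝ) {i : ℕ}
    (hi : i < ν.length) :
    blockSlope ν (walk fun a => x (σ a)) i = blockSlope ν (walk x) i := by
  have := (isBlockCyclic_iff.1 h).blockSlope_eq x ⟨i, hi⟩
  rwa [arrange_one] at this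

theorem IsBlockCyclic.shiftCount_eq (h : IsBlockCyclic ν σ) (x : Fin n → ℝ) :
    shiftCount ν (fun a => x (σ a)) = shiftCount ν x := by
  have := (isBlockCyclic_iff.1 h).shiftCount_eq x
  rwa [arrange_one] at this

theorem IsBlockCyclic.slopesAntitone_iff (h : IsBlockCyclic ν σ) (x : Fin n → ℝ) :
    SlopesAntitone ν (walk fun a => x (σ a)) ↔ SlopesAntitone ν (walk x) := by
  refine forall₄_congr fun i j hij hj => ?_
  rw [h.blockSlope_eq x hj, h.blockSlope_eq x (by omega)]

theorem IsBlockCyclic.slopeRank_eq (h : IsBlockCyclic ν σ) (x : Fin n → ℝ) {i : ℕ}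
    (hi : i < ν.length) :
    slopeRank ν (walk fun a => x (σ a)) i = slopeRank ν (walk x) i := by
  rw [slopeRank, slopeRank]
  congr 1
  refine Finset.filter_congr fun j hj => ?_
  rw [h.blockSlope_eq x hi, h.blockSlope_eq x (Finset.mem_range.1 hj)]

theorem IsBlockCyclic.chordFun_eq (h : IsBlockCyclic ν σ) (x : Fin n → ℝ) :
    chordFun ν (walk fun a => x (σ a)) = chordFun ν (walk x) := by
  funext t
  rw [chordFun, chordFun, walk_zero, walk_zero]
  congr 1
  refine Finset.sum_congr rfl fun i hi => ?_
  rw [h.blockSlope_eq x (Finset.mem_range.1 hi)]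

theorem IsBlockCyclic.blockChords_eq (h : IsBlockCyclic ν σ) (x : Fin n → ℝ) :
    blockChords ν (fun a => x (σ a)) = blockChords ν x := by
  funext t
  rw [blockChords_eq_chordFun, blockChords_eq_chordFun, h.chordFun_eq]

/-- Blockwise cyclic permutations do not move the chord function, so staying below the profile means
staying below the chords of the shifted walk itself. -/
theorem mem_goodShifts_iff (hn : 1 ≤ n) (x : Fin n → ℝ) (σ : Equiv.Perm (Fin n)) :
    σ ∈ goodShifts ν (blockChords ν x) x ↔
      IsBlockCyclic ν σ ∧ BelowChords ν (walk fun a => x (σ a)) := by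
  simp only [goodShifts, Finset.mem_filter, Finset.mem_univ, true_and]
  refine and_congr_right fun h => ?_
  rw [belowChords_iff_le_chordFun hn, h.chordFun_eq]
  constructor
  · intro h' j hj
    rcases Nat.eq_zero_or_pos j with rfl | hj0
    · simp only [Nat.cast_zero]
      have := chordFun_sizeUpTo ν (walk x) (ν.length_pos_iff.2 hn)
      simp only [Composition.sizeUpTo_zero, Nat.cast_zero] at this
      rw [this, walk_zero, walk_zero]
    · have := h' j hj0 hj
      rwa [blockChords_val ν x (Nat.cast_nonneg _) (by exact_mod_cast hj)] at this
  · intro h' j _ hj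
    rw [blockChords_val ν x (Nat.cast_nonneg _) (by exact_mod_cast hj)]
    exact h' j hj

theorem card_goodShifts (hn : 1 ≤ n) (x : Fin n → ℝ) :
    (goodShifts ν (blockChords ν x) x).card = shiftCount ν x := by
  classical
  rw [← card_belowChords ν 1 x]
  congr 1
  ext σ
  rw [mem_goodShifts_iff hn, isBlockCyclic_iff, arrange_one]
  simp

open Classical in
theorem card_isBlockCyclic (ν : Composition n) :
    (Finset.univ.filter fun σ => IsBlockCyclic ν σ).card = ν.blocks.prod := by
  simp only [isBlockCyclic_iff]
  rw [card_isBlockArrangement, ← List.prod_ofFn, ν.ofFn_blocksFun]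

end Cyclic

/-! ### Measurability -/

section Measurability

variable {n : ℕ}

theorem measurable_card_filter {α β : Type*} [MeasurableSpace α] (s : Finset β)
    (p : α → β → Prop) [∀ a, DecidablePred (p a)] (h : ∀ b, Measurable fun a => p a b) :
    Measurable fun a => (s.filter (p a)).card := by
  simp only [Finset.card_filter]
  refine Finset.measurable_fun_sum s fun b _ => ?_
  exact Measurable.ite (measurableSet_setOfPred.2 (h b)) measurable_const measurable_const

theorem measurable_le {α : Type*} [MeasurableSpace α] {f g : α → ℝ} (hf : Measurable f)
    (hg : Measurable g) : Measurable fun a => f a ≤ g a :=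
  measurableSet_setOfPred.1 (measurableSet_le hf hg)

theorem measurable_eq_real {α : Type*} [MeasurableSpace α] {f g : α → ℝ} (hf : Measurable f)
    (hg : Measurable g) : Measurable fun a => f a = g a :=
  measurableSet_setOfPred.1 (measurableSet_eq_fun hf hg)

theorem measurable_walk (j : ℕ) : Measurable fun x : Fin n → ℝ => walk x j :=
  Finset.measurable_fun_sum _ fun i _ => measurable_pi_apply i

theorem measurable_path : Measurable (path : (Fin n → ℝ) → Fin (n + 1) → ℝ) :=
  measurable_pi_lambda _ fun j => measurable_walk j

theorem measurable_chordSlope (p j : ℕ) :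
    Measurable fun x : Fin n → ℝ => chordSlope (walk x) p j :=
  ((measurable_walk _).sub (measurable_walk _)).div_const _

theorem measurable_blockSlope (ν : Composition n) (i : ℕ) :
    Measurable fun x : Fin n → ℝ => blockSlope ν (walk x) i :=
  measurable_chordSlope _ _

theorem measurable_slopesAntitone (ν : Composition n) :
    Measurable fun x : Fin n → ℝ => SlopesAntitone ν (walk x) :=
  Measurable.forall fun i => Measurable.forall fun j => measurable_const.imp <|
    measurable_const.imp <| measurable_le (measurable_blockSlope ν j) (measurable_blockSlope ν i)

theorem measurable_belowChords (ν : Composition n) :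
    Measurable fun x : Fin n → ℝ => BelowChords ν (walk x) :=
  Measurable.forall fun i => measurable_const.imp <| Measurable.forall fun _ =>
    measurable_const.imp <| measurable_const.imp <|
      measurable_le (measurable_chordSlope _ _) (measurable_blockSlope ν i)

theorem measurable_isMajorizing (L : Composition n) (τ : Equiv.Perm (Fin L.length)) :
    Measurable fun z : Fin n → ℝ => IsMajorizing L τ z := by
  simp only [isMajorizing_iff]
  exact (measurable_slopesAntitone _).and (measurable_belowChords _)

theorem measurable_slopeRank (ν : Composition n) (i : ℕ) :
    Measurable fun x : Fin n → ℝ => slopeRank ν (walk x) i := by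
  refine measurable_card_filter _ _ fun j => measurable_const.and ?_
  exact measurable_eq_real (measurable_blockSlope ν j) (measurable_blockSlope ν i)

theorem measurable_touchCount (p b : ℕ) :
    Measurable fun x : Fin n → ℝ => touchCount (walk x) p b :=
  measurable_card_filter _ _ fun _ =>
    measurable_eq_real (measurable_chordSlope _ _) (measurable_chordSlope _ _)

theorem measurable_segmentProb (ν : Composition n) :
    Measurable fun x : Fin n → ℝ => segmentProb ν (walk x) := by
  classical
  refine Measurable.ite (measurableSet_setOfPred.2
    ((measurable_slopesAntitone ν).and (measurable_belowChords ν))) ?_ measurable_const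
  refine Measurable.inv ?_
  have h : Measurable fun x : Fin n → ℝ => ∏ i ∈ Finset.range ν.length,
      touchCount (walk x) (ν.sizeUpTo i) (blockSize ν i) * slopeRank ν (walk x) i :=
    Finset.measurable_fun_prod _ fun i _ =>
      (measurable_touchCount _ _).mul (measurable_slopeRank ν i)
  exact (measurable_from_nat (f := fun k : ℕ => (k : NNReal))).comp h

theorem measurable_blockChords (ν : Composition n) :
    Measurable (blockChords ν : (Fin n → ℝ) → Profile n) := by
  refine measurable_pi_lambda _ fun t => Finset.measurable_fun_sum _ fun i _ => ?_
  exact (measurable_chordSlope _ _).mul_const _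

theorem measurable_comp_perm (σ : Equiv.Perm (Fin n)) :
    Measurable fun (x : Fin n → ℝ) i => x (σ i) :=
  measurable_pi_lambda _ fun i => measurable_pi_apply (σ i)

theorem measurable_val (t : ℝ) : Measurable fun c : Profile n => c.val t :=
  measurable_pi_apply _

theorem measurable_blockEndValues (ν : Composition n) :
    Measurable (blockEndValues ν : (Fin n → ℝ) → Fin ν.length → ℝ) :=
  measurable_pi_lambda _ fun _ => measurable_walk _

theorem measurable_blockEndValuesOf (ν : Composition n) :
    Measurable (blockEndValuesOf ν : Profile n → Fin ν.length → ℝ) :=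
  measurable_pi_lambda _ fun _ => measurable_val _

/-- The finitely many events that `ν` is a possible segment composition cover everything, and on
each of them the majorant is the measurable function `blockChords ν`. -/
theorem measurable_concaveMajorant_path (hn : 1 ≤ n) :
    Measurable fun x : Fin n → ℝ => concaveMajorant (path x) := by
  intro A hA
  have h : (fun x : Fin n → ℝ => concaveMajorant (path x)) ⁻¹' A =
      ⋃ ν : Composition n, {x | SlopesAntitone ν (walk x) ∧ BelowChords ν (walk x)} ∩
        blockChords ν ⁻¹' A := by
    ext x
    simp only [Set.mem_preimage, Set.mem_iUnion, Set.mem_inter_iff, Set.mem_ofPred_eq]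
    constructor
    · intro hx
      obtain ⟨ν, h1, h2⟩ := exists_slopesAntitone_belowChords n (walk x)
      exact ⟨ν, ⟨h1, h2⟩, by rwa [← concaveMajorant_eq_blockChords hn h1 h2]⟩
    · rintro ⟨ν, ⟨h1, h2⟩, hx⟩
      rwa [concaveMajorant_eq_blockChords hn h1 h2]
  rw [h]
  exact MeasurableSet.iUnion fun ν => (measurableSet_setOfPred.2
    ((measurable_slopesAntitone ν).and (measurable_belowChords ν))).inter
    (measurable_blockChords ν hA)

theorem path_sub_eq (s : Fin (n + 1) → ℝ) :
    (fun j => path (fun i : Fin n => s i.succ - s i.castSucc) j + s 0) = s := by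
  funext j
  have h : ∀ k (hk : k < n + 1), walk (fun i : Fin n => s i.succ - s i.castSucc) k =
      s ⟨k, hk⟩ - s 0 := by
    intro k
    induction k with
    | zero => intro _; rw [walk_zero]; exact (sub_self _).symm
    | succ k ih =>
      intro hk
      have hk' : k < n := by omega
      rw [walk_eq_sum_increment, Finset.sum_range_succ, ← walk_eq_sum_increment, ih (by omega),
        increment, dif_pos hk']
      simp only [Fin.succ_mk, Fin.castSucc_mk]
      ring
  rw [path, h j j.2]
  simp

theorem measurable_concaveMajorant (hn : 1 ≤ n) :
    Measurable (concaveMajorant : (Fin (n + 1) → ℝ) → Profile n) := by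
  refine measurable_pi_lambda _ fun t => ?_
  have h : (fun s : Fin (n + 1) → ℝ => concaveMajorant s t) = fun s =>
      concaveMajorant (path fun i : Fin n => s i.succ - s i.castSucc) t + s 0 := by
    funext s
    conv_lhs => rw [← path_sub_eq s]
    exact concaveMajorant_add_const _ _ _
  rw [h]
  refine Measurable.add ?_ (measurable_pi_apply 0)
  refine ((measurable_pi_apply t).comp (measurable_concaveMajorant_path hn)).comp ?_
  exact measurable_pi_lambda _ fun i => (measurable_pi_apply _).sub (measurable_pi_apply _)

theorem lintegral_uniformMix {α β : Type*} [MeasurableSpace β] (s : Finset α) (m : α → Measure β)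
    (f : β → ℝ≥0∞) :
    ∫⁻ b, f b ∂uniformMix s m = (s.card : ℝ≥0∞)⁻¹ * ∑ a ∈ s, ∫⁻ b, f b ∂m a := by
  rw [uniformMix, lintegral_smul_measure, lintegral_finsetSum_measure, smul_eq_mul]

theorem uniformMix_apply {α β : Type*} [MeasurableSpace β] (s : Finset α) (m : α → Measure β)
    (B : Set β) : uniformMix s m B = (s.card : ℝ≥0∞)⁻¹ * ∑ a ∈ s, m a B := by
  rw [uniformMix, Measure.smul_apply, Measure.finsetSum_apply, smul_eq_mul]

theorem uniformMix_univ_le {α β : Type*} [MeasurableSpace β] (s : Finset α) (m : α → Measure β)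
    (h : ∀ a, m a Set.univ ≤ 1) : uniformMix s m Set.univ ≤ 1 := by
  rw [uniformMix_apply]
  have h1 : ∑ a ∈ s, m a Set.univ ≤ s.card := by
    refine (Finset.sum_le_sum fun a _ => h a).trans ?_
    simp
  refine (mul_le_mul_right h1 _).trans ?_
  exact ENNReal.inv_mul_le_one _

theorem measurable_uniformMix {α β γ : Type*} [MeasurableSpace α] [Fintype β] [MeasurableSpace γ]
    {s : α → Finset β} {m : α → β → Measure γ} (hs : ∀ b, Measurable fun a => b ∈ s a)
    (hm : ∀ b, Measurable fun a => m a b) : Measurable fun a => uniformMix (s a) (m a) := by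
  classical
  refine Measure.measurable_of_measurable_coe _ fun B hB => ?_
  simp only [uniformMix_apply]
  have h1 : ∀ a, s a = Finset.univ.filter fun b => b ∈ s a := fun a => by ext; simp
  refine Measurable.mul ?_ ?_
  · refine Measurable.inv ?_
    have : Measurable fun a => (s a).card := by
      have h2 := measurable_card_filter Finset.univ (fun a b => b ∈ s a) hs
      simpa only [← h1] using h2
    exact (measurable_from_nat (f := fun k : ℕ => (k : ℝ≥0∞))).comp this
  · have h2 : ∀ a, ∑ b ∈ s a, m a b B = ∑ b, if b ∈ s a then m a b B else 0 := by
      intro a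
      rw [← Finset.sum_filter, ← h1]
    simp only [h2]
    refine Finset.measurable_fun_sum _ fun b _ => ?_
    exact Measurable.ite (measurableSet_setOfPred.2 (hs b))
      ((Measure.measurable_coe hB).comp (hm b)) measurable_const

theorem measurable_mem_goodArrangements (L : Composition n)
    (p : Equiv.Perm (Fin L.length) × Equiv.Perm (Fin n)) :
    Measurable fun x : Fin n → ℝ => p ∈ goodArrangements L x := by
  simp only [goodArrangements, Finset.mem_filter, Finset.mem_univ, true_and]
  exact measurable_const.and ((measurable_isMajorizing L p.1).comp (measurable_comp_perm p.2))

theorem measurable_mem_goodShifts (ν : Composition n) (σ : Equiv.Perm (Fin n)) :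
    Measurable fun p : Profile n × (Fin n → ℝ) => σ ∈ goodShifts ν p.1 p.2 := by
  simp only [goodShifts, Finset.mem_filter, Finset.mem_univ, true_and]
  refine measurable_const.and (Measurable.forall fun j => measurable_const.imp <|
    measurable_const.imp <| measurable_le ?_ ?_)
  · exact ((measurable_walk j).comp (measurable_comp_perm σ)).comp measurable_snd
  · exact (measurable_val _).comp measurable_fst

/-- The last step of the construction of the walk from its concave majorant. -/
noncomputable def shiftedPathLaw (ν : Composition n) (c : Profile n) (y : Fin n → ℝ) :
    Measure (Fin (n + 1) → ℝ) :=
  uniformMix (goodShifts ν c y) fun σ => Measure.dirac (path fun i => y (σ i))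

theorem measurable_shiftedPathLaw (ν : Composition n) :
    Measurable fun p : Profile n × (Fin n → ℝ) => shiftedPathLaw ν p.1 p.2 :=
  measurable_uniformMix (measurable_mem_goodShifts ν) fun σ => Measure.measurable_dirac.comp
    ((measurable_path.comp (measurable_comp_perm σ)).comp measurable_snd)

theorem measurable_rearrangement_kernel : Measurable fun x : Fin n → ℝ =>
    uniformMix (Finset.univ : Finset (Equiv.Perm (Fin n))) fun π =>
      uniformMix (goodArrangements (cycleLengths π) x) fun p =>
        Measure.dirac (arrange (cycleLengths π) p.1, path fun i => x (p.2 i)) := by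
  refine measurable_uniformMix (fun _ => measurable_const) fun π => ?_
  refine measurable_uniformMix (measurable_mem_goodArrangements _) fun p => ?_
  exact Measure.measurable_dirac.comp
    (measurable_const.prodMk (measurable_path.comp (measurable_comp_perm p.2)))

end Measurability

/-! ### Exchangeability: the joint law of segment composition and rearranged walk -/

section Laws

variable {n : ℕ} {μ : Measure (Fin n → ℝ)}

theorem lintegral_comp_perm (hμ : ∀ σ : Equiv.Perm (Fin n), μ.map (fun x i => x (σ i)) = μ)
    (σ : Equiv.Perm (Fin n)) {f : (Fin n → ℝ) → ℝ≥0∞} (hf : Measurable f) :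
    ∫⁻ x, f (fun i => x (σ i)) ∂μ = ∫⁻ x, f x ∂μ := by
  conv_rhs => rw [← hμ σ, lintegral_map hf (measurable_comp_perm σ)]

theorem segmentProb_eq {ν : Composition n} {x : Fin n → ℝ} (h1 : SlopesAntitone ν (walk x))
    (h2 : BelowChords ν (walk x)) : segmentProb ν (walk x) =
      ((shiftCount ν x * ∏ i ∈ Finset.range ν.length, slopeRank ν (walk x) i : ℕ) : NNReal)⁻¹ := by
  rw [segmentProb, if_pos ⟨h1, h2⟩, h2.shiftCount_eq, Finset.prod_mul_distrib]

theorem slopeRank_pos (ν : Composition n) (s : ℕ → ℝ) {i : ℕ} (hi : i < ν.length) :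
    0 < slopeRank ν s i :=
  Finset.card_pos.2 ⟨i, Finset.mem_filter.2 ⟨Finset.mem_range.2 hi, le_rfl, rfl⟩⟩

theorem prod_slopeRank_pos (ν : Composition n) (s : ℕ → ℝ) :
    0 < ∏ i ∈ Finset.range ν.length, slopeRank ν s i :=
  Finset.prod_pos fun _ hi => slopeRank_pos ν s (Finset.mem_range.1 hi)

theorem coe_segmentProb {ν : Composition n} {x : Fin n → ℝ} (h1 : SlopesAntitone ν (walk x))
    (h2 : BelowChords ν (walk x)) : (segmentProb ν (walk x) : ℝ≥0∞) =
      ((shiftCount ν x * ∏ i ∈ Finset.range ν.length, slopeRank ν (walk x) i : ℕ) : ℝ≥0∞)⁻¹ := by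
  have h : ((shiftCount ν x * ∏ i ∈ Finset.range ν.length, slopeRank ν (walk x) i : ℕ) : NNReal)
      ≠ 0 := by
    have := Nat.mul_pos (shiftCount_pos ν x) (prod_slopeRank_pos ν (walk x))
    exact_mod_cast this.ne'
  rw [segmentProb_eq h1 h2, ENNReal.coe_inv h, ENNReal.coe_natCast]

theorem segmentProb_of_not {ν : Composition n} {s : ℕ → ℝ}
    (h : ¬(SlopesAntitone ν s ∧ BelowChords ν s)) : segmentProb ν s = 0 :=
  if_neg h

/-- The reciprocal of the number of admissible arrangements is `segmentProb` at the rearranged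
increments, and it vanishes for inadmissible ones. So the sum extends over all block arrangements, a
set independent of `x`, and each `σ` can be removed by exchangeability. -/
theorem lintegral_goodArrangements
    (hμ : ∀ σ : Equiv.Perm (Fin n), μ.map (fun x i => x (σ i)) = μ) (L : Composition n)
    {g : Composition n × (Fin (n + 1) → ℝ) → ℝ≥0∞} (hg : Measurable g) :
    ∫⁻ x, ((goodArrangements L x).card : ℝ≥0∞)⁻¹ * ∑ p ∈ goodArrangements L x,
      g (arrange L p.1, path fun i => x (p.2 i)) ∂μ =
      ∑ ν : Composition n, ((Finset.univ.filter fun τ : Equiv.Perm (Fin L.length) =>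
        arrange L τ = ν).card * ν.blocks.prod : ℕ) *
          ∫⁻ z, segmentProb ν (walk z) * g (ν, path z) ∂μ := by
  classical
  set H : Composition n → ℝ≥0∞ := fun ν => ∫⁻ z, segmentProb ν (walk z) * g (ν, path z) ∂μ with hH
  have hmeas : ∀ ν : Composition n, Measurable fun z : Fin n → ℝ =>
      (segmentProb ν (walk z) : ℝ≥0∞) * g (ν, path z) := fun ν =>
    (measurable_segmentProb ν).coe_nnreal_ennreal.mul
      (hg.comp (measurable_const.prodMk measurable_path))
  have hpt : ∀ x, ((goodArrangements L x).card : ℝ≥0∞)⁻¹ * ∑ p ∈ goodArrangements L x,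
      g (arrange L p.1, path fun i => x (p.2 i)) =
      ∑ p : Equiv.Perm (Fin L.length) × Equiv.Perm (Fin n),
        if IsBlockArrangement L p.1 p.2 then
          (segmentProb (arrange L p.1) (walk fun i => x (p.2 i)) : ℝ≥0∞) *
            g (arrange L p.1, path fun i => x (p.2 i)) else 0 := by
    intro x
    have hG : goodArrangements L x = Finset.univ.filter fun p => p ∈ goodArrangements L x := by
      ext; simp
    rw [Finset.mul_sum, Finset.sum_congr hG fun _ _ => rfl, Finset.sum_filter]
    refine Finset.sum_congr rfl fun p _ => ?_
    have hmem : p ∈ goodArrangements L x ↔ IsBlockArrangement L p.1 p.2 ∧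
        IsMajorizing L p.1 (fun i => x (p.2 i)) := by
      simp [goodArrangements]
    by_cases h1 : IsBlockArrangement L p.1 p.2
    · rw [if_pos h1]
      by_cases h2 : IsMajorizing L p.1 (fun i => x (p.2 i))
      · have h3 := (isMajorizing_iff L p.1 _).1 h2
        rw [if_pos (hmem.2 ⟨h1, h2⟩), coe_segmentProb h3.1 h3.2, card_goodArrangements h1 h2]
      · rw [if_neg fun h => h2 (hmem.1 h).2,
          segmentProb_of_not fun h => h2 ((isMajorizing_iff L p.1 _).2 h)]
        simp
    · rw [if_neg h1, if_neg fun h => h1 (hmem.1 h).1]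
  simp only [hpt]
  rw [lintegral_finsetSum]
  · have hterm : ∀ p : Equiv.Perm (Fin L.length) × Equiv.Perm (Fin n),
        ∫⁻ x, (if IsBlockArrangement L p.1 p.2 then
          (segmentProb (arrange L p.1) (walk fun i => x (p.2 i)) : ℝ≥0∞) *
            g (arrange L p.1, path fun i => x (p.2 i)) else 0) ∂μ =
        if IsBlockArrangement L p.1 p.2 then H (arrange L p.1) else 0 := by
      intro p
      split_ifs
      · exact lintegral_comp_perm hμ p.2 (hmeas (arrange L p.1))
      · simp
    simp only [hterm, Fintype.sum_prod_type]
    have hin : ∀ τ : Equiv.Perm (Fin L.length),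
        (∑ σ, if IsBlockArrangement L τ σ then H (arrange L τ) else 0) =
        ∑ ν : Composition n, if arrange L τ = ν then (ν.blocks.prod : ℝ≥0∞) * H ν else 0 := by
      intro τ
      rw [Finset.sum_ite_eq, if_pos (Finset.mem_univ _), ← Finset.sum_filter, Finset.sum_const,
        card_isBlockArrangement, nsmul_eq_mul]
      have hp : (arrange L τ).blocks.prod = ∏ b, L.blocksFun b := by
        rw [arrange]
        simp only [List.prod_ofFn]
        exact Equiv.prod_comp τ L.blocksFun
      rw [hp]
    rw [Finset.sum_congr rfl fun τ _ => hin τ, Finset.sum_comm]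
    refine Finset.sum_congr rfl fun ν _ => ?_
    rw [← Finset.sum_filter, Finset.sum_const, nsmul_eq_mul, Nat.cast_mul, mul_assoc]
  · intro p _
    split_ifs
    · exact (hmeas (arrange L p.1)).comp (measurable_comp_perm p.2)
    · exact measurable_const

theorem lintegral_rearrangementLaw
    (hμ : ∀ σ : Equiv.Perm (Fin n), μ.map (fun x i => x (σ i)) = μ)
    {g : Composition n × (Fin (n + 1) → ℝ) → ℝ≥0∞} (hg : Measurable g) :
    ∫⁻ p, g p ∂rearrangementLaw μ =
      ∑ ν : Composition n, ∫⁻ z, segmentProb ν (walk z) * g (ν, path z) ∂μ := by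
  rw [rearrangementLaw, Measure.lintegral_bind measurable_rearrangement_kernel.aemeasurable
    hg.aemeasurable]
  simp only [lintegral_uniformMix, lintegral_dirac' _ hg]
  rw [lintegral_const_mul, lintegral_finsetSum, Finset.sum_congr rfl fun π _ =>
    lintegral_goodArrangements hμ (cycleLengths π) hg, Finset.sum_comm, Finset.mul_sum]
  · refine Finset.sum_congr rfl fun ν _ => ?_
    rw [← Finset.sum_mul, ← Nat.cast_sum, sum_arrange_cycleLengths, ← mul_assoc, Finset.card_univ,
      Fintype.card_perm, Fintype.card_fin, ENNReal.inv_mul_cancel, one_mul]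
    · exact_mod_cast n.factorial_ne_zero
    · exact ENNReal.natCast_ne_top _
  all_goals
    have hm : ∀ π : Equiv.Perm (Fin n), Measurable fun x : Fin n → ℝ =>
        ((goodArrangements (cycleLengths π) x).card : ℝ≥0∞)⁻¹ *
          ∑ p ∈ goodArrangements (cycleLengths π) x,
            g (arrange (cycleLengths π) p.1, path fun i => x (p.2 i)) := by
      intro π
      have h1 := (Measure.measurable_lintegral hg).comp (measurable_uniformMix (m := fun x p =>
          Measure.dirac (arrange (cycleLengths π) p.1, path fun i => x (p.2 i)))
        (measurable_mem_goodArrangements (cycleLengths π)) fun p =>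
          Measure.measurable_dirac.comp
            (measurable_const.prodMk (measurable_path.comp (measurable_comp_perm p.2))))
      simpa only [Function.comp_def, lintegral_uniformMix, lintegral_dirac' _ hg] using h1
  · exact fun π _ => hm π
  · exact Finset.measurable_fun_sum _ fun π _ => hm π

theorem lintegral_sum_segmentProb {f : (Fin n → ℝ) → ℝ≥0∞} (hf : Measurable f) :
    ∑ ν : Composition n, ∫⁻ z, segmentProb ν (walk z) * f z ∂μ = ∫⁻ z, f z ∂μ := by
  rw [← lintegral_finsetSum]
  · refine lintegral_congr fun z => ?_
    rw [← Finset.sum_mul, ← ENNReal.ofNNReal_finsetSum, sum_segmentProb, ENNReal.coe_one, one_mul]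
  · exact fun ν _ => (measurable_segmentProb ν).coe_nnreal_ennreal.mul hf

/-- Summing out the segment composition leaves the law of the original walk, because the
`segmentProb` add up to `1`. -/
theorem map_concaveMajorant_rearrangementLaw (hn : 1 ≤ n)
    (hμ : ∀ σ : Equiv.Perm (Fin n), μ.map (fun x i => x (σ i)) = μ) :
    (rearrangementLaw μ).map (fun p => concaveMajorant p.2) =
      μ.map fun x => concaveMajorant (path x) := by
  have hC := measurable_concaveMajorant hn
  ext A hA
  have hm : MeasurableSet ((fun p : Composition n × (Fin (n + 1) → ℝ) =>
      concaveMajorant p.2) ⁻¹' A) := (hC.comp measurable_snd) hA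
  rw [Measure.map_apply (f := fun p : Composition n × (Fin (n + 1) → ℝ) => concaveMajorant p.2)
    (hC.comp measurable_snd) hA,
    Measure.map_apply (measurable_concaveMajorant_path hn) hA, ← lintegral_indicator_one hm,
    lintegral_rearrangementLaw hμ (measurable_one.indicator hm),
    ← lintegral_indicator_one (measurable_concaveMajorant_path hn hA),
    ← lintegral_sum_segmentProb
      (measurable_one.indicator (measurable_concaveMajorant_path hn hA))]
  rfl

theorem measurable_segmentWeight_blockChords (hn : 1 ≤ n) (ν : Composition n) :
    Measurable fun x : Fin n → ℝ => segmentWeight ν (blockChords ν x) := by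
  classical
  simp only [segmentWeight_blockChords hn]
  refine Measurable.ite (measurableSet_setOfPred.2 (measurable_slopesAntitone ν)) ?_
    measurable_const
  refine Measurable.inv ?_
  have h : Measurable fun x : Fin n → ℝ => ν.blocks.prod *
      ∏ i ∈ Finset.range ν.length, slopeRank ν (walk x) i :=
    (Finset.measurable_fun_prod _ fun i _ => measurable_slopeRank ν i).const_mul _
  exact (measurable_from_nat (f := fun k : ℕ => (k : ℝ≥0∞))).comp h

theorem natCast_mul_inv (a b : ℕ) :
    ((a * b : ℕ) : ℝ≥0∞)⁻¹ = (a : ℝ≥0∞)⁻¹ * (b : ℝ≥0∞)⁻¹ := by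
  rw [Nat.cast_mul, ENNReal.mul_inv (Or.inr (ENNReal.natCast_ne_top _))
    (Or.inl (ENNReal.natCast_ne_top _))]

/-- Averaging over the cyclic permutations of the blocks. -/
theorem lintegral_segmentProb_mul (hn : 1 ≤ n)
    (hμ : ∀ σ : Equiv.Perm (Fin n), μ.map (fun x i => x (σ i)) = μ) (ν : Composition n)
    {F : Profile n → ℝ≥0∞} (hF : Measurable F) {f : (Fin n → ℝ) → ℝ≥0∞} (hf : Measurable f) :
    ∫⁻ z, segmentProb ν (walk z) * (F (concaveMajorant (path z)) * f z) ∂μ =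
      ∫⁻ x, segmentWeight ν (blockChords ν x) * (F (blockChords ν x) *
        (((goodShifts ν (blockChords ν x) x).card : ℝ≥0∞)⁻¹ *
          ∑ σ ∈ goodShifts ν (blockChords ν x) x, f fun i => x (σ i))) ∂μ := by
  classical
  set ψ : (Fin n → ℝ) → ℝ≥0∞ := fun z =>
    segmentProb ν (walk z) * (F (blockChords ν z) * f z) with hψ
  have hψm : Measurable ψ := (measurable_segmentProb ν).coe_nnreal_ennreal.mul
    ((hF.comp (measurable_blockChords ν)).mul hf)
  -- On the support of `segmentProb ν` the majorant is `blockChords ν`, which, unlike the majorant,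
  -- is invariant under blockwise cyclic permutations.
  have h1 : ∀ z, segmentProb ν (walk z) * (F (concaveMajorant (path z)) * f z) = ψ z := by
    intro z
    by_cases h : SlopesAntitone ν (walk z) ∧ BelowChords ν (walk z)
    · rw [hψ, concaveMajorant_eq_blockChords hn h.1 h.2]
    · simp only [hψ, segmentProb_of_not h, ENNReal.coe_zero, zero_mul]
  have hprod : (ν.blocks.prod : ℝ≥0∞) ≠ 0 := by
    have : ν.blocks.prod ≠ 0 := by
      rw [Ne, List.prod_eq_zero_iff]
      exact fun h => lt_irrefl _ (ν.blocks_pos h)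
    exact_mod_cast this
  -- By exchangeability every blockwise cyclic permutation gives the same integral; averaging over
  -- all of them produces the factor `1 / ∏ n_i`.
  have h2 : ∫⁻ z, ψ z ∂μ = (ν.blocks.prod : ℝ≥0∞)⁻¹ *
      ∑ σ ∈ Finset.univ.filter (fun σ : Equiv.Perm (Fin n) => IsBlockCyclic ν σ),
        ∫⁻ x, ψ (fun i => x (σ i)) ∂μ := by
    rw [Finset.sum_congr rfl fun σ _ => lintegral_comp_perm hμ σ hψm, Finset.sum_const,
      card_isBlockCyclic, nsmul_eq_mul, ← mul_assoc,
      ENNReal.inv_mul_cancel hprod (ENNReal.natCast_ne_top _), one_mul]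
  simp only [h1]
  have hψσ : ∀ σ : Equiv.Perm (Fin n), Measurable fun x : Fin n → ℝ => ψ fun i => x (σ i) :=
    fun σ => hψm.comp (measurable_comp_perm σ)
  rw [h2, ← lintegral_finsetSum _ fun σ _ => hψσ σ,
    ← lintegral_const_mul _ (Finset.measurable_fun_sum _ fun σ _ => hψσ σ)]
  refine lintegral_congr fun x => ?_
  rw [card_goodShifts hn, segmentWeight_blockChords hn]
  have hG : goodShifts ν (blockChords ν x) x =
      (Finset.univ.filter fun σ : Equiv.Perm (Fin n) => IsBlockCyclic ν σ).filter
        fun σ => BelowChords ν (walk fun i => x (σ i)) := by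
    ext σ
    rw [mem_goodShifts_iff hn]
    simp
  rw [hG, Finset.sum_filter
    (s := Finset.univ.filter fun σ : Equiv.Perm (Fin n) => IsBlockCyclic ν σ),
    Finset.mul_sum, Finset.mul_sum, Finset.mul_sum, Finset.mul_sum]
  refine Finset.sum_congr rfl fun σ hσ => ?_
  have hc : IsBlockCyclic ν σ := (Finset.mem_filter.1 hσ).2
  simp only [hψ]
  rw [hc.blockChords_eq]
  -- The factor `shiftCount` of `segmentProb` is invariant and equals the number of good shifts, so
  -- it normalizes the sum to a mean; the ranks remain for `segmentWeight`.
  by_cases ha : SlopesAntitone ν (walk x)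
  · rw [if_pos ha]
    by_cases hb : BelowChords ν (walk fun i => x (σ i))
    · rw [if_pos hb, coe_segmentProb ((hc.slopesAntitone_iff x).2 ha) hb, hc.shiftCount_eq,
        Finset.prod_congr rfl fun i hi => hc.slopeRank_eq x (Finset.mem_range.1 hi)]
      rw [natCast_mul_inv, natCast_mul_inv]
      ring
    · rw [if_neg hb, segmentProb_of_not fun h => hb h.2]
      simp
  · rw [if_neg ha, segmentProb_of_not fun h => ha ((hc.slopesAntitone_iff x).1 h.1)]
    simp

theorem lintegral_segmentProb_mul_concaveMajorant (hn : 1 ≤ n)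
    (hμ : ∀ σ : Equiv.Perm (Fin n), μ.map (fun x i => x (σ i)) = μ) (ν : Composition n)
    {F : Profile n → ℝ≥0∞} (hF : Measurable F) :
    ∫⁻ z, segmentProb ν (walk z) * F (concaveMajorant (path z)) ∂μ =
      ∫⁻ x, segmentWeight ν (blockChords ν x) * F (blockChords ν x) ∂μ := by
  have h := lintegral_segmentProb_mul hn hμ ν hF (f := fun _ => 1) measurable_const
  simp only [mul_one, Finset.sum_const, nsmul_eq_mul] at h
  rw [h]
  refine lintegral_congr fun x => ?_
  rw [card_goodShifts hn, ENNReal.inv_mul_cancel, mul_one]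
  · exact_mod_cast (shiftCount_pos ν x).ne'
  · exact ENNReal.natCast_ne_top _

end Laws

/-! ### Profiles as functions of the block end values -/

section BlockEnds

variable {n : ℕ} (ν : Composition n)

theorem walk_sizeUpTo_of_blockEndValues_eq {x y : Fin n → ℝ}
    (h : blockEndValues ν x = blockEndValues ν y) {i : ℕ} (hi : i ≤ ν.length) :
    walk x (ν.sizeUpTo i) = walk y (ν.sizeUpTo i) := by
  rcases i with _ | i
  · rw [Composition.sizeUpTo_zero, walk_zero, walk_zero]
  · exact congrFun h ⟨i, hi⟩

theorem blockChords_congr {x y : Fin n → ℝ} (h : blockEndValues ν x = blockEndValues ν y) :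
    blockChords ν x = blockChords ν y := by
  funext t
  rw [blockChords_eq_chordFun, blockChords_eq_chordFun, chordFun, chordFun, walk_zero, walk_zero]
  congr 1
  refine Finset.sum_congr rfl fun i hi => ?_
  have hi' := Finset.mem_range.1 hi
  rw [blockSlope, blockSlope, chordSlope, chordSlope, sizeUpTo_add_blockSize,
    walk_sizeUpTo_of_blockEndValues_eq ν h (show i + 1 ≤ ν.length from hi'),
    walk_sizeUpTo_of_blockEndValues_eq ν h hi'.le]

theorem blockEndValuesOf_blockChords (x : Fin n → ℝ) :
    blockEndValuesOf ν (blockChords ν x) = blockEndValues ν x := by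
  funext i
  rw [blockEndValuesOf, blockChords_val ν x (Nat.cast_nonneg _)
    (by exact_mod_cast ν.sizeUpTo_le _), chordFun_sizeUpTo_succ ν _ i.2]
  rfl

/-- A walk that takes the values `v` at the block end points. -/
def stepWalk (v : Fin ν.length → ℝ) (j : ℕ) : ℝ :=
  if h : 1 ≤ j ∧ j ≤ n then v (ν.index ⟨j - 1, by omega⟩) else 0

/-- Increments of a walk with the values `v` at the block end points. -/
def liftEnds (v : Fin ν.length → ℝ) : Fin n → ℝ := fun a =>
  stepWalk ν v (a + 1) - stepWalk ν v a

theorem measurable_liftEnds : Measurable (liftEnds ν) := by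
  have h : ∀ j, Measurable fun v => stepWalk ν v j := by
    intro j
    unfold stepWalk
    split_ifs
    · exact measurable_pi_apply _
    · exact measurable_const
  exact measurable_pi_lambda _ fun a => (h _).sub (h _)

theorem blockEndValues_liftEnds (v : Fin ν.length → ℝ) :
    blockEndValues ν (liftEnds ν v) = v := by
  have hw : ∀ j ≤ n, walk (liftEnds ν v) j = stepWalk ν v j := by
    intro j
    induction j with
    | zero => intro _; simp [walk_zero, stepWalk]
    | succ j ih =>
      intro hj
      rw [walk_eq_sum_increment, Finset.sum_range_succ, ← walk_eq_sum_increment, ih (by omega),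
        increment, dif_pos (show j < n by omega), liftEnds]
      ring
  funext i
  rw [blockEndValues, hw _ (ν.sizeUpTo_le _), stepWalk]
  have h1 := ν.one_le_blocksFun i
  have h2 := ν.sizeUpTo_succ' i
  rw [dif_pos ⟨by omega, ν.sizeUpTo_le _⟩]
  congr 1
  have h3 : (⟨ν.sizeUpTo (i + 1) - 1, by have := ν.sizeUpTo_le (i + 1); omega⟩ : Fin n) =
      ν.embedding i ⟨ν.blocksFun i - 1, by omega⟩ := by
    ext
    rw [ν.coe_embedding]
    simp only
    omega
  rw [h3, ν.index_embedding]

end BlockEnds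

/-! ### Disintegration -/

section Conditional

variable {n : ℕ} {μ : Measure (Fin n → ℝ)}

/-- The defining property of `q` is tested on the event that the segment composition is `ν`; the
joint law and the average over cyclic shifts then give the explicit weight. -/
theorem lintegral_condDistrib_mul (hn : 1 ≤ n) [IsProbabilityMeasure μ]
    (hμ : ∀ σ : Equiv.Perm (Fin n), μ.map (fun x i => x (σ i)) = μ)
    {q : Kernel (Profile n) (Composition n)} [IsMarkovKernel q]
    (hq : HasCondDistrib (fun p : Composition n × (Fin (n + 1) → ℝ) => p.1)
      (fun p => concaveMajorant p.2) q (rearrangementLaw μ))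
    (ν : Composition n) {F : Profile n → ℝ≥0∞} (hF : Measurable F) :
    ∫⁻ c, q c {ν} * F c ∂(μ.map fun x => concaveMajorant (path x)) =
      ∫⁻ x, segmentWeight ν (blockChords ν x) * F (blockChords ν x) ∂μ := by
  classical
  have hC := measurable_concaveMajorant hn
  have hCp := measurable_concaveMajorant_path hn
  have : IsProbabilityMeasure (μ.map fun x => concaveMajorant (path x)) :=
    Measure.isProbabilityMeasure_map hCp.aemeasurable
  have hmap := hq.map_eq
  rw [map_concaveMajorant_rearrangementLaw hn hμ] at hmap
  set f : Profile n × Composition n → ℝ≥0∞ := fun p =>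
    ({ν} : Set (Composition n)).indicator 1 p.2 * F p.1 with hf
  have hfm : Measurable f :=
    ((measurable_one.indicator (measurableSet_singleton ν)).comp measurable_snd).mul
      (hF.comp measurable_fst)
  have hp : Measurable fun p : Composition n × (Fin (n + 1) → ℝ) => (concaveMajorant p.2, p.1) :=
    (hC.comp measurable_snd).prodMk measurable_fst
  have h1 := congrArg (fun m => ∫⁻ p, f p ∂m) hmap
  simp only at h1
  rw [lintegral_map hfm hp, Measure.lintegral_compProd hfm,
    lintegral_rearrangementLaw hμ (g := fun p => f (concaveMajorant p.2, p.1)) (hfm.comp hp)] at h1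
  rw [← lintegral_segmentProb_mul_concaveMajorant hn hμ ν hF]
  have h2 : ∀ c, ∫⁻ b, f (c, b) ∂q c = q c {ν} * F c := by
    intro c
    simp only [hf]
    rw [lintegral_mul_const _ (measurable_one.indicator (measurableSet_singleton ν)),
      lintegral_indicator_one (measurableSet_singleton ν)]
  simp only [h2] at h1
  rw [← h1, Finset.sum_eq_single ν]
  · simp [hf]
  · intro ν' _ hne
    simp [hf, hne]
  · simp

variable (q : Kernel (Profile n) (Composition n))
  (κ : (ν : Composition n) → Kernel (Fin ν.length → ℝ) (Fin n → ℝ))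

theorem threeStepLaw_apply (c : Profile n) {B : Set (Fin (n + 1) → ℝ)} (hB : MeasurableSet B) :
    threeStepLaw q κ c B = ∑ ν : Composition n,
      q c {ν} * ∫⁻ y, shiftedPathLaw ν c y B ∂κ ν (blockEndValuesOf ν c) := by
  rw [threeStepLaw, Measure.finsetSum_apply]
  refine Finset.sum_congr rfl fun ν _ => ?_
  rw [Measure.smul_apply, smul_eq_mul, Measure.bind_apply hB]
  · rfl
  · exact ((measurable_shiftedPathLaw ν).comp measurable_prodMk_left).aemeasurable

variable [IsMarkovKernel q] [∀ ν, IsMarkovKernel (κ ν)]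

theorem measurable_lintegral_shiftedPathLaw (ν : Composition n) {B : Set (Fin (n + 1) → ℝ)}
    (hB : MeasurableSet B) : Measurable fun c : Profile n =>
      ∫⁻ y, shiftedPathLaw ν c y B ∂κ ν (blockEndValuesOf ν c) := by
  have h : Measurable fun p : Profile n × (Fin n → ℝ) => shiftedPathLaw ν p.1 p.2 B :=
    (Measure.measurable_coe hB).comp (measurable_shiftedPathLaw ν)
  exact Measurable.lintegral_kernel_prod_right
    (κ := (κ ν).comap (blockEndValuesOf ν) (measurable_blockEndValuesOf ν)) h

/-- `threeStepLaw` as a kernel. -/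
noncomputable def threeStepKernel : Kernel (Profile n) (Fin (n + 1) → ℝ) where
  toFun := threeStepLaw q κ
  measurable' := by
    refine Measure.measurable_of_measurable_coe _ fun B hB => ?_
    simp only [threeStepLaw_apply q κ _ hB]
    exact Finset.measurable_fun_sum _ fun ν _ => (q.measurable_coe (measurableSet_singleton ν)).mul
      (measurable_lintegral_shiftedPathLaw κ ν hB)

-- Total mass at most `1` is all that holds at each profile by construction: for an arbitrary `c`
-- there may be no good shift, and then `uniformMix` is the zero measure.
instance : IsFiniteKernel (threeStepKernel q κ) := by
  refine ⟨⟨1, ENNReal.one_lt_top, fun c => ?_⟩⟩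
  change threeStepLaw q κ c Set.univ ≤ 1
  rw [threeStepLaw_apply q κ c MeasurableSet.univ]
  have h : ∀ ν : Composition n,
      q c {ν} * ∫⁻ y, shiftedPathLaw ν c y Set.univ ∂κ ν (blockEndValuesOf ν c) ≤ q c {ν} := by
    intro ν
    have h1 : ∫⁻ y, shiftedPathLaw ν c y Set.univ ∂κ ν (blockEndValuesOf ν c) ≤
        ∫⁻ _, 1 ∂κ ν (blockEndValuesOf ν c) :=
      lintegral_mono fun y => uniformMix_univ_le _ _ fun σ => by simp
    rw [lintegral_one, measure_univ] at h1
    exact (mul_le_mul_right h1 _).trans_eq (mul_one _)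
  refine (Finset.sum_le_sum fun ν _ => h ν).trans ?_
  rw [sum_measure_singleton, Finset.coe_univ, measure_univ]

theorem lintegral_condDistrib_blockEndValues {ν : Composition n} [IsProbabilityMeasure μ]
    (hκ : μ.map (fun x => (blockEndValues ν x, x)) = (μ.map (blockEndValues ν)) ⊗ₘ κ ν)
    {Θ : (Fin ν.length → ℝ) × (Fin n → ℝ) → ℝ≥0∞} (hΘ : Measurable Θ) :
    ∫⁻ x, ∫⁻ y, Θ (blockEndValues ν x, y) ∂κ ν (blockEndValues ν x) ∂μ =
      ∫⁻ x, Θ (blockEndValues ν x, x) ∂μ := by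
  have hV := measurable_blockEndValues ν
  have hp : Measurable fun x => (blockEndValues ν x, x) := hV.prodMk measurable_id
  rw [← lintegral_map (g := fun x => (blockEndValues ν x, x)) hΘ hp, hκ,
    ← lintegral_map (g := blockEndValues ν) (f := fun v => ∫⁻ y, Θ (v, y) ∂κ ν v)
      hΘ.lintegral_kernel_prod_right' hV]
  have : IsProbabilityMeasure (μ.map (blockEndValues ν)) :=
    Measure.isProbabilityMeasure_map hV.aemeasurable
  rw [Measure.lintegral_compProd hΘ]

/-- `blockChords ν x` depends on `x` only through the block end values, so it is frozen under `κ ν`;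
`liftEnds` makes this a measurable function of those values. `W` is only required to be measurable
along `blockChords ν`, which is what is known of `segmentWeight`. -/
theorem lintegral_condDistrib_blockChords {ν : Composition n} [IsProbabilityMeasure μ]
    (hκ : μ.map (fun x => (blockEndValues ν x, x)) = (μ.map (blockEndValues ν)) ⊗ₘ κ ν)
    {W : Profile n → ℝ≥0∞} (hW : Measurable fun x => W (blockChords ν x))
    {G : Profile n × (Fin n → ℝ) → ℝ≥0∞} (hG : Measurable G) :
    ∫⁻ x, W (blockChords ν x) * ∫⁻ y, G (blockChords ν x, y)
        ∂κ ν (blockEndValuesOf ν (blockChords ν x)) ∂μ =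
      ∫⁻ x, W (blockChords ν x) * G (blockChords ν x, x) ∂μ := by
  have hlift : ∀ x, blockChords ν (liftEnds ν (blockEndValues ν x)) = blockChords ν x := fun x =>
    blockChords_congr ν (blockEndValues_liftEnds ν _)
  have hl := measurable_liftEnds ν
  have hI : Measurable fun v => blockChords ν (liftEnds ν v) := (measurable_blockChords ν).comp hl
  have hWl : Measurable fun v => W (blockChords ν (liftEnds ν v)) := hW.comp hl
  have hΘ : Measurable fun p : (Fin ν.length → ℝ) × (Fin n → ℝ) =>
      W (blockChords ν (liftEnds ν p.1)) * G (blockChords ν (liftEnds ν p.1), p.2) :=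
    (hWl.comp measurable_fst).mul (hG.comp ((hI.comp measurable_fst).prodMk measurable_snd))
  have h := lintegral_condDistrib_blockEndValues κ hκ hΘ
  simp only [hlift] at h
  rw [← h]
  refine lintegral_congr fun x => ?_
  rw [blockEndValuesOf_blockChords]
  exact (lintegral_const_mul _ (hG.comp measurable_prodMk_left)).symm

theorem map_path_eq_compProd_threeStepKernel (hn : 1 ≤ n) [IsProbabilityMeasure μ]
    (hμ : ∀ σ : Equiv.Perm (Fin n), μ.map (fun x i => x (σ i)) = μ)
    (hq : HasCondDistrib (fun p : Composition n × (Fin (n + 1) → ℝ) => p.1)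
      (fun p => concaveMajorant p.2) q (rearrangementLaw μ))
    (hκ : ∀ ν : Composition n,
      μ.map (fun x => (blockEndValues ν x, x)) = (μ.map (blockEndValues ν)) ⊗ₘ κ ν) :
    μ.map (fun x => (concaveMajorant (path x), path x)) =
      (μ.map fun x => concaveMajorant (path x)) ⊗ₘ threeStepKernel q κ := by
  have hCp := measurable_concaveMajorant_path hn
  have hpair : Measurable fun x : Fin n → ℝ => (concaveMajorant (path x), path x) :=
    hCp.prodMk measurable_path
  have : IsProbabilityMeasure (μ.map fun x => (concaveMajorant (path x), path x)) :=
    Measure.isProbabilityMeasure_map hpair.aemeasurable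
  have : IsProbabilityMeasure (μ.map fun x => concaveMajorant (path x)) :=
    Measure.isProbabilityMeasure_map hCp.aemeasurable
  refine Measure.ext_prod fun {A B} hA hB => ?_
  have hFA : Measurable (A.indicator (1 : Profile n → ℝ≥0∞)) := measurable_one.indicator hA
  have hFB : Measurable (B.indicator (1 : (Fin (n + 1) → ℝ) → ℝ≥0∞)) := measurable_one.indicator hB
  rw [Measure.compProd_apply_prod hA hB, Measure.map_apply hpair (hA.prod hB),
    ← lintegral_indicator_one (hpair (hA.prod hB)), ← lintegral_indicator hA]
  have hleft : ∀ x : Fin n → ℝ,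
      ((fun x => (concaveMajorant (path x), path x)) ⁻¹' (A ×ˢ B)).indicator 1 x =
      A.indicator (1 : Profile n → ℝ≥0∞) (concaveMajorant (path x)) *
        B.indicator (1 : (Fin (n + 1) → ℝ) → ℝ≥0∞) (path x) := by
    intro x
    by_cases h1 : concaveMajorant (path x) ∈ A <;> by_cases h2 : path x ∈ B <;>
      simp [Set.indicator, h1, h2]
  have hright : ∀ c, A.indicator (fun c => threeStepKernel q κ c B) c = ∑ ν : Composition n,
      q c {ν} * (A.indicator 1 c *
        ∫⁻ y, shiftedPathLaw ν c y B ∂κ ν (blockEndValuesOf ν c)) := by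
    intro c
    have h1 : A.indicator (fun c => threeStepKernel q κ c B) c =
        A.indicator 1 c * threeStepLaw q κ c B := by
      by_cases h : c ∈ A
      · simp only [Set.indicator_of_mem h, Pi.one_apply, one_mul]; rfl
      · simp only [Set.indicator_of_notMem h, zero_mul]
    rw [h1, threeStepLaw_apply q κ c hB, Finset.mul_sum]
    exact Finset.sum_congr rfl fun ν _ => by ring
  have hm : ∀ ν : Composition n, Measurable fun c : Profile n => A.indicator 1 c *
      ∫⁻ y, shiftedPathLaw ν c y B ∂κ ν (blockEndValuesOf ν c) := fun ν =>
    hFA.mul (measurable_lintegral_shiftedPathLaw κ ν hB)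
  have hqm : ∀ ν : Composition n, Measurable fun c : Profile n => q c {ν} * (A.indicator 1 c *
      ∫⁻ y, shiftedPathLaw ν c y B ∂κ ν (blockEndValuesOf ν c)) := fun ν =>
    (q.measurable_coe (measurableSet_singleton ν)).mul (hm ν)
  have hAB : Measurable fun x : Fin n → ℝ =>
      A.indicator (1 : Profile n → ℝ≥0∞) (concaveMajorant (path x)) *
        B.indicator (1 : (Fin (n + 1) → ℝ) → ℝ≥0∞) (path x) :=
    (hFA.comp hCp).mul (hFB.comp measurable_path)
  simp only [hleft, hright]
  -- Inserting the weights `segmentProb`, of sum `1`, on the side of the walk lets the two sides be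
  -- compared for each `ν` separately.
  rw [lintegral_finsetSum _ fun ν _ => hqm ν, ← lintegral_sum_segmentProb hAB]
  refine Finset.sum_congr rfl fun ν _ => ?_
  have hG : Measurable fun p : Profile n × (Fin n → ℝ) => shiftedPathLaw ν p.1 p.2 B :=
    (Measure.measurable_coe hB).comp (measurable_shiftedPathLaw ν)
  have hW : Measurable fun x : Fin n → ℝ => segmentWeight ν (blockChords ν x) *
      A.indicator (1 : Profile n → ℝ≥0∞) (blockChords ν x) :=
    (measurable_segmentWeight_blockChords hn ν).mul (hFA.comp (measurable_blockChords ν))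
  have hκν := lintegral_condDistrib_blockChords κ (hκ ν)
    (W := fun c => segmentWeight ν c * A.indicator 1 c) hW hG
  simp only [mul_assoc] at hκν
  -- First `q` is replaced by its explicit weight on block chords, then the sample from `κ ν` by the
  -- increments themselves; what remains is the averaging identity over cyclic shifts.
  rw [lintegral_condDistrib_mul hn hμ hq ν (hm ν), hκν]
  refine (lintegral_segmentProb_mul hn hμ ν hFA (hFB.comp measurable_path)).trans ?_
  refine lintegral_congr fun x => ?_
  rw [shiftedPathLaw, uniformMix_apply]
  simp only [Measure.dirac_apply' _ hB, Function.comp_apply]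

end Conditional

end ConcaveMajorantWalk

open ConcaveMajorantWalk in
theorem mainTheorem11 {Ω : Type*} [MeasurableSpace Ω] (P : Measure Ω) [IsProbabilityMeasure P]
    (n : ℕ) (hn : 1 ≤ n) (X : Fin n → Ω → ℝ) (hX : ∀ i, Measurable (X i))
    (hexch : Exchangeable P X)
    -- `q` is any version of the regular conditional law of the segment composition
    -- given the concave majorant of the rearranged walk
    (q : Kernel (Profile n) (Composition n)) [IsMarkovKernel q]
    (hq : HasCondDistrib (fun p : Composition n × (Fin (n + 1) → ℝ) => p.1)
      (fun p => concaveMajorant p.2) q (rearrangementLaw (P.map fun ω i => X i ω)))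
    -- `κ ν` is any version of the regular conditional law of the increments
    -- given the positions of the walk at the block end points of `ν`
    (κ : (ν : Composition n) → Kernel (Fin ν.length → ℝ) (Fin n → ℝ))
    [∀ ν, IsMarkovKernel (κ ν)]
    (hκ : ∀ ν : Composition n, HasCondDistrib (fun ω i => X i ω)
      (fun ω => blockEndValues ν fun i => X i ω) (κ ν) P) :
    -- the explicit conditional density of the segment composition
    (∀ (ν : Composition n) (A : Set (Profile n)), MeasurableSet A →
      ∫⁻ c in A, q c {ν} ∂(P.map fun ω => concaveMajorant (path fun i => X i ω)) =
        ∫⁻ ω in {ω | blockChords ν (fun i => X i ω) ∈ A},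
          segmentWeight ν (blockChords ν fun i => X i ω) ∂P) ∧
    -- the three-step law is the regular conditional law of the walk given its concave majorant
    (∀ᵐ c ∂(P.map fun ω => concaveMajorant (path fun i => X i ω)),
      threeStepLaw q κ c =
        condDistrib (fun ω => path fun i => X i ω)
          (fun ω => concaveMajorant (path fun i => X i ω)) P c) := by
  have hXm : Measurable fun ω i => X i ω := measurable_pi_lambda _ hX
  set μ : Measure (Fin n → ℝ) := P.map fun ω i => X i ω with hμdef
  have : IsProbabilityMeasure μ := Measure.isProbabilityMeasure_map hXm.aemeasurable
  have hμ : ∀ σ : Equiv.Perm (Fin n), μ.map (fun x i => x (σ i)) = μ := fun σ => by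
    rw [hμdef, Measure.map_map (measurable_pi_lambda _ fun i => measurable_pi_apply _) hXm]
    exact hexch σ
  have hκμ : ∀ ν : Composition n,
      μ.map (fun x => (blockEndValues ν x, x)) = (μ.map (blockEndValues ν)) ⊗ₘ κ ν := fun ν => by
    have hV := measurable_blockEndValues ν
    have hp : Measurable fun x => (blockEndValues ν x, x) := hV.prodMk measurable_id
    rw [hμdef, Measure.map_map hp hXm, Measure.map_map hV hXm]
    exact (hκ ν).map_eq
  have hCp := measurable_concaveMajorant_path hn
  have hC : P.map (fun ω => concaveMajorant (path fun i => X i ω)) =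
      μ.map fun x => concaveMajorant (path x) := by
    rw [hμdef, Measure.map_map hCp hXm]
    rfl
  refine ⟨fun ν A hA => ?_, ?_⟩
  · have hF : Measurable (A.indicator (1 : Profile n → ℝ≥0∞)) := measurable_one.indicator hA
    have hI := measurable_blockChords ν
    have hIX : Measurable fun ω => blockChords ν fun i => X i ω := hI.comp hXm
    have hs := measurable_segmentWeight_blockChords hn ν
    have hW : Measurable fun x => segmentWeight ν (blockChords ν x) *
        A.indicator 1 (blockChords ν x) := hs.mul (hF.comp hI)
    have h := lintegral_condDistrib_mul hn hμ hq ν hF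
    rw [hμdef, lintegral_map hW hXm, ← hμdef, ← hC] at h
    have hAX : MeasurableSet {ω | blockChords ν (fun i => X i ω) ∈ A} := hIX hA
    rw [← lintegral_indicator hA, ← lintegral_indicator hAX]
    refine Eq.trans (lintegral_congr fun c => ?_) (h.trans (lintegral_congr fun ω => ?_))
    · by_cases hc : c ∈ A <;> simp [hc]
    · by_cases hω : (blockChords ν fun i => X i ω) ∈ A <;> simp [hω]
  · have hS : Measurable fun ω => path fun i => X i ω := measurable_path.comp hXm
    have hpair : P.map (fun ω => (concaveMajorant (path fun i => X i ω), path fun i => X i ω)) =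
        P.map (fun ω => concaveMajorant (path fun i => X i ω)) ⊗ₘ threeStepKernel q κ := by
      rw [hC, ← map_path_eq_compProd_threeStepKernel q κ hn hμ hq hκμ, hμdef,
        Measure.map_map (hCp.prodMk measurable_path) hXm]
      rfl
    -- A kernel that disintegrates the joint law of majorant and walk is almost everywhere the
    -- regular conditional law.
    filter_upwards [condDistrib_ae_eq_of_measure_eq_compProd
      (fun ω => concaveMajorant (path fun i => X i ω)) hS.aemeasurable hpair] with c hc
    exact hc.symm
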